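/- Let $F$ be a field of characteristic $p>0$. For a field extension $K/F$ and an $F$-linear derivation $\delta$ of $K$, let $K[t;\delta]$ be the ring of polynomials $\sum a_it^i$ ($a_i\in K$) with multiplication determined by $ta=at+\delta(a)$. Let $g\in F[t]$ be the minimum polynomial of $\delta$, viewed as an $F$-linear map $K\to K$. For $d_0\in F$ put $f=g-d_0\in F[t]\subset K[t;\delta]$; the quotient $(K,\delta,d_0)=K[t;\delta]/(f)$ is called a differential extension of $K$. For $b\in K$ put $V_{p^j}(b)=\sum_{i=0}^{j}\bigl(\delta^{p^i-1}(b)\bigr)^{p^{j-i}}$, so that $V_p(b)=b^p+\delta^{p-1}(b)$ and $(t-b)^{p^j}=t^{p^j}-V_{p^j}(b)$ in $K[t;\delta]$. A $p$-algebra over $F$ is a finite-dimensional central simple $F$-algebra whose index is a power of $p$. A cyclic Galois $F$-algebra of degree $m$ is a commutative étale $F$-algebra $L$ of dimension $m$ with an $F$-automorphism $\sigma$ such that $\sigma^m=1$ and $L^{\sigma}=F$. An $F$-algebra is cyclic of degree $m$ if it is isomorphic to $(L/F,\sigma,c)=\bigoplus_{i=0}^{m-1}Lz^i$, with $zx=\sigma(x)z$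 for $x\in L$ and $z^m=c$, for some such $L,\sigma$ and some $c\in F^\times$. Theorem. Let $B$ be a $p$-algebra of degree $m$ over $F$ which is split by a purely inseparable field extension $K/F$ of exponent one with $[K:F]=m$. Then $m=p^e$ for some $e\ge 1$, and: (i) There are an $F$-linear derivation $\delta$ of $K$ with field of constants $F$ and minimum polynomial $g$ of degree $m$, and $d_0\in F$, such that $B\cong(K,\delta,d_0)$ as $F$-algebras. Moreover $B$ is a cyclic algebra $(L/F,\sigma,c)$ of degree $m$; here $L$ can be chosen to be a field (a cyclic Galois field extension of $F$ of degree $m$) if $B\not\cong\mathrm{Mat}_m(F)$ or if $F$ has a cyclic Galois field extension of degree $m$. Furthermore, for all $\delta$, $d_0$ as in (i) and every isomorphism $\varphi:(K,\delta,d_0)\to B$ of $F$-algebras, with $f=g-d_0$: the minimum polynomial has the form $g=t^{p^e}+c_1t^{p^{e-1}}+\dots+c_et$ with $c_i\in F$; $f$ is central in $K[t;\delta]$; the center of $K[t;\delta]$ is $F[z]$ with $z=g-d_0$; and (ii) $F[t]/(f)$ is a subfield of $B$ of degree $p^e$ over $F$ (that is, it is a field of degree $p^e$ over $F$, and $t\mapsto\varphi(t)$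 defines an embedding of $F$-algebras $F[t]/(f)\to B$) if and only if $f$ is irreducible in $F[t]$; (iii) $f$ is irreducible in $K[t;\delta]$ if and only if $B$ is a division algebra; (iv) $B\cong\mathrm{Mat}_{p^e}(F)$ as $F$-algebras if and only if there is $b\in K$ with $d_0=V_g(b)=V_{p^e}(b)+c_1V_{p^{e-1}}(b)+\dots+c_eb$. -/

import Mathlib

open Polynomial TensorProduct

universe u v w

noncomputable section

/-! ### The differential polynomial ring `K[t;δ]` -/

section DiffPoly

variable {F : Type u} {K : Type v} [Field F] [Field K] [Algebra F K]

/-- The differential polynomial ring `K[t;δ]`: its elements are the polynomials `∑ aᵢ tⁱ` with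
coefficients in `K` written on the left, with termwise addition and with the multiplication
determined by `t a = a t + δ(a)` (see `DiffPoly.mul_def`, `DiffPoly.t_mul_const`). -/
def DiffPoly (_δ : Derivation F K K) : Type v := K[X]

namespace DiffPoly

variable (δ : Derivation F K K)

instance : AddCommGroup (DiffPoly δ) := inferInstanceAs (AddCommGroup K[X])

instance : Module F (DiffPoly δ) := inferInstanceAs (Module F K[X])

/-- The action of `δ` on the coefficients of a polynomial. -/
def mapCoeff : K[X] →ₗ[F] K[X] :=
  Polynomial.lsum fun i => ((monomial i : K →ₗ[K] K[X]).restrictScalars F) ∘ₗ (δ : K →ₗ[F] K)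

/-- Left multiplication by `t`, that is
`t · ∑ aᵢ tⁱ = ∑ aᵢ tⁱ⁺¹ + ∑ δ(aᵢ) tⁱ`. -/
def tMul : Module.End F K[X] :=
  (LinearMap.mulLeft K (X : K[X])).restrictScalars F + mapCoeff δ

/-- Left multiplication by `∑ aᵢ tⁱ`, that is `h ↦ ∑ aᵢ (tⁱ · h)`. -/
def leftMul : K[X] →ₗ[F] Module.End F K[X] :=
  Polynomial.lsum fun i =>
    { toFun := fun a => (LinearMap.mulLeft K (C a)).restrictScalars F * tMul δ ^ i
      map_add' := fun a b => by
        ext1 h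
        simp [add_mul]
      map_smul' := fun c a => by
        ext1 h
        simp [← Polynomial.smul_C] }

theorem mapCoeff_monomial (i : ℕ) (a : K) : mapCoeff δ (monomial i a) = monomial i (δ a) := by
  simp [mapCoeff]

theorem tMul_monomial (i : ℕ) (a : K) :
    tMul δ (monomial i a) = monomial (i + 1) a + monomial i (δ a) := by
  simp [tMul, mapCoeff_monomial, X_mul_monomial]

theorem leftMul_monomial (i : ℕ) (a : K) (h : K[X]) :
    leftMul δ (monomial i a) h = C a * (tMul δ ^ i) h := by
  simp [leftMul]

theorem tMul_C_mul (a : K) (h : K[X]) : tMul δ (C a * h) = C a * tMul δ h + C (δ a) * h := by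
  induction h using Polynomial.induction_on' with
  | add p q hp hq => simp only [mul_add, map_add, hp, hq]; ring
  | monomial i b =>
    simp only [C_mul_monomial, tMul_monomial, Derivation.leibniz, smul_eq_mul, mul_add, map_add]
    rw [mul_comm (δ a) b]
    ring

theorem leftMul_tMul (g h : K[X]) : leftMul δ (tMul δ g) h = tMul δ (leftMul δ g h) := by
  induction g using Polynomial.induction_on' with
  | add p q hp hq => simp only [map_add, LinearMap.add_apply, hp, hq]
  | monomial i b =>
    simp only [tMul_monomial, map_add, LinearMap.add_apply, leftMul_monomial, tMul_C_mul,
      pow_succ', Module.End.mul_apply]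

theorem leftMul_C_mul (a : K) (g h : K[X]) :
    leftMul δ (C a * g) h = C a * leftMul δ g h := by
  induction g using Polynomial.induction_on' with
  | add p q hp hq => simp only [mul_add, map_add, LinearMap.add_apply, hp, hq]
  | monomial i b =>
    simp only [C_mul_monomial, leftMul_monomial, map_mul, mul_assoc]

theorem leftMul_tMul_pow (n : ℕ) (g h : K[X]) :
    leftMul δ ((tMul δ ^ n) g) h = (tMul δ ^ n) (leftMul δ g h) := by
  induction n with
  | zero => simp
  | succ n ih => simp only [pow_succ', Module.End.mul_apply, leftMul_tMul, ih]

theorem leftMul_leftMul (f g h : K[X]) :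
    leftMul δ (leftMul δ f g) h = leftMul δ f (leftMul δ g h) := by
  induction f using Polynomial.induction_on' with
  | add p q hp hq => simp only [map_add, LinearMap.add_apply, hp, hq]
  | monomial i b => simp only [leftMul_monomial, leftMul_C_mul, leftMul_tMul_pow]

theorem leftMul_one (f : K[X]) : leftMul δ f 1 = f := by
  have key : ∀ i : ℕ, (tMul δ ^ i) (1 : K[X]) = X ^ i := by
    intro i
    induction i with
    | zero => simp
    | succ i ih =>
      rw [pow_succ', Module.End.mul_apply, ih, ← monomial_one_right_eq_X_pow, tMul_monomial]
      simp [monomial_one_right_eq_X_pow]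
  induction f using Polynomial.induction_on' with
  | add p q hp hq => simp only [map_add, LinearMap.add_apply, hp, hq]
  | monomial i b => rw [leftMul_monomial, key, C_mul_X_pow_eq_monomial]

theorem one_leftMul (f : K[X]) : leftMul δ 1 f = f := by
  rw [← C_1, ← monomial_zero_left, leftMul_monomial]
  simp

instance : Ring (DiffPoly δ) :=
  { (inferInstanceAs (AddCommGroup K[X]) : AddCommGroup (DiffPoly δ)) with
    one := (1 : K[X])
    mul := fun f g => leftMul δ f g
    mul_assoc := leftMul_leftMul δ
    one_mul := one_leftMul δ
    mul_one := leftMul_one δ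
    left_distrib := fun f g h => map_add (leftMul δ f) g h
    right_distrib := fun f g h => LinearMap.congr_fun (map_add (leftMul δ) f g) h
    zero_mul := fun f => LinearMap.congr_fun (map_zero (leftMul δ)) f
    mul_zero := fun f => map_zero (leftMul δ f) }

instance : Algebra F (DiffPoly δ) :=
  Algebra.ofModule
    (fun r f g => LinearMap.congr_fun (map_smul (leftMul δ) r f) g)
    (fun r f g => map_smul (leftMul δ f) r g)

/-- The element of `K[t;δ]` with given coefficients. -/
def ofPoly (f : K[X]) : DiffPoly δ := f

/-- The constant `a ∈ K` as an element of `K[t;δ]`. -/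
def const (a : K) : DiffPoly δ := ofPoly δ (C a)

/-- The indeterminate of `K[t;δ]`. -/
def t : DiffPoly δ := ofPoly δ X

theorem mul_def (f g : K[X]) :
    ofPoly δ f * ofPoly δ g = ofPoly δ (f.sum fun i a => C a * (tMul δ ^ i) g) := by
  change leftMul δ f g = _
  simp only [leftMul, Polynomial.lsum_apply, Polynomial.sum_def, LinearMap.sum_apply]
  rfl

theorem ofPoly_eq_sum (f : K[X]) :
    ofPoly δ f = f.sum fun i a => const δ a * t δ ^ i := by
  have key : ∀ i : ℕ, t δ ^ i = ofPoly δ (X ^ i) := by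
    intro i
    induction i with
    | zero => rfl
    | succ i ih =>
      rw [pow_succ', ih]
      change leftMul δ X (X ^ i) = X ^ (i + 1)
      rw [← monomial_one_one_eq_X, leftMul_monomial, monomial_one_one_eq_X,
        ← monomial_one_right_eq_X_pow, pow_one, tMul_monomial]
      simp [monomial_one_right_eq_X_pow]
  have key2 : ∀ (i : ℕ) (a : K), const δ a * t δ ^ i = ofPoly δ (monomial i a) := by
    intro i a
    rw [key]
    change leftMul δ (C a) (X ^ i) = monomial i a
    rw [← monomial_zero_left, leftMul_monomial]
    simp [C_mul_X_pow_eq_monomial]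
  simp only [key2]
  exact (f.sum_monomial_eq).symm

/-- The defining relation `t a = a t + δ(a)`. -/
theorem t_mul_const (a : K) : t δ * const δ a = const δ a * t δ + const δ (δ a) := by
  change leftMul δ X (C a) = leftMul δ (C a) X + C (δ a)
  have h1 : leftMul δ X (C a) = tMul δ (C a) := by
    rw [← monomial_one_one_eq_X, leftMul_monomial]
    simp
  have h2 : leftMul δ (C a) X = C a * X := by
    have h := leftMul_monomial δ 0 a X
    rwa [monomial_zero_left, pow_zero, Module.End.one_apply] at h
  have h3 := tMul_monomial δ 0 a
  rw [monomial_zero_left, monomial_zero_left] at h3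
  rw [h1, h2, h3, zero_add, C_mul_X_eq_monomial]

theorem const_mul (a b : K) : const δ (a * b) = const δ a * const δ b := by
  change C (a * b) = leftMul δ (C a) (C b)
  have h := leftMul_monomial δ 0 a (C b)
  rw [monomial_zero_left, pow_zero, Module.End.one_apply] at h
  rw [h, map_mul]

end DiffPoly

/-! ### Algebraic derivations and differential extensions -/

/-- The field of constants of `δ` is exactly (the image of) `F`; the inclusion of `F` in the
constants is automatic as `δ` is `F`-linear. -/
def HasConstants (δ : Derivation F K K) : Prop :=
  ∀ a : K, δ a = 0 → a ∈ (algebraMap F K).range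

/-- The minimum polynomial over `F` of the derivation `δ`, viewed as an `F`-linear map `K → K`. -/
def derivMinpoly (δ : Derivation F K K) : F[X] :=
  minpoly F ((δ : K →ₗ[F] K) : Module.End F K)

/-- The commutative polynomial `g - d₀ ∈ F[t]`, with `g` the minimum polynomial of `δ`. -/
def extPoly (δ : Derivation F K K) (d₀ : F) : F[X] :=
  derivMinpoly δ - C d₀

/-- The differential polynomial `f(t) = g(t) - d₀ ∈ K[t;δ]`. -/
def extDiffPoly (δ : Derivation F K K) (d₀ : F) : DiffPoly δ :=
  aeval (DiffPoly.t δ) (extPoly δ d₀)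

/-- The differential extension `(K, δ, d₀) = K[t;δ]/(f)`, `f(t) = g(t) - d₀`. -/
abbrev DiffExt (δ : Derivation F K K) (d₀ : F) : Type v :=
  (TwoSidedIdeal.span {extDiffPoly δ d₀}).ringCon.Quotient

/-- The class of `t` in `(K, δ, d₀)`. -/
def DiffExt.root (δ : Derivation F K K) (d₀ : F) : DiffExt δ d₀ :=
  (TwoSidedIdeal.span {extDiffPoly δ d₀}).ringCon.mk' (DiffPoly.t δ)

/-- `V_{p^j}(b) = ∑_{i=0}^{j} (δ^{p^i - 1}(b))^{p^{j-i}}`; thus `V_1(b) = b`,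
`V_p(b) = b^p + δ^{p-1}(b)`, and in characteristic `p` one has
`(t - b)^{p^j} = t^{p^j} - V_{p^j}(b)` in `K[t;δ]`. -/
def pV (p : ℕ) (δ : Derivation F K K) (j : ℕ) (b : K) : K :=
  ∑ i ∈ Finset.range (j + 1), ((⇑δ)^[p ^ i - 1] b) ^ p ^ (j - i)

/-- `V_g(b) = ∑_{j=0}^{e} g_j V_{p^j}(b)` for a `p`-polynomial `g = ∑_{j=0}^{e} g_j t^{p^j}`. -/
def polyV (p e : ℕ) (δ : Derivation F K K) (g : F[X]) (b : K) : K :=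
  ∑ j ∈ Finset.range (e + 1), g.coeff (p ^ j) • pV p δ j b

end DiffPoly

/-! ### Central simple algebras -/

/-- A `p`-algebra over the field `F` (of characteristic `p`): a finite-dimensional central simple
`F`-algebra `B ≅ Mat_r(D)`, with `D` a division algebra, whose index (the degree of `D`) is a
power of `p`. -/
structure IsPAlgebra (p : ℕ) (F : Type u) (B : Type w) [Field F] [Ring B] [Algebra F B] :
    Prop where
  central : Algebra.IsCentral F B
  simple : IsSimpleRing B
  finite : FiniteDimensional F B
  index : ∃ (n r : ℕ) (D : Type w) (_ : DivisionRing D) (_ : Algebra F D),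
    Module.finrank F D = (p ^ n) ^ 2 ∧ Nonempty (B ≃ₐ[F] Matrix (Fin r) (Fin r) D)

/-- The field extension `K/F` splits the `F`-algebra `B`. -/
def SplitBy (F : Type u) (K : Type v) (B : Type w) [Field F] [Field K] [Algebra F K] [Ring B]
    [Algebra F B] : Prop :=
  ∃ n : ℕ, n ≠ 0 ∧ Nonempty (K ⊗[F] B ≃ₐ[K] Matrix (Fin n) (Fin n) K)

/-- `B` is a division algebra. -/
def IsDivisionAlg (B : Type w) [Ring B] : Prop :=
  Nontrivial B ∧ ∀ x : B, x ≠ 0 → IsUnit x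

/-- `L` is a cyclic Galois `F`-algebra of degree `m` with generator `σ`: an étale `F`-algebra of
dimension `m` with `σ^m = 1` whose `σ`-fixed elements are those of `F`. If `L` is a field, this
says that `L/F` is a cyclic Galois extension of degree `m` with Galois group generated by `σ`. -/
structure IsCyclicGaloisAlg (F : Type u) (L : Type w) [Field F] [CommRing L] [Algebra F L]
    (σ : L ≃ₐ[F] L) (m : ℕ) : Prop where
  etale : Algebra.Etale F L
  finrank_eq : Module.finrank F L = m
  pow_eq_one : σ ^ m = 1
  fixed : ∀ x : L, σ x = x → x ∈ (algebraMap F L).range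

/-- `B` is the cyclic algebra `(L/F, σ, c) = L ⊕ L z ⊕ ⋯ ⊕ L z^{m-1}` with `z x = σ(x) z` for
`x ∈ L` and `z^m = c`. -/
def IsCyclicAlg (F : Type u) (L B : Type w) [Field F] [CommRing L] [Algebra F L] [Ring B]
    [Algebra F B] (σ : L ≃ₐ[F] L) (c : Fˣ) (m : ℕ) : Prop :=
  ∃ (ι : L →ₐ[F] B) (z : B),
    (∀ x : L, z * ι x = ι (σ x) * z) ∧ z ^ m = algebraMap F B (c : F) ∧
    Function.Bijective fun x : Fin m → L => ∑ i : Fin m, ι (x i) * z ^ (i : ℕ)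

end

/-! Let m = [K:F]. A derivation δ of K with constants F plays the role of a Galois generator. A
nonzero K-space of vectors stable under δ contains a vector over F (`exists_constant_vector_mem`).
This shows that the minimum polynomial g has degree m, and that if τa = aτ + δ(a) in an F-algebra,
then 1, τ, ..., τ^{m-1} are left independent over K (`leftEval_injective_of_degree_lt`). Comparing
coefficients in the relation g(δ)a = a g(δ) then forces g to be a p-polynomial. In characteristic p,
ad(τ)^{p^j} = ad(τ^{p^j}), so g(τ) commutes with K and f is central; Jacobson's formula gives g(τ +
b) = g(τ) + V_g(b).

The division criterion is division with remainder in K[t;δ]. For the splitting criterion, a split B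
acts on F^m, which is a line Kv; from tv = bv one reads off d₀ = V_g(b). Conversely t ↦ δ + b
represents (K,δ,d₀) on K.

Existence: K arises by adjoining p-th roots one at a time, and a nilpotent δ with constants F can be
extended at every step (`exists_nilpotent_derivation`), so g = t^m with m = p^e. Since K splits B,
it embeds in B and δ becomes inner, say by τ; then τ^m is central, which gives d₀ and, by counting
dimensions, the presentation of B.

Cyclicity: translate τ by a scalar to a unit z and let σ be conjugation by z. Elements b with
σ^{p^k}(b) = b + 1 exist for all k < e, and elements fixed by σ have their p^e-th power in F. This
suffices to build an étale subalgebra L of B as a tower of Artin–Schreier steps with σ as generator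
(`IsCyclicTower.succ`).

To replace L by a field, reduce modulo a maximal ideal: the residue field is cyclic of degree p^s,
and B acts on a space of dimension m over it. If s = 0 then B is split. Otherwise the residue field
embeds in a cyclic field of degree m (`exists_cyclic_extension_succ`), which splits B and therefore,
by Skolem–Noether, presents B as a cyclic algebra. -/

noncomputable section

/-! ### Elements τ inducing δ on K, and the minimum polynomial of δ -/

section Pairs

variable {F : Type u} {K : Type v} [Field F] [Field K] [Algebra F K]

/-- A nonzero `K`-subspace of `K^ι` stable under a derivation contains a nonzero vector of
constants. -/
theorem exists_constant_vector_mem {δ : Derivation F K K} (hδ : HasConstants δ) {ι : Type*}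
    [Fintype ι] (W : Submodule K (ι → K)) (hW : ∀ w ∈ W, (fun i => δ (w i)) ∈ W) (hne : W ≠ ⊥) :
    ∃ v : ι → F, v ≠ 0 ∧ (fun i => algebraMap F K (v i)) ∈ W := by
  classical
  obtain ⟨w, hwW, hw0⟩ := W.ne_bot_iff.1 hne
  induction hn : (Finset.univ.filter fun i => w i ≠ 0).card using Nat.strong_induction_on
    generalizing w with
  | _ n ih =>
    obtain ⟨i₀, hi₀⟩ := Function.ne_iff.1 hw0
    rw [Pi.zero_apply] at hi₀
    set w' : ι → K := (w i₀)⁻¹ • w with hw'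
    have hw'W : w' ∈ W := W.smul_mem _ hwW
    have h1 : w' i₀ = 1 := by simp [hw', hi₀]
    by_cases h0 : (fun i => δ (w' i)) = 0
    · have hc : ∀ i, ∃ c : F, algebraMap F K c = w' i := fun i => hδ _ (congrFun h0 i)
      choose c hc using hc
      refine ⟨c, fun h => ?_, by simpa only [hc] using hw'W⟩
      have := hc i₀
      rw [h, h1] at this
      simp at this
    -- The coordinate `i₀` of `w'` is 1, so δ kills it and creates no new nonzero coordinate: the
    -- support shrinks strictly.
    · refine ih _ ?_ _ (hW _ hw'W) h0 rfl
      rw [← hn]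
      apply Finset.card_lt_card
      refine ⟨fun i hi => ?_, fun h => ?_⟩
      · simp only [Finset.mem_filter, Finset.mem_univ, true_and] at hi ⊢
        intro h
        apply hi
        simp [hw', h]
      · have := h (Finset.mem_filter.2 ⟨Finset.mem_univ i₀, hi₀⟩)
        simp [h1] at this

variable {δ : Derivation F K K} {A : Type*} [Ring A] [Algebra F A] {ι : K →ₐ[F] A} {τ : A}

theorem iterate_ad_apply (h : ∀ a, τ * ι a = ι a * τ + ι (δ a)) (n : ℕ) (a : K) :
    ((LinearMap.mulLeft F τ - LinearMap.mulRight F τ) ^ n) (ι a) = ι (δ^[n] a) := by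
  induction n with
  | zero => simp
  | succ n ih =>
    rw [pow_succ', Module.End.mul_apply, ih, Function.iterate_succ_apply']
    simp [h]

/-- Left multiplication by τ is ad(τ) plus right multiplication, and these two commute, so the
binomial theorem applies. -/
theorem pow_mul_eq_sum (h : ∀ a, τ * ι a = ι a * τ + ι (δ a)) (n : ℕ) (a : K) :
    τ ^ n * ι a = ∑ i ∈ Finset.range (n + 1), n.choose i • (ι (δ^[i] a) * τ ^ (n - i)) := by
  have hc : Commute (LinearMap.mulLeft F τ - LinearMap.mulRight F τ) (LinearMap.mulRight F τ) :=
    (LinearMap.commute_mulLeft_right (R := F) τ τ).sub_left (Commute.refl _)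
  have h1 : τ ^ n * ι a = ((LinearMap.mulLeft F τ) ^ n) (ι a) := by
    rw [LinearMap.pow_mulLeft, LinearMap.mulLeft_apply]
  rw [h1, ← sub_add_cancel (LinearMap.mulLeft F τ) (LinearMap.mulRight F τ), hc.add_pow,
    LinearMap.sum_apply]
  refine Finset.sum_congr rfl fun i _ => ?_
  rw [(hc.pow_pow i (n - i)).eq, mul_assoc, Module.End.mul_apply, Module.End.mul_apply,
    LinearMap.pow_mulRight, LinearMap.mulRight_apply, Module.End.natCast_apply, map_nsmul,
    iterate_ad_apply h, smul_mul_assoc]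

/-- Freshman's dream for the commuting left and right multiplications: ad(τ)^{p^n} = ad(τ^{p^n}).
Thus τ^{p^n} induces the derivation δ^{p^n}. -/
theorem charPow_mul (p : ℕ) [Fact p.Prime] [CharP F p]
    (h : ∀ a, τ * ι a = ι a * τ + ι (δ a)) (n : ℕ) (a : K) :
    τ ^ p ^ n * ι a = ι a * τ ^ p ^ n + ι (δ^[p ^ n] a) := by
  cases subsingleton_or_nontrivial A
  · exact Subsingleton.elim _ _
  have : CharP (Module.End F A) p := charP_of_injective_algebraMap
    (FaithfulSMul.algebraMap_injective F (Module.End F A)) p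
  have h1 := iterate_ad_apply h (p ^ n) a
  rw [sub_pow_char_pow_of_commute _ _ (LinearMap.commute_mulLeft_right (R := F) τ τ)] at h1
  rw [← h1, LinearMap.pow_mulLeft, LinearMap.pow_mulRight]
  simp only [LinearMap.sub_apply, LinearMap.mulLeft_apply, LinearMap.mulRight_apply]
  abel

/-- Multiplications and `δ` in the ring of `F`-linear endomorphisms of `K`. -/
theorem end_mul_lmul (δ : Derivation F K K) (a : K) :
    ((δ : K →ₗ[F] K) : Module.End F K) * Algebra.lmul F K a =
      Algebra.lmul F K a * ((δ : K →ₗ[F] K) : Module.End F K) + Algebra.lmul F K (δ a) := by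
  ext x
  simp [mul_comm]

theorem coe_pow_apply (δ : Derivation F K K) (n : ℕ) (x : K) :
    (((δ : K →ₗ[F] K) : Module.End F K) ^ n) x = δ^[n] x := by
  rw [Module.End.pow_apply]; rfl

/-- This is `charPow_mul` inside the endomorphism ring of K, with δ itself as τ. -/
theorem leibniz_iterate_charPow (p : ℕ) [Fact p.Prime] [CharP F p] (δ : Derivation F K K) (n : ℕ)
    (a b : K) : δ^[p ^ n] (a * b) = a * δ^[p ^ n] b + b * δ^[p ^ n] a := by
  have h := charPow_mul p (end_mul_lmul δ) n a
  have := LinearMap.congr_fun h b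
  simp only [Module.End.mul_apply, LinearMap.add_apply, coe_pow_apply] at this
  simpa [mul_comm] using this

/-- The derivation `δ^{p^n}`. -/
def Derivation.charPow (p : ℕ) [Fact p.Prime] [CharP F p] (δ : Derivation F K K) (n : ℕ) :
    Derivation F K K :=
  Derivation.mk' (((δ : K →ₗ[F] K) : Module.End F K) ^ p ^ n) fun a b => by
    simp only [coe_pow_apply, smul_eq_mul]
    exact leibniz_iterate_charPow p δ n a b

theorem Derivation.charPow_apply (p : ℕ) [Fact p.Prime] [CharP F p] (δ : Derivation F K K) (n : ℕ)
    (a : K) : δ.charPow p n a = δ^[p ^ n] a := by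
  rw [← coe_pow_apply]; rfl

/-- Left evaluation of a polynomial over `K` at `τ`. -/
def leftEval (ι : K →ₐ[F] A) (τ : A) : K[X] →ₗ[F] A :=
  Polynomial.lsum fun i => LinearMap.mulRight F (τ ^ i) ∘ₗ ι.toLinearMap

theorem leftEval_monomial (ι : K →ₐ[F] A) (τ : A) (i : ℕ) (a : K) :
    leftEval ι τ (monomial i a) = ι a * τ ^ i := by
  simp [leftEval]

theorem leftEval_C_mul (ι : K →ₐ[F] A) (τ : A) (a : K) (P : K[X]) :
    leftEval ι τ (C a * P) = ι a * leftEval ι τ P := by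
  induction P using Polynomial.induction_on' with
  | add p q hp hq => simp only [mul_add, map_add, hp, hq]
  | monomial i b => rw [C_mul_monomial, leftEval_monomial, leftEval_monomial, map_mul, mul_assoc]

theorem leftEval_mul_X (ι : K →ₐ[F] A) (τ : A) (P : K[X]) :
    leftEval ι τ (P * X) = leftEval ι τ P * τ := by
  induction P using Polynomial.induction_on' with
  | add p q hp hq => simp only [add_mul, map_add, hp, hq]
  | monomial i b => rw [monomial_mul_X, leftEval_monomial, leftEval_monomial, pow_succ, mul_assoc]

theorem leftEval_map (ι : K →ₐ[F] A) (τ : A) (q : F[X]) :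
    leftEval ι τ (q.map (algebraMap F K)) = aeval τ q := by
  induction q using Polynomial.induction_on' with
  | add p q hp hq => simp only [Polynomial.map_add, map_add, hp, hq]
  | monomial i b =>
    rw [map_monomial, leftEval_monomial, aeval_monomial, AlgHom.commutes]

theorem leftEval_eq_sum (ι : K →ₐ[F] A) (τ : A) {n : ℕ} (b : Fin n → K) :
    leftEval ι τ (∑ i : Fin n, monomial (i : ℕ) (b i)) = ∑ i, ι (b i) * τ ^ (i : ℕ) := by
  simp only [map_sum, leftEval_monomial]

theorem mul_leftEval (h : ∀ a, τ * ι a = ι a * τ + ι (δ a)) (P : K[X]) :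
    τ * leftEval ι τ P = leftEval ι τ P * τ + leftEval ι τ (DiffPoly.mapCoeff δ P) := by
  induction P using Polynomial.induction_on' with
  | add p q hp hq => simp only [mul_add, add_mul, map_add, hp, hq]; abel
  | monomial i b =>
    rw [DiffPoly.mapCoeff_monomial, leftEval_monomial, leftEval_monomial, ← mul_assoc, h, add_mul,
      mul_assoc, mul_assoc, ← pow_succ, ← pow_succ']

theorem degree_C_mul_map_le (a : K) (q : F[X]) :
    (C a * q.map (algebraMap F K)).degree ≤ q.degree :=
  (degree_mul_le _ _).trans ((add_le_add degree_C_le degree_map_le).trans_eq (zero_add _))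

/-- The binomial expansion of τ^n a is made linear in the polynomial by Hasse derivatives, which
avoid dividing by factorials. The term j = 0 is a·q(τ), so the terms j ≥ 1 are the commutator of
q(τ) with a and have smaller degree. -/
theorem aeval_mul_eq_leftEval (h : ∀ a, τ * ι a = ι a * τ + ι (δ a)) {N : ℕ} (a : K) (q : F[X])
    (hq : q.natDegree ≤ N) :
    aeval τ q * ι a = leftEval ι τ
      (∑ j ∈ Finset.range (N + 1), C (δ^[j] a) * (hasseDeriv j q).map (algebraMap F K)) := by
  refine induction_with_natDegree_le (motive := fun q => aeval τ q * ι a = leftEval ι τ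
    (∑ j ∈ Finset.range (N + 1), C (δ^[j] a) * (hasseDeriv j q).map (algebraMap F K)))
    N ?_ ?_ ?_ q hq
  · simp
  · intro n r hr hn
    simp only [map_sum, leftEval_C_mul, leftEval_map]
    rw [C_mul_X_pow_eq_monomial, aeval_monomial, mul_assoc, pow_mul_eq_sum h, Finset.mul_sum]
    rw [← Finset.sum_subset (Finset.range_mono (Nat.succ_le_succ hn))]
    · refine Finset.sum_congr rfl fun j _ => ?_
      rw [hasseDeriv_monomial, aeval_monomial, map_mul, map_natCast]
      simp only [nsmul_eq_mul, ← Algebra.smul_def, mul_assoc]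
      rw [← mul_assoc (ι _ : A), ← (Nat.cast_commute (n.choose j) (ι (δ^[j] a))).eq, mul_assoc,
        mul_smul_comm, mul_smul_comm]
    · intro j _ hj
      rw [hasseDeriv_monomial, Nat.choose_eq_zero_of_lt (by simpa using hj)]
      simp
  · intro f g _ _ hf' hg''
    simp only [map_add, add_mul, hf', hg'', Polynomial.map_add, mul_add, Finset.sum_add_distrib]

/-- A Wronskian argument. If the degree were less than [K:F], some nonzero vector b would satisfy Σ
bᵢ q(δ)(yᵢ) = 0 for all q, where y is an F-basis of K. Differentiating shows that such b form a
space stable under δ, so one may take b over F; then q = 1 contradicts the independence of y. -/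
theorem natDegree_derivMinpoly [FiniteDimensional F K] (hδ : HasConstants δ) :
    (derivMinpoly δ).natDegree = Module.finrank F K := by
  set D : Module.End F K := (δ : K →ₗ[F] K) with hD
  have hint : IsIntegral F D := Algebra.IsIntegral.isIntegral D
  apply le_antisymm
  · rw [← LinearMap.charpoly_natDegree D]
    exact natDegree_le_of_dvd (LinearMap.minpoly_dvd_charpoly D) (LinearMap.charpoly_monic D).ne_zero
  by_contra! hlt
  set y := Module.finBasis F K
  set n := (derivMinpoly δ).natDegree
  let W : Submodule K (Fin (Module.finrank F K) → K) :=
    { carrier := {b | ∀ q : F[X], ∑ i, b i * (aeval D q) (y i) = 0}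
      add_mem' := fun {b c} hb hc q => by
        simp only [Pi.add_apply, add_mul, Finset.sum_add_distrib, hb q, hc q, add_zero]
      zero_mem' := fun q => by simp
      smul_mem' := fun c b hb q => by
        simp only [Pi.smul_apply, smul_eq_mul, mul_assoc, ← Finset.mul_sum, hb q, mul_zero] }
  have hW : ∀ w ∈ W, (fun i => δ (w i)) ∈ W := by
    intro w hw q
    have h1 := congrArg δ (hw q)
    have h2 := hw (X * q)
    rw [map_zero, map_sum] at h1
    simp only [Derivation.leibniz, smul_eq_mul, Finset.sum_add_distrib] at h1
    simp only [map_mul, aeval_X, Module.End.mul_apply] at h2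
    change ∑ i, w i * δ ((aeval D q) (y i)) = 0 at h2
    rw [h2, zero_add] at h1
    rw [← h1]
    exact Finset.sum_congr rfl fun i _ => mul_comm _ _
  -- Modulo the minimum polynomial only q = 1, t, ..., t^{n-1} matter: n equations in more than n
  -- unknowns.
  have hne : W ≠ ⊥ := by
    let T : (Fin (Module.finrank F K) → K) →ₗ[K] (Fin n → K) :=
      LinearMap.pi fun j => ∑ i, ((D ^ (j : ℕ)) (y i)) • LinearMap.proj i
    have hT : LinearMap.ker T ≠ ⊥ := by
      apply LinearMap.ker_ne_bot_of_finrank_lt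
      simpa using hlt
    obtain ⟨b, hb, hb0⟩ := (Submodule.ne_bot_iff _).1 hT
    refine (Submodule.ne_bot_iff _).2 ⟨b, fun q => ?_, hb0⟩
    have hq : aeval D q = aeval D (q %ₘ derivMinpoly δ) := by
      rw [modByMonic_eq_sub_mul_div, map_sub, map_mul]
      simp [derivMinpoly, hD]
    have hdeg : (q %ₘ derivMinpoly δ).natDegree < n :=
      natDegree_modByMonic_lt _ (minpoly.monic hint) (minpoly.ne_one F D)
    rw [hq, aeval_eq_sum_range' hdeg]
    simp only [LinearMap.sum_apply, Finset.mul_sum]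
    rw [Finset.sum_comm]
    refine Finset.sum_eq_zero fun j hj => ?_
    have := congrFun hb ⟨j, Finset.mem_range.1 hj⟩
    simp only [T, LinearMap.pi_apply, LinearMap.sum_apply, LinearMap.smul_apply,
      LinearMap.proj_apply, smul_eq_mul, Pi.zero_apply] at this
    simp only [LinearMap.smul_apply, mul_smul_comm, ← Finset.smul_sum]
    rw [Finset.sum_congr rfl fun i _ => mul_comm (b i) _, this, smul_zero]
  obtain ⟨v, hv0, hv⟩ := exists_constant_vector_mem hδ W hW hne
  have h1 := hv 1
  simp only [map_one, Module.End.one_apply, ← Algebra.smul_def] at h1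
  exact hv0 (funext fun i => Fintype.linearIndependent_iff.1 y.linearIndependent v h1 i)

/-- Relations of degree at most n form a K-space, and commutation with τ makes it stable under δ; so
a nontrivial relation yields one, q(τ) = 0, with coefficients in F. Its commutators with K are
shorter relations, hence trivial by induction, and their constant coefficients say that (q - q₀)(δ)
= 0. As deg q is below the degree of the minimum polynomial, q is constant, hence zero. -/
theorem leftEval_injective_of_degree_lt [Nontrivial A] (hδ : HasConstants δ)
    (h : ∀ a, τ * ι a = ι a * τ + ι (δ a)) {P : K[X]}
    (hP : P.degree < (derivMinpoly δ).natDegree) (h0 : leftEval ι τ P = 0) : P = 0 := by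
  set m := (derivMinpoly δ).natDegree
  have key : ∀ n ≤ m, ∀ P : K[X], P.degree < n → leftEval ι τ P = 0 → P = 0 := by
    intro n
    induction n with
    | zero => intro _ P hP _; simpa using hP
    | succ n ih =>
      intro hn P hP h0
      by_contra hP0
      let f : (Fin (n + 1) → K) → K[X] := fun b => ∑ i : Fin (n + 1), monomial (i : ℕ) (b i)
      have hf : ∀ (b : Fin (n + 1) → K) (i : Fin (n + 1)), (f b).coeff i = b i := by
        intro b i
        simp only [f, finsetSum_coeff, coeff_monomial]
        rw [Finset.sum_eq_single i] <;> simp +contextual [Fin.val_inj]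
      let W : Submodule K (Fin (n + 1) → K) :=
        { carrier := {b | leftEval ι τ (f b) = 0}
          add_mem' := fun {b c} hb hc => by
            simp only [Set.mem_ofPred_eq, f, leftEval_eq_sum, Pi.add_apply, map_add, add_mul,
              Finset.sum_add_distrib] at *
            rw [hb, hc, add_zero]
          zero_mem' := by simp [f]
          smul_mem' := fun c b hb => by
            simp only [Set.mem_ofPred_eq, f, leftEval_eq_sum, Pi.smul_apply, smul_eq_mul, map_mul,
              mul_assoc, ← Finset.mul_sum] at *
            rw [hb, mul_zero] }
      have hW : ∀ w ∈ W, (fun i => δ (w i)) ∈ W := by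
        intro w hw
        have h1 := mul_leftEval h (f w)
        rw [show leftEval ι τ (f w) = 0 from hw] at h1
        simp only [f, map_sum, DiffPoly.mapCoeff_monomial, mul_zero, zero_mul, zero_add] at h1
        change leftEval ι τ (f fun i => δ (w i)) = 0
        simp only [f, map_sum]
        exact h1.symm
      have hne : W ≠ ⊥ := by
        refine (Submodule.ne_bot_iff _).2 ⟨fun i => P.coeff i, ?_, fun hc => hP0 ?_⟩
        · change leftEval ι τ (∑ i : Fin (n + 1), monomial (i : ℕ) (P.coeff i)) = 0
          rw [Fin.sum_univ_eq_sum_range (fun i => monomial i (P.coeff i)),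
            ← P.as_sum_range' (n + 1) ((natDegree_lt_iff_degree_lt hP0).2 hP), h0]
        · ext i
          by_cases hi : i < n + 1
          · exact congrFun hc ⟨i, hi⟩
          · rw [coeff_zero]
            exact coeff_eq_zero_of_degree_lt (hP.trans_le (by exact_mod_cast not_lt.1 hi))
      obtain ⟨v, hv0, hv⟩ := exists_constant_vector_mem hδ W hW hne
      set q : F[X] := ∑ i : Fin (n + 1), monomial (i : ℕ) (v i) with hq
      have hqv : ∀ i : Fin (n + 1), q.coeff i = v i := by
        intro i
        simp only [hq, finsetSum_coeff, coeff_monomial]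
        rw [Finset.sum_eq_single i] <;> simp +contextual [Fin.val_inj]
      have hqdeg : q.degree < ((n + 1 : ℕ) : WithBot ℕ) := by
        refine (degree_sum_le _ _).trans_lt ((Finset.sup_lt_iff (WithBot.bot_lt_coe _)).2 ?_)
        intro i _
        exact (degree_monomial_le _ _).trans_lt (by exact_mod_cast i.2)
      have hqn : q.natDegree ≤ n := natDegree_le_iff_coeff_eq_zero.2 fun N hN =>
        (degree_lt_iff_coeff_zero _ _).1 hqdeg N hN
      have hq0 : aeval τ q = 0 := by
        have h3 : leftEval ι τ (f fun i => algebraMap F K (v i)) = 0 := hv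
        rw [← leftEval_map ι, ← h3]
        simp only [hq, f, Polynomial.map_sum, map_monomial]
      have hcoeff : ∀ a, ∑ j ∈ Finset.range n, δ^[j + 1] a * algebraMap F K (q.coeff (j + 1)) = 0 := by
        intro a
        have h1 := aeval_mul_eq_leftEval h a q hqn
        rw [Finset.sum_range_succ', hasseDeriv_zero', map_add, leftEval_C_mul, leftEval_map, hq0,
          zero_mul, mul_zero, add_zero] at h1
        have h2 := ih (by omega) _ ?_ h1.symm
        · have := congrArg (fun P => coeff P 0) h2
          simpa [finsetSum_coeff, coeff_C_mul, hasseDeriv_coeff] using this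
        · refine (degree_sum_le _ _).trans_lt ((Finset.sup_lt_iff (WithBot.bot_lt_coe _)).2 ?_)
          intro j hj
          rw [Finset.mem_range] at hj
          refine (degree_C_mul_map_le _ _).trans_lt ?_
          refine degree_le_natDegree.trans_lt ?_
          have := natDegree_hasseDeriv_le q (j + 1)
          exact_mod_cast (by omega : (hasseDeriv (j + 1) q).natDegree < n)
      have hr : aeval ((δ : K →ₗ[F] K) : Module.End F K) (q - C (q.coeff 0)) = 0 := by
        ext a
        rw [map_sub, aeval_eq_sum_range' (Nat.lt_succ_of_le hqn), Finset.sum_range_succ', aeval_C,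
          pow_zero, ← Algebra.algebraMap_eq_smul_one, add_sub_cancel_right, LinearMap.sum_apply,
          LinearMap.zero_apply, ← hcoeff a]
        refine Finset.sum_congr rfl fun j _ => ?_
        rw [LinearMap.smul_apply, coe_pow_apply, Algebra.smul_def, mul_comm]
      have hr0 : q - C (q.coeff 0) = 0 := by
        by_contra hne0
        have h1 := natDegree_le_natDegree (minpoly.degree_le_of_ne_zero F _ hne0 hr)
        rw [natDegree_sub_C] at h1
        change m ≤ _ at h1
        omega
      rw [sub_eq_zero] at hr0
      rw [hr0, aeval_C] at hq0
      have hq00 := (FaithfulSMul.algebraMap_eq_zero_iff F A).1 hq0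
      apply hv0
      funext i
      rw [← hqv i, hr0, hq00]; simp
  exact key m le_rfl P hP h0

/-- Write n = p^j r with p not dividing r; by Lucas, the binomial coefficient of n over p^j is
congruent to r modulo p. -/
theorem exists_eq_prime_pow_of_dvd_choose {p : ℕ} (hp : p.Prime) {n : ℕ} (hn : n ≠ 0)
    (h : ∀ k, 0 < k → k < n → p ∣ n.choose k) : ∃ j, n = p ^ j := by
  have := Fact.mk hp
  obtain ⟨j, r, hr, rfl⟩ := Nat.exists_eq_pow_mul_and_not_dvd hn p hp.ne_one
  refine ⟨j, ?_⟩
  have hr0 : r ≠ 0 := by rintro rfl; simp at hr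
  by_contra hne
  have hr1 : 1 < r := by
    by_contra hlt
    have : r = 1 := by omega
    simp [this] at hne
  have h1 := h (p ^ j) (pow_pos hp.pos j) (by nlinarith [pow_pos hp.pos j])
  have h2 : (p ^ j * r).choose (p ^ j) ≡ r [MOD p] := by
    have : ∀ j, (p ^ j * r).choose (p ^ j) ≡ r [MOD p] := by
      intro j
      induction j with
      | zero => simp; rfl
      | succ j ih =>
        have := Choose.choose_modEq_choose_mod_mul_choose_div_nat (n := p ^ (j + 1) * r)
          (k := p ^ (j + 1)) (p := p)
        rw [pow_succ', mul_assoc, Nat.mul_mod_right, Nat.mul_mod_right, Nat.mul_div_cancel_left _ hp.pos,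
          Nat.mul_div_cancel_left _ hp.pos] at this
        rw [pow_succ', mul_assoc]
        refine this.trans ?_
        simpa using ih
    exact this j
  exact hr ((Nat.modEq_zero_iff_dvd).1 (h2.symm.trans ((Nat.modEq_zero_iff_dvd).2 h1)))

theorem derivMinpoly_coeff_zero : (derivMinpoly δ).coeff 0 = 0 := by
  have h := LinearMap.congr_fun (minpoly.aeval F ((δ : K →ₗ[F] K) : Module.End F K)) 1
  rw [aeval_eq_sum_range, LinearMap.sum_apply, Finset.sum_range_succ'] at h
  rw [Finset.sum_eq_zero] at h
  · simpa [Algebra.smul_def, derivMinpoly] using h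
  · intro i _
    rw [LinearMap.smul_apply, coe_pow_apply, Function.iterate_succ_apply]
    simp

/-- The exponents in the minimum polynomial of `δ` are powers of the characteristic. -/
theorem derivMinpoly_coeff_eq_zero (p : ℕ) [Fact p.Prime] [CharP F p] (hδ : HasConstants δ) {n : ℕ}
    (hn : ∀ j, n ≠ p ^ j) : (derivMinpoly δ).coeff n = 0 := by
  set g := derivMinpoly δ with hg
  set m := g.natDegree with hm
  by_cases hn0 : n = 0
  · rw [hn0]; exact derivMinpoly_coeff_zero
  by_contra hne
  have hnm : n ≤ m := le_natDegree_of_ne_zero hne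
  -- As n is not a power of p, some inner binomial coefficient of n survives modulo p.
  obtain ⟨k, hk0, hkn, hk⟩ : ∃ k, 0 < k ∧ k < n ∧ ¬ p ∣ n.choose k := by
    by_contra! hcon
    obtain ⟨j, hj⟩ := exists_eq_prime_pow_of_dvd_choose (Fact.out : p.Prime) hn0
      fun k h1 h2 => hcon k h1 h2
    exact hn j hj
  set D : Module.End F K := (δ : K →ₗ[F] K) with hD
  have hg0 : aeval D g = 0 := minpoly.aeval F D
  -- As g(δ) = 0, the commutator of g(δ) with a is a relation of degree below m in δ, so each
  -- coefficient vanishes. The coefficient at t^k is Q(δ)(a). Since k > 0, deg Q < m, which forces Q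
  -- = 0; its coefficient at n - k is the binomial coefficient of n over k times g_n.
  let Q : F[X] := ∑ j ∈ Finset.range m, C (((k + (j + 1)).choose (j + 1) : F) * g.coeff (k + (j + 1))) * X ^ (j + 1)
  have hQ : aeval D Q = 0 := by
    ext a
    have h1 := aeval_mul_eq_leftEval (end_mul_lmul δ) a g le_rfl
    rw [Finset.sum_range_succ', hasseDeriv_zero', map_add, leftEval_C_mul, leftEval_map, hg0,
      zero_mul, mul_zero, add_zero] at h1
    have h2 := leftEval_injective_of_degree_lt hδ (end_mul_lmul δ) ?_ h1.symm
    · have := congrArg (fun P => coeff P k) h2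
      simp only [finsetSum_coeff, coeff_C_mul, coeff_map, hasseDeriv_coeff, coeff_zero] at this
      simp only [Q, map_sum, map_mul, aeval_C, map_pow, aeval_X, LinearMap.sum_apply,
        LinearMap.zero_apply]
      rw [← this]
      refine Finset.sum_congr rfl fun j _ => ?_
      rw [← map_mul, ← Algebra.smul_def, LinearMap.smul_apply, coe_pow_apply, Algebra.smul_def,
        mul_comm]
    · have hm0 : 0 < m := by omega
      refine (degree_sum_le _ _).trans_lt ((Finset.sup_lt_iff (WithBot.bot_lt_coe _)).2 ?_)
      intro j hj
      rw [Finset.mem_range] at hj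
      refine (degree_C_mul_map_le _ _).trans_lt ?_
      refine degree_le_natDegree.trans_lt ?_
      have := natDegree_hasseDeriv_le g (j + 1)
      exact_mod_cast (by omega : (hasseDeriv (j + 1) g).natDegree < m)
  have hQc : ∀ i, Q.coeff i = if 0 < i ∧ i ≤ m then ((k + i).choose i : F) * g.coeff (k + i) else 0 := by
    intro i
    simp only [Q, finsetSum_coeff, coeff_C_mul, coeff_X_pow]
    rcases i with _ | i
    · simp
    · simp
  have hQ0 : Q = 0 := by
    by_contra hQne
    have h1 := minpoly.degree_le_of_ne_zero F D hQne hQ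
    have h2 : Q.degree < m := by
      rw [degree_lt_iff_coeff_zero]
      intro i hi
      rw [hQc]
      split_ifs with h
      · rw [coeff_eq_zero_of_natDegree_lt (n := k + i) (by omega), mul_zero]
      · rfl
    have h3 : (minpoly F D).degree = m :=
      degree_eq_natDegree fun h => hne (by rw [hg, derivMinpoly, h, coeff_zero])
    exact absurd (h1.trans_lt h2) (by rw [h3]; exact lt_irrefl _)
  have := hQc (n - k)
  rw [hQ0, coeff_zero, if_pos ⟨by omega, by omega⟩, Nat.add_sub_cancel' hkn.le] at this
  rcases mul_eq_zero.1 this.symm with h | h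
  · rw [CharP.cast_eq_zero_iff F p, Nat.choose_symm hkn.le] at h
    exact hk h
  · exact hne h

theorem derivMinpoly_eq_sum (p : ℕ) [Fact p.Prime] [CharP F p] (hδ : HasConstants δ) {e : ℕ}
    (he : (derivMinpoly δ).natDegree = p ^ e) :
    derivMinpoly δ = ∑ j ∈ Finset.range (e + 1), C ((derivMinpoly δ).coeff (p ^ j)) * X ^ p ^ j := by
  have hp : p.Prime := Fact.out
  ext n
  simp only [finsetSum_coeff, coeff_C_mul, coeff_X_pow]
  by_cases hn : ∃ j, n = p ^ j
  · obtain ⟨j, rfl⟩ := hn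
    by_cases hj : j ∈ Finset.range (e + 1)
    · rw [Finset.sum_eq_single_of_mem j hj]
      · simp
      · intro i _ hij
        rw [if_neg (fun h => hij (Nat.pow_right_injective hp.two_le h).symm), mul_zero]
    · rw [Finset.sum_eq_zero]
      · apply coeff_eq_zero_of_natDegree_lt
        rw [he]
        exact Nat.pow_lt_pow_right hp.one_lt (by simpa using hj)
      · intro i hi
        rw [if_neg (fun h => hj ?_), mul_zero]
        rwa [Nat.pow_right_injective hp.two_le h]
  · rw [derivMinpoly_coeff_eq_zero p hδ (not_exists.1 hn), Finset.sum_eq_zero]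
    intro i _
    rw [if_neg (fun h => hn ⟨i, h⟩), mul_zero]

/-- In characteristic `p` the minimum polynomial of `δ`, evaluated at `τ`, commutes with `K`. -/
theorem aeval_derivMinpoly_commute (p : ℕ) [Fact p.Prime] [CharP F p] (hδ : HasConstants δ) {e : ℕ}
    (he : (derivMinpoly δ).natDegree = p ^ e) (h : ∀ a, τ * ι a = ι a * τ + ι (δ a)) (a : K) :
    aeval τ (derivMinpoly δ) * ι a = ι a * aeval τ (derivMinpoly δ) := by
  have h0 : ∑ j ∈ Finset.range (e + 1), (derivMinpoly δ).coeff (p ^ j) • δ^[p ^ j] a = 0 := by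
    have h1 : aeval ((δ : K →ₗ[F] K) : Module.End F K) (derivMinpoly δ) = 0 := minpoly.aeval _ _
    rw [derivMinpoly_eq_sum p hδ he] at h1
    have h2 := LinearMap.congr_fun h1 a
    simpa only [map_sum, map_mul, aeval_C, map_pow, aeval_X, LinearMap.sum_apply,
      ← Algebra.smul_def, LinearMap.smul_apply, coe_pow_apply, LinearMap.zero_apply] using h2
  have h3 : aeval τ (derivMinpoly δ) =
      ∑ j ∈ Finset.range (e + 1), (derivMinpoly δ).coeff (p ^ j) • τ ^ p ^ j := by
    conv_lhs => rw [derivMinpoly_eq_sum p hδ he]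
    simp only [map_sum, map_mul, aeval_C, map_pow, aeval_X, ← Algebra.smul_def]
  rw [h3, Finset.sum_mul, Finset.mul_sum, ← sub_eq_zero, ← Finset.sum_sub_distrib,
    ← map_zero ι, ← h0, map_sum]
  refine Finset.sum_congr rfl fun j _ => ?_
  rw [smul_mul_assoc, mul_smul_comm, ← smul_sub, charPow_mul p h, add_sub_cancel_left, map_smul]

end Pairs

/-! ### Jacobson's formula for (τ + b)^{p^j} -/

section Jacobson

/-- The sum `∑ xⁱ y x^{p-1-i}` is `ad(x)^{p-1}(y)` in characteristic `p`. -/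
theorem sum_pow_mul_mul_pow (p : ℕ) [Fact p.Prime] {R : Type*} [Ring R] [CharP R p] (x y : R) :
    ∑ i ∈ Finset.range p, x ^ i * y * x ^ (p - 1 - i) =
      ((LinearMap.mulLeft ℤ x - LinearMap.mulRight ℤ x) ^ (p - 1)) y := by
  have hp : p.Prime := Fact.out
  have hc : Commute (LinearMap.mulLeft ℤ x) (-LinearMap.mulRight ℤ x) :=
    (LinearMap.commute_mulLeft_right (R := ℤ) x x).neg_right
  rw [sub_eq_add_neg, hc.add_pow, LinearMap.sum_apply, Nat.sub_add_cancel hp.one_le]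
  refine Finset.sum_congr rfl fun i hi => ?_
  rw [Finset.mem_range] at hi
  -- In characteristic p the binomial coefficient of p - 1 over k equals (-1)^k, so it cancels the
  -- sign in the expansion of ad(x)^{p-1}.
  have hch : (-1 : R) ^ (p - 1 - i) * ((p - 1).choose i : R) = 1 := by
    have key : ∀ k < p, (-1 : R) ^ k * ((p - 1).choose k : R) = 1 := by
      intro k
      induction k with
      | zero => simp
      | succ k ih =>
        intro hk
        have h1 := ih (by omega)
        have h2 : ((p.choose (k + 1) : ℕ) : R) = 0 :=
          (CharP.cast_eq_zero_iff R p _).2 (hp.dvd_choose_self (by omega) hk)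
        rw [← Nat.sub_add_cancel hp.one_le, Nat.choose_succ_succ, Nat.cast_add] at h2
        rw [pow_succ, eq_neg_of_add_eq_zero_right h2]
        simpa using h1
    simpa only [Nat.choose_symm (show i ≤ p - 1 by omega)] using key (p - 1 - i) (by omega)
  rw [neg_pow, LinearMap.pow_mulLeft, LinearMap.pow_mulRight]
  rw [Module.End.mul_apply, Module.End.natCast_apply, Module.End.mul_apply, map_nsmul, map_nsmul]
  simp only [Module.End.mul_apply, LinearMap.mulRight_apply, LinearMap.mulLeft_apply]
  have hneg : ∀ (n : ℕ) (z : R), ((-1 : Module.End ℤ R) ^ n) z = (-1 : R) ^ n * z := by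
    intro n z
    rcases Nat.even_or_odd n with h | h <;> simp [h.neg_one_pow]
  rw [hneg, nsmul_eq_mul, ← mul_assoc, ← mul_assoc]
  have h3 : ((p - 1).choose i : R) * x ^ i * (-1 : R) ^ (p - 1 - i) = x ^ i := by
    rw [(Nat.cast_commute _ _).eq, mul_assoc, (Nat.cast_commute _ _).eq, hch, mul_one]
  simp only [← mul_assoc, h3]

variable {R : Type*} [Ring R]

/-- The product rule with the order of factors kept, since q need not commute with its derivative.
-/
theorem derivative_pow_eq_sum (q : R[X]) (n : ℕ) :
    derivative (q ^ n) = ∑ i ∈ Finset.range n, q ^ i * derivative q * q ^ (n - 1 - i) := by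
  induction n with
  | zero => simp
  | succ n ih =>
    rw [pow_succ, derivative_mul, ih, Finset.sum_range_succ, Finset.sum_mul]
    congr 1
    · refine Finset.sum_congr rfl fun i hi => ?_
      rw [Finset.mem_range] at hi
      rw [mul_assoc, ← pow_succ]
      congr 2
      omega
    · simp

variable {F : Type u} {K : Type v} [Field F] [Field K] [Algebra F K] {δ : Derivation F K K}
  {A : Type*} [Ring A] [Algebra F A] {ι : K →ₐ[F] A} {τ : A}

/-- Jacobson's formula `(τ + b)^p = τ^p + b^p + δ^{p-1}(b)`. -/
theorem add_pow_char_of_ad (p : ℕ) [Fact p.Prime] [CharP F p]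
    (h : ∀ a, τ * ι a = ι a * τ + ι (δ a)) (b : K) :
    (τ + ι b) ^ p = τ ^ p + ι (b ^ p + δ^[p - 1] b) := by
  cases subsingleton_or_nontrivial A
  · exact Subsingleton.elim _ _
  have hp : p.Prime := Fact.out
  have hA : CharP A p := charP_of_injective_algebraMap (FaithfulSMul.algebraMap_injective F A) p
  -- Interpolate by T = τ + bX with X central. The derivative of T^p is ad(T)^{p-1}(b) = δ^{p-1}(b),
  -- free of X; so the coefficient of X is δ^{p-1}(b), and those of X^i with 1 < i < p vanish
  -- because i is invertible. Then put X = 1.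
  set T : A[X] := C τ + C (ι b) * X with hT
  have hTd : derivative T = C (ι b) := by simp [hT]
  have had : ∀ n a, ((LinearMap.mulLeft ℤ T - LinearMap.mulRight ℤ T) ^ n) (C (ι a)) =
      C (ι (δ^[n] a)) := by
    intro n a
    induction n with
    | zero => simp
    | succ n ih =>
      rw [pow_succ', Module.End.mul_apply, ih, Function.iterate_succ_apply']
      simp only [LinearMap.sub_apply, LinearMap.mulLeft_apply, LinearMap.mulRight_apply, hT,
        add_mul, mul_add, mul_assoc, X_mul_C]
      rw [← mul_assoc (C _) (C _), ← mul_assoc (C _) (C _), ← C_mul, ← C_mul, ← C_mul, ← C_mul, h,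
        ← map_mul, ← map_mul, mul_comm b, C_add]
      abel
  have hder : derivative (T ^ p) = C (ι (δ^[p - 1] b)) := by
    rw [derivative_pow_eq_sum, hTd, sum_pow_mul_mul_pow p, had]
  have hdegT : T.natDegree ≤ 1 := by
    rw [hT]; compute_degree
  have hdeg : (T ^ p).natDegree ≤ p := by
    simpa using natDegree_pow_le_of_le p hdegT
  have hcp : (T ^ p).coeff p = ι b ^ p := by
    have := coeff_pow_of_natDegree_le (m := p) hdegT
    rw [mul_one] at this
    rw [this]; simp [hT]
  have hc0 : (T ^ p).coeff 0 = τ ^ p := by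
    rw [← constantCoeff_apply, map_pow]; simp [hT]
  have hcd : ∀ n, (T ^ p).coeff (n + 1) * ((n : A) + 1) = (C (ι (δ^[p - 1] b))).coeff n := by
    intro n
    rw [← hder, coeff_derivative]
  let ev : A[X] →+* A := eval₂RingHom' (RingHom.id A) 1 fun a => Commute.one_right _
  have hev : ev T = τ + ι b := by
    simp [ev, hT, eval₂RingHom']
  have hsum : ev (T ^ p) = ∑ i ∈ Finset.range (p + 1), (T ^ p).coeff i := by
    change eval₂ (RingHom.id A) 1 (T ^ p) = _
    rw [eval₂_eq_sum_range' _ (Nat.lt_succ_of_le hdeg)]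
    simp
  rw [← hev, ← map_pow, hsum, Finset.sum_range_succ, hcp]
  obtain ⟨q, hq⟩ : ∃ q, p = q + 2 := ⟨p - 2, by have := hp.two_le; omega⟩
  have hc1 : (T ^ p).coeff 1 = ι (δ^[p - 1] b) := by simpa using hcd 0
  have hmid : ∑ i ∈ Finset.range q, (T ^ p).coeff (i + 1 + 1) = 0 := by
    refine Finset.sum_eq_zero fun i hi => ?_
    rw [Finset.mem_range] at hi
    have h1 := hcd (i + 1)
    rw [coeff_C_succ, ← Nat.cast_add_one] at h1
    have h2 : IsUnit ((i + 1 + 1 : ℕ) : A) := by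
      rw [← map_natCast (algebraMap F A)]
      refine (IsUnit.mk0 _ fun h0 => ?_).map _
      have := Nat.le_of_dvd (by omega) ((CharP.cast_eq_zero_iff F p _).1 h0)
      omega
    exact h2.mul_left_eq_zero.1 h1
  have hr : ∑ i ∈ Finset.range p, (T ^ p).coeff i = ι (δ^[p - 1] b) + τ ^ p := by
    have h1 : ∑ i ∈ Finset.range p, (T ^ p).coeff i =
        ∑ i ∈ Finset.range (q + 2), (T ^ p).coeff i := by rw [← hq]
    rw [h1, Finset.sum_range_succ', Finset.sum_range_succ', hmid, hc1, hc0, zero_add]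
  rw [hr, map_add, map_pow]
  abel

/-- All terms of V_{p^j}(b) with i < j are p-th powers, which derivations kill. So (δ^{p^j})^{p-1}
sees only the last term δ^{p^j-1}(b), and turns it into δ^{p^{j+1}-1}(b). -/
theorem pV_succ (p : ℕ) [Fact p.Prime] [CharP F p] (j : ℕ) (b : K) :
    pV p δ (j + 1) b = pV p δ j b ^ p + (δ.charPow p j)^[p - 1] (pV p δ j b) := by
  have hp : p.Prime := Fact.out
  have hK : CharP K p := charP_of_injective_algebraMap (algebraMap F K).injective p
  have h1 : pV p δ j b ^ p =
      ∑ i ∈ Finset.range (j + 1), (δ^[p ^ i - 1] b) ^ p ^ (j + 1 - i) := by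
    rw [pV, sum_pow_char]
    refine Finset.sum_congr rfl fun i hi => ?_
    rw [Finset.mem_range] at hi
    rw [← pow_mul, ← pow_succ, Nat.succ_sub (by omega)]
  have hit : ∀ n x, (δ.charPow p j)^[n] x = δ^[p ^ j * n] x := by
    intro n x
    have : ⇑(δ.charPow p j) = δ^[p ^ j] := funext fun x => Derivation.charPow_apply p δ j x
    rw [this, ← Function.iterate_mul]
  have h2 : (δ.charPow p j)^[p - 1] (pV p δ j b) = δ^[p ^ (j + 1) - 1] b := by
    have hlin : ∀ n x y, (δ.charPow p j)^[n] (x + y) =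
        (δ.charPow p j)^[n] x + (δ.charPow p j)^[n] y := iterate_map_add _
    rw [pV, Finset.sum_range_succ, hlin]
    have hz : (δ.charPow p j)^[p - 1]
        (∑ i ∈ Finset.range j, (δ^[p ^ i - 1] b) ^ p ^ (j - i)) = 0 := by
      obtain ⟨q, hq⟩ : ∃ q, p - 1 = q + 1 := ⟨p - 2, by have := hp.two_le; omega⟩
      rw [hq, Function.iterate_succ_apply, map_sum, Finset.sum_eq_zero, iterate_map_zero]
      intro i hi
      rw [Finset.mem_range] at hi
      rw [Derivation.leibniz_pow, ← Nat.cast_smul_eq_nsmul K, Nat.cast_pow, CharP.cast_eq_zero,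
        zero_pow (by omega), zero_smul]
    rw [hz, zero_add, Nat.sub_self, pow_zero, pow_one, hit, ← Function.iterate_add_apply]
    congr 1
    have := pow_pos hp.pos j
    obtain ⟨q, hq⟩ : ∃ q, p = q + 1 := ⟨p - 1, by have := hp.two_le; omega⟩
    rw [pow_succ]
    have h3 : p ^ j * p = p ^ j * (p - 1) + p ^ j := by
      conv_lhs => rw [← Nat.sub_add_cancel hp.one_le, mul_add, mul_one]
      rw [Nat.sub_add_cancel hp.one_le]
    omega
  rw [h1, h2]
  conv_lhs => rw [pV, Finset.sum_range_succ, Nat.sub_self, pow_zero, pow_one]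

/-- Jacobson's formula is iterated: step j applies it to τ^{p^j}, which induces the derivation
δ^{p^j}. -/
theorem add_pow_charPow_of_ad (p : ℕ) [Fact p.Prime] [CharP F p]
    (h : ∀ a, τ * ι a = ι a * τ + ι (δ a)) (b : K) (j : ℕ) :
    (τ + ι b) ^ p ^ j = τ ^ p ^ j + ι (pV p δ j b) := by
  induction j with
  | zero => simp [pV]
  | succ j ih =>
    have h1 : ∀ a, τ ^ p ^ j * ι a = ι a * τ ^ p ^ j + ι (δ.charPow p j a) := by
      intro a
      rw [charPow_mul p h, Derivation.charPow_apply]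
    rw [pow_succ, pow_mul, ih, add_pow_char_of_ad p h1, ← pow_mul, pV_succ]

theorem aeval_derivMinpoly_add (p : ℕ) [Fact p.Prime] [CharP F p] (hδ : HasConstants δ) {e : ℕ}
    (he : (derivMinpoly δ).natDegree = p ^ e) (h : ∀ a, τ * ι a = ι a * τ + ι (δ a)) (b : K) :
    aeval (τ + ι b) (derivMinpoly δ) =
      aeval τ (derivMinpoly δ) + ι (polyV p e δ (derivMinpoly δ) b) := by
  have h3 : ∀ x : A, aeval x (derivMinpoly δ) =
      ∑ j ∈ Finset.range (e + 1), (derivMinpoly δ).coeff (p ^ j) • x ^ p ^ j := by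
    intro x
    conv_lhs => rw [derivMinpoly_eq_sum p hδ he]
    simp only [map_sum, map_mul, aeval_C, map_pow, aeval_X, ← Algebra.smul_def]
  simp only [h3, add_pow_charPow_of_ad p h, smul_add, Finset.sum_add_distrib, polyV, map_sum,
    map_smul]

end Jacobson

/-! ### K[t;δ]: universal property, degrees, division with remainder, centre -/

namespace DiffPoly

variable {F : Type u} {K : Type v} [Field F] [Field K] [Algebra F K] (δ : Derivation F K K)

/-- The underlying polynomial of an element of `K[t;δ]`. -/
def toPoly (x : DiffPoly δ) : K[X] := x

variable {δ}

theorem toPoly_ofPoly (P : K[X]) : toPoly δ (ofPoly δ P) = P := rfl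

theorem ofPoly_toPoly (x : DiffPoly δ) : ofPoly δ (toPoly δ x) = x := rfl

theorem toPoly_sub (x y : DiffPoly δ) : toPoly δ (x - y) = toPoly δ x - toPoly δ y := rfl

theorem toPoly_zero : toPoly δ 0 = 0 := rfl

theorem toPoly_one : toPoly δ 1 = 1 := rfl

variable (δ)

/-- The inclusion of the constants `K` in `K[t;δ]`. -/
def constHom : K →ₐ[F] DiffPoly δ where
  toFun := const δ
  map_one' := rfl
  map_mul' := const_mul δ
  map_zero' := C_0
  map_add' _ _ := C_add
  commutes' r := by
    change (C (algebraMap F K r) : K[X]) = r • (1 : K[X])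
    rw [Algebra.algebraMap_eq_smul_one, ← smul_C, C_1]

theorem t_mul_constHom (a : K) : t δ * constHom δ a = constHom δ a * t δ + constHom δ (δ a) :=
  t_mul_const δ a

theorem leftEval_constHom (P : K[X]) : leftEval (constHom δ) (t δ) P = ofPoly δ P := by
  rw [ofPoly_eq_sum, leftEval, Polynomial.lsum_apply]; rfl

theorem aeval_t (q : F[X]) : aeval (t δ) q = ofPoly δ (q.map (algebraMap F K)) := by
  rw [← leftEval_constHom, leftEval_map]

variable {δ}

section lift

variable {A : Type*} [Ring A] [Algebra F A] (ι : K →ₐ[F] A) (τ : A)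

theorem leftEval_leftMul (h : ∀ a, τ * ι a = ι a * τ + ι (δ a)) (P Q : K[X]) :
    leftEval ι τ (leftMul δ P Q) = leftEval ι τ P * leftEval ι τ Q := by
  have key : ∀ Q, leftEval ι τ (tMul δ Q) = τ * leftEval ι τ Q := by
    intro Q
    rw [mul_leftEval h, ← leftEval_mul_X, mul_comm Q X, ← map_add]; rfl
  induction P using Polynomial.induction_on' with
  | add p q hp hq => simp only [map_add, LinearMap.add_apply, hp, hq, add_mul]
  | monomial i a =>
    rw [leftMul_monomial, leftEval_C_mul, leftEval_monomial, mul_assoc]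
    congr 1
    induction i with
    | zero => simp
    | succ i ih => rw [pow_succ', Module.End.mul_apply, key, ih, pow_succ', mul_assoc]

/-- The universal property of `K[t;δ]`. -/
def lift (h : ∀ a, τ * ι a = ι a * τ + ι (δ a)) : DiffPoly δ →ₐ[F] A where
  toFun x := leftEval ι τ (toPoly δ x)
  map_one' := by
    rw [toPoly_one, ← C_1, ← monomial_zero_left, leftEval_monomial]; simp
  map_mul' x y := leftEval_leftMul ι τ h _ _
  map_zero' := map_zero _
  map_add' x y := map_add _ _ _
  commutes' r := by
    have h1 : toPoly δ (algebraMap F (DiffPoly δ) r) = r • (1 : K[X]) := rfl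
    rw [h1, map_smul, ← C_1, ← monomial_zero_left, leftEval_monomial]
    simp [Algebra.algebraMap_eq_smul_one]

theorem lift_apply (h : ∀ a, τ * ι a = ι a * τ + ι (δ a)) (x : DiffPoly δ) :
    lift ι τ h x = leftEval ι τ (toPoly δ x) := rfl

theorem lift_t (h : ∀ a, τ * ι a = ι a * τ + ι (δ a)) : lift ι τ h (t δ) = τ := by
  rw [lift_apply, t, toPoly_ofPoly, ← monomial_one_one_eq_X, leftEval_monomial]; simp

theorem lift_constHom (h : ∀ a, τ * ι a = ι a * τ + ι (δ a)) (a : K) :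
    lift ι τ h (constHom δ a) = ι a := by
  change leftEval ι τ (C a) = _
  rw [← monomial_zero_left, leftEval_monomial]; simp

end lift

section degree

/-- `P` has degree at most `n`, with coefficient `c` in degree `n`. -/
def HasTop (P : K[X]) (n : ℕ) (c : K) : Prop := (∀ k, n < k → P.coeff k = 0) ∧ P.coeff n = c

theorem coeff_mapCoeff (P : K[X]) (k : ℕ) : (mapCoeff δ P).coeff k = δ (P.coeff k) := by
  induction P using Polynomial.induction_on' with
  | add p q hp hq => simp only [map_add, coeff_add, hp, hq]
  | monomial i a =>
    rw [mapCoeff_monomial, coeff_monomial, coeff_monomial]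
    split_ifs <;> simp

theorem HasTop.tMul {P : K[X]} {n : ℕ} {c : K} (h : HasTop P n c) :
    HasTop (tMul δ P) (n + 1) c := by
  have key : ∀ k, (DiffPoly.tMul δ P).coeff (k + 1) = P.coeff k + δ (P.coeff (k + 1)) := by
    intro k
    change (X * P + mapCoeff δ P).coeff (k + 1) = _
    rw [coeff_add, coeff_X_mul, coeff_mapCoeff]
  refine ⟨fun k hk => ?_, ?_⟩
  · obtain ⟨k, rfl⟩ : ∃ j, k = j + 1 := ⟨k - 1, by omega⟩
    rw [key, h.1 k (by omega), h.1 (k + 1) (by omega)]; simp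
  · rw [key, h.2, h.1 (n + 1) (by omega)]; simp

theorem HasTop.tMul_pow {P : K[X]} {n : ℕ} {c : K} (h : HasTop P n c) (i : ℕ) :
    HasTop ((DiffPoly.tMul δ ^ i) P) (n + i) c := by
  induction i with
  | zero => simpa using h
  | succ i ih => rw [pow_succ', Module.End.mul_apply]; exact ih.tMul

theorem HasTop.leftMul {P Q : K[X]} {n k : ℕ} {a b : K} (hP : HasTop P n a) (hQ : HasTop Q k b) :
    HasTop (leftMul δ P Q) (n + k) (a * b) := by
  have h1 : DiffPoly.leftMul δ P Q =
      ∑ i ∈ Finset.range (n + 1), C (P.coeff i) * (DiffPoly.tMul δ ^ i) Q := by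
    conv_lhs => rw [P.as_sum_range' (n + 1) (Nat.lt_succ_of_le
      (natDegree_le_iff_coeff_eq_zero.2 hP.1))]
    simp only [map_sum, LinearMap.sum_apply, leftMul_monomial]
  have h2 : ∀ i, HasTop ((DiffPoly.tMul δ ^ i) Q) (k + i) b := fun i => hQ.tMul_pow i
  rw [h1]
  refine ⟨fun j hj => ?_, ?_⟩
  · rw [finsetSum_coeff]
    refine Finset.sum_eq_zero fun i hi => ?_
    rw [Finset.mem_range] at hi
    rw [coeff_C_mul, (h2 i).1 j (by omega), mul_zero]
  · rw [finsetSum_coeff, Finset.sum_range_succ, Finset.sum_eq_zero, zero_add, coeff_C_mul, hP.2,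
      add_comm n k, (h2 n).2]
    intro i hi
    rw [Finset.mem_range] at hi
    rw [coeff_C_mul, (h2 i).1 _ (by omega), mul_zero]

theorem hasTop_natDegree (P : K[X]) : HasTop P P.natDegree P.leadingCoeff :=
  ⟨fun _ hk => coeff_eq_zero_of_natDegree_lt hk, rfl⟩

theorem HasTop.natDegree_eq {P : K[X]} {n : ℕ} {c : K} (h : HasTop P n c) (hc : c ≠ 0) :
    P.natDegree = n :=
  le_antisymm (natDegree_le_iff_coeff_eq_zero.2 h.1) (le_natDegree_of_ne_zero (by rwa [h.2]))

theorem HasTop.ne_zero {P : K[X]} {n : ℕ} {c : K} (h : HasTop P n c) (hc : c ≠ 0) : P ≠ 0 := by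
  rintro rfl
  exact hc (by rw [← h.2, coeff_zero])

instance : NoZeroDivisors (DiffPoly δ) where
  eq_zero_or_eq_zero_of_mul_eq_zero {x y} hxy := by
    by_contra! hne
    exact ((hasTop_natDegree (toPoly δ x)).leftMul (hasTop_natDegree (toPoly δ y))).ne_zero
      (mul_ne_zero (leadingCoeff_ne_zero.2 hne.1) (leadingCoeff_ne_zero.2 hne.2)) hxy

instance : Nontrivial (DiffPoly δ) := inferInstanceAs (Nontrivial K[X])

theorem natDegree_mul {x y : DiffPoly δ} (hx : x ≠ 0) (hy : y ≠ 0) :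
    (toPoly δ (x * y)).natDegree = (toPoly δ x).natDegree + (toPoly δ y).natDegree :=
  ((hasTop_natDegree (toPoly δ x)).leftMul (hasTop_natDegree (toPoly δ y))).natDegree_eq
    (mul_ne_zero (leadingCoeff_ne_zero.2 hx) (leadingCoeff_ne_zero.2 hy))

/-- Division with remainder in `K[t;δ]`. -/
theorem exists_eq_mul_add {d : DiffPoly δ} (hd : d ≠ 0) (x : DiffPoly δ) :
    ∃ q r : DiffPoly δ, x = q * d + r ∧ (toPoly δ r).degree < (toPoly δ d).degree := by
  induction hn : (toPoly δ x).natDegree using Nat.strong_induction_on generalizing x with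
  | _ n ih =>
    by_cases hlt : (toPoly δ x).degree < (toPoly δ d).degree
    · exact ⟨0, x, by rw [zero_mul, zero_add], hlt⟩
    rw [not_lt] at hlt
    have hd' : toPoly δ d ≠ 0 := hd
    have hx' : toPoly δ x ≠ 0 := fun h => by
      rw [h, degree_zero, le_bot_iff, degree_eq_bot] at hlt
      exact hd' hlt
    have hle := natDegree_le_natDegree hlt
    -- With c on the left, c t^k d has leading coefficient c times that of d: moving t past
    -- coefficients only adds lower terms.
    set c : K := (toPoly δ x).leadingCoeff / (toPoly δ d).leadingCoeff with hc
    set k := (toPoly δ x).natDegree - (toPoly δ d).natDegree with hk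
    set q₀ : DiffPoly δ := ofPoly δ (monomial k c) with hq₀
    have htop : HasTop (toPoly δ (q₀ * d)) n (toPoly δ x).leadingCoeff := by
      have h1 : HasTop (toPoly δ q₀) k c :=
        ⟨fun j hj => coeff_monomial_of_ne _ hj.ne', coeff_monomial_same _ _⟩
      have h2 := h1.leftMul (δ := δ) (hasTop_natDegree (toPoly δ d))
      rw [hc, div_mul_cancel₀ _ (leadingCoeff_ne_zero.2 hd'), hk, Nat.sub_add_cancel hle, hn] at h2
      exact h2
    by_cases h0 : x - q₀ * d = 0
    · exact ⟨q₀, 0, by rw [add_zero]; exact sub_eq_zero.1 h0, by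
        rw [toPoly_zero, degree_zero]; exact bot_lt_iff_ne_bot.2 (degree_ne_bot.2 hd')⟩
    have hlt' : (toPoly δ (x - q₀ * d)).natDegree < n := by
      rw [natDegree_lt_iff_degree_lt (p := toPoly δ (x - q₀ * d)) h0, degree_lt_iff_coeff_zero]
      intro j hj
      rw [toPoly_sub, coeff_sub]
      rcases hj.eq_or_lt with rfl | hj
      · rw [htop.2, ← hn, coeff_natDegree, sub_self]
      · rw [htop.1 j hj, coeff_eq_zero_of_natDegree_lt (by omega), sub_self]
    obtain ⟨q, r, hqr, hr⟩ := ih _ hlt' _ rfl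
    refine ⟨q + q₀, r, ?_, hr⟩
    rw [add_mul, add_right_comm, ← hqr, sub_add_cancel]

theorem isUnit_iff {x : DiffPoly δ} : IsUnit x ↔ x ≠ 0 ∧ (toPoly δ x).natDegree = 0 := by
  constructor
  · rintro ⟨u, rfl⟩
    refine ⟨u.ne_zero, ?_⟩
    have h := natDegree_mul (δ := δ) u.ne_zero u⁻¹.ne_zero
    rw [u.mul_inv, toPoly_one, natDegree_one] at h
    omega
  · rintro ⟨h0, hdeg⟩
    obtain ⟨a, ha⟩ := natDegree_eq_zero.1 hdeg
    have hx : x = constHom δ a := ha.symm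
    rw [hx]
    refine (IsUnit.mk0 a fun h => h0 ?_).map (constHom δ)
    rw [hx, h, map_zero]

end degree

theorem mem_center_iff {x : DiffPoly δ} :
    x ∈ Subalgebra.center F (DiffPoly δ) ↔
      x * t δ = t δ * x ∧ ∀ a, x * constHom δ a = constHom δ a * x := by
  rw [Subalgebra.mem_center_iff]
  refine ⟨fun h => ⟨(h _).symm, fun a => (h _).symm⟩, fun ⟨h1, h2⟩ y => ?_⟩
  rw [← ofPoly_toPoly y, ← leftEval_constHom]
  induction toPoly δ y using Polynomial.induction_on' with
  | add p q hp hq => rw [map_add, add_mul, mul_add, hp, hq]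
  | monomial i a =>
    rw [leftEval_monomial]
    have h3 : Commute x (t δ) := h1
    have h4 : Commute x (constHom δ a) := h2 a
    exact (h4.mul_right (h3.pow_right i)).eq.symm

theorem extDiffPoly_eq (d₀ : F) : extDiffPoly δ d₀ =
    aeval (t δ) (derivMinpoly δ) - algebraMap F (DiffPoly δ) d₀ := by
  rw [extDiffPoly, extPoly, map_sub, aeval_C]

theorem extDiffPoly_mem_center (p : ℕ) [Fact p.Prime] [CharP F p] (hδ : HasConstants δ) {e : ℕ}
    (he : (derivMinpoly δ).natDegree = p ^ e) (d₀ : F) :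
    extDiffPoly δ d₀ ∈ Subalgebra.center F (DiffPoly δ) := by
  rw [mem_center_iff, extDiffPoly_eq]
  refine ⟨?_, fun a => ?_⟩
  · rw [sub_mul, mul_sub, Algebra.commutes]
    congr 1
    conv_lhs => enter [2]; rw [← aeval_X (R := F) (t δ)]
    conv_rhs => enter [1]; rw [← aeval_X (R := F) (t δ)]
    rw [← map_mul, ← map_mul, mul_comm]
  · rw [sub_mul, mul_sub, Algebra.commutes,
      aeval_derivMinpoly_commute p hδ he (t_mul_constHom δ)]

/-- A central element commutes with t, so δ kills its coefficients and it is q(t) with q over F. Let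
t act on K as δ: then q(δ) commutes with multiplications, hence is multiplication by its value q₀ at
1, and g divides q - q₀. The cofactor is again central because K[t;δ] is a domain; induct on the
degree. -/
theorem center_eq_adjoin (p : ℕ) [Fact p.Prime] [CharP F p] (hδ : HasConstants δ) {e : ℕ}
    (he : (derivMinpoly δ).natDegree = p ^ e) (d₀ : F) :
    Subalgebra.center F (DiffPoly δ) = Algebra.adjoin F {extDiffPoly δ d₀} := by
  have hp : p.Prime := Fact.out
  have hfc := extDiffPoly_mem_center p hδ he d₀
  refine le_antisymm ?_ (Algebra.adjoin_le (Set.singleton_subset_iff.2 hfc))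
  set S := Algebra.adjoin F {extDiffPoly δ d₀}
  have hfS : extDiffPoly δ d₀ ∈ S := Algebra.self_mem_adjoin_singleton F _
  have hgS : aeval (t δ) (derivMinpoly δ) ∈ S := by
    have := S.add_mem hfS (S.algebraMap_mem d₀)
    rwa [extDiffPoly_eq, sub_add_cancel] at this
  have hgc : aeval (t δ) (derivMinpoly δ) ∈ Subalgebra.center F (DiffPoly δ) := by
    have := Subalgebra.add_mem _ hfc (Subalgebra.algebraMap_mem _ d₀)
    rwa [extDiffPoly_eq, sub_add_cancel] at this
  have hg0 : aeval (t δ) (derivMinpoly δ) ≠ 0 := by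
    rw [aeval_t]
    intro h
    have h1 : (derivMinpoly δ).map (algebraMap F K) = 0 := h
    rw [Polynomial.map_eq_zero] at h1
    rw [h1, natDegree_zero] at he
    exact (pow_pos hp.pos e).ne he
  have hpoly : ∀ q : F[X], aeval (t δ) q ∈ Subalgebra.center F (DiffPoly δ) → aeval (t δ) q ∈ S := by
    intro q
    induction hn : q.natDegree using Nat.strong_induction_on generalizing q with
    | _ n ih =>
      intro hq
      set D : Module.End F K := (δ : K →ₗ[F] K) with hD
      let ψ : DiffPoly δ →ₐ[F] Module.End F K := lift (Algebra.lmul F K) D (end_mul_lmul δ)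
      have hψ : ψ (aeval (t δ) q) = aeval D q := by
        rw [← aeval_algHom_apply, lift_t]
      have h1 : aeval D (q - C (q.coeff 0)) = 0 := by
        ext a
        have h2 := congrArg ψ ((mem_center_iff.1 hq).2 a)
        rw [map_mul, map_mul, hψ, lift_constHom] at h2
        have h3 := LinearMap.congr_fun h2 1
        simp only [Module.End.mul_apply, Algebra.coe_lmul_eq_mul, LinearMap.mul_apply_apply,
          mul_one] at h3
        have h4 : aeval D q 1 = algebraMap F K (q.coeff 0) := by
          rw [aeval_eq_sum_range, LinearMap.sum_apply, Finset.sum_range_succ', Finset.sum_eq_zero]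
          · simp [Algebra.algebraMap_eq_smul_one]
          · intro i _
            rw [LinearMap.smul_apply, coe_pow_apply, Function.iterate_succ_apply]
            simp
        rw [map_sub, aeval_C, LinearMap.sub_apply, h3, h4, Module.algebraMap_end_apply,
          Algebra.smul_def, mul_comm, sub_self, LinearMap.zero_apply]
      obtain ⟨s, hs⟩ := minpoly.dvd F D h1
      have hq' : aeval (t δ) q = algebraMap F _ (q.coeff 0) +
          aeval (t δ) (derivMinpoly δ) * aeval (t δ) s := by
        rw [← map_mul, derivMinpoly, ← hD, ← hs, map_sub, aeval_C, add_sub_cancel]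
      have hsc : aeval (t δ) s ∈ Subalgebra.center F (DiffPoly δ) := by
        rw [Subalgebra.mem_center_iff] at hq hgc ⊢
        intro y
        have h5 := hq y
        rw [hq', mul_add, add_mul, Algebra.commutes, add_right_inj, ← mul_assoc, hgc, mul_assoc,
          mul_assoc] at h5
        exact mul_left_cancel₀ hg0 h5
      have hsS : aeval (t δ) s ∈ S := by
        by_cases hs0 : s = 0
        · rw [hs0, map_zero]; exact S.zero_mem
        refine ih s.natDegree ?_ s rfl hsc
        have h6 := congrArg natDegree hs
        have h7 : minpoly F D ≠ 0 := fun h => hg0 (by rw [derivMinpoly, ← hD, h, map_zero])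
        rw [natDegree_sub_C, Polynomial.natDegree_mul h7 hs0] at h6
        have h8 : (minpoly F D).natDegree = p ^ e := he
        have := pow_pos hp.pos e
        omega
      rw [hq']
      exact S.add_mem (S.algebraMap_mem _) (S.mul_mem hgS hsS)
  intro x hx
  have h1 := (mem_center_iff.1 hx).1
  have h2 : ∀ i, δ ((toPoly δ x).coeff i) = 0 := by
    intro i
    have h3 := mul_leftEval (t_mul_constHom δ) (toPoly δ x)
    rw [leftEval_constHom, leftEval_constHom, ofPoly_toPoly, h1, left_eq_add] at h3
    have h4 : mapCoeff δ (toPoly δ x) = 0 := h3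
    rw [← coeff_mapCoeff, h4, coeff_zero]
  have h3 : toPoly δ x ∈ lifts (algebraMap F K) := by
    rw [lifts_iff_coeff_lifts]
    intro i
    exact hδ _ (h2 i)
  obtain ⟨q, hq⟩ := (mem_lifts _).1 h3
  have hxq : x = aeval (t δ) q := by rw [aeval_t, hq, ofPoly_toPoly]
  rw [hxq] at hx ⊢
  exact hpoly q hx

end DiffPoly

/-! ### Differential extensions: division and splitting criteria -/

section DiffExt

variable {F : Type u} {K : Type v} [Field F] [Field K] [Algebra F K] {δ : Derivation F K K}

open DiffPoly

theorem mem_span_singleton_iff {R : Type*} [Ring R] {f : R} (hf : ∀ y, y * f = f * y) {x : R} :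
    x ∈ TwoSidedIdeal.span {f} ↔ ∃ q, x = q * f := by
  constructor
  · intro hx
    let I : TwoSidedIdeal R := .mk' {x | ∃ q, x = q * f} ⟨0, by simp⟩
      (by rintro _ _ ⟨a, rfl⟩ ⟨b, rfl⟩; exact ⟨a + b, by rw [add_mul]⟩)
      (by rintro _ ⟨a, rfl⟩; exact ⟨-a, by rw [neg_mul]⟩)
      (by rintro x _ ⟨a, rfl⟩; exact ⟨x * a, by rw [mul_assoc]⟩)
      (by rintro _ y ⟨a, rfl⟩; exact ⟨a * y, by rw [mul_assoc, ← hf, mul_assoc]⟩)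
    have hle : TwoSidedIdeal.span {f} ≤ I :=
      TwoSidedIdeal.span_le.2 (Set.singleton_subset_iff.2 ((TwoSidedIdeal.mem_mk' _ _ _ _ _ _ _).2
        ⟨1, by rw [one_mul]⟩))
    exact (TwoSidedIdeal.mem_mk' {x | ∃ q, x = q * f} _ _ _ _ _ _).1 (hle hx)
  · rintro ⟨q, rfl⟩
    exact TwoSidedIdeal.mul_mem_left _ _ _ (TwoSidedIdeal.subset_span rfl)

/-- The quotient map `K[t;δ] → (K,δ,d₀)`. -/
def DiffExt.mk (δ : Derivation F K K) (d₀ : F) : DiffPoly δ →ₐ[F] DiffExt δ d₀ :=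
  (TwoSidedIdeal.span {extDiffPoly δ d₀}).ringCon.mkₐ F

namespace DiffExt

variable {d₀ : F}

theorem mk_surjective : Function.Surjective (mk δ d₀) := RingCon.mkₐ_surjective _

theorem mk_t : mk δ d₀ (t δ) = root δ d₀ := rfl

theorem mk_eq_zero_iff {x : DiffPoly δ} :
    mk δ d₀ x = 0 ↔ x ∈ TwoSidedIdeal.span {extDiffPoly δ d₀} :=
  (RingCon.eq _).trans (TwoSidedIdeal.mem_iff _ _).symm

theorem mk_extDiffPoly : mk δ d₀ (extDiffPoly δ d₀) = 0 :=
  mk_eq_zero_iff.2 (TwoSidedIdeal.subset_span rfl)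

/-- Algebra homomorphisms out of a differential extension. -/
def lift {A : Type*} [Ring A] [Algebra F A] (ψ : DiffPoly δ →ₐ[F] A)
    (h : ψ (extDiffPoly δ d₀) = 0) : DiffExt δ d₀ →ₐ[F] A :=
  RingCon.liftₐ _ ψ fun x y hxy => by
    have h1 : x - y ∈ TwoSidedIdeal.span {extDiffPoly δ d₀} := (TwoSidedIdeal.rel_iff _ _ _).1 hxy
    have h2 : TwoSidedIdeal.span {extDiffPoly δ d₀} ≤ TwoSidedIdeal.ker ψ :=
      TwoSidedIdeal.span_le.2 (Set.singleton_subset_iff.2 ((TwoSidedIdeal.mem_ker _).2 h))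
    have h3 := (TwoSidedIdeal.mem_ker _).1 (h2 h1)
    rw [map_sub, sub_eq_zero] at h3
    exact h3

theorem root_mul (a : K) : root δ d₀ * mk δ d₀ (constHom δ a) =
    mk δ d₀ (constHom δ a) * root δ d₀ + mk δ d₀ (constHom δ (δ a)) := by
  rw [← mk_t, ← map_mul, ← map_mul, ← map_add, t_mul_constHom]

theorem aeval_root : aeval (root δ d₀) (derivMinpoly δ) = algebraMap F (DiffExt δ d₀) d₀ := by
  have h := congrArg (mk δ d₀) (extDiffPoly_eq (δ := δ) d₀)
  rw [mk_extDiffPoly, map_sub, AlgHom.commutes, ← aeval_algHom_apply, mk_t] at h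
  exact sub_eq_zero.1 h.symm

theorem natDegree_extPoly (d₀ : F) :
    (extPoly δ d₀).natDegree = (derivMinpoly δ).natDegree := by
  rw [extPoly, natDegree_sub_C]

theorem natDegree_extDiffPoly (d₀ : F) :
    (toPoly δ (extDiffPoly δ d₀)).natDegree = (derivMinpoly δ).natDegree := by
  rw [extDiffPoly, aeval_t, toPoly_ofPoly, natDegree_map, natDegree_extPoly (δ := δ) d₀]

theorem extDiffPoly_ne_zero (h : (derivMinpoly δ).natDegree ≠ 0) (d₀ : F) :
    extDiffPoly δ d₀ ≠ 0 := by
  intro h0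
  have := natDegree_extDiffPoly (δ := δ) d₀
  rw [h0, toPoly_zero, natDegree_zero] at this
  exact h this.symm

/-- `f` is irreducible in `K[t;δ]` iff the differential extension is a division algebra. -/
theorem irreducible_iff (p : ℕ) [Fact p.Prime] [CharP F p] (hδ : HasConstants δ) {e : ℕ}
    (he : (derivMinpoly δ).natDegree = p ^ e) (d₀ : F) :
    Irreducible (extDiffPoly δ d₀) ↔ IsDivisionAlg (DiffExt δ d₀) := by
  have hp : p.Prime := Fact.out
  have hm : (derivMinpoly δ).natDegree ≠ 0 := by rw [he]; exact (pow_pos hp.pos e).ne'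
  set f := extDiffPoly δ d₀ with hf
  have hf0 : f ≠ 0 := extDiffPoly_ne_zero hm d₀
  have hfc : ∀ y, y * f = f * y := Subalgebra.mem_center_iff.1 (extDiffPoly_mem_center p hδ he d₀)
  have hker : ∀ x, mk δ d₀ x = 0 ↔ ∃ q, x = q * f := fun x =>
    mk_eq_zero_iff.trans (mem_span_singleton_iff hfc)
  have hnu : ¬ IsUnit f := fun h => hm (by
    rw [← natDegree_extDiffPoly (δ := δ) d₀]; exact (DiffPoly.isUnit_iff.1 h).2)
  constructor
  · intro hirr
    have hnt : Nontrivial (DiffExt δ d₀) := by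
      refine ⟨⟨mk δ d₀ 1, 0, fun h => hnu ?_⟩⟩
      obtain ⟨q, hq⟩ := (hker 1).1 h
      exact ⟨⟨f, q, by rw [← hfc, ← hq], hq.symm⟩, rfl⟩
    have hleft : ∀ x : DiffExt δ d₀, x ≠ 0 → ∃ y, y * x = 1 := by
      intro x hx
      obtain ⟨x, rfl⟩ := mk_surjective x
      -- The left ideal generated by x and f is generated by an element d of least degree. In f =
      -- c·d one factor is a unit: if c is, then x lies in (f); if d is, then x has a left inverse
      -- modulo f.
      let I : Ideal (DiffPoly δ) := Ideal.span {x, f}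
      have hfI : f ∈ I := Ideal.subset_span (by simp)
      have hxI : x ∈ I := Ideal.subset_span (by simp)
      obtain ⟨d, ⟨hdI, hd0⟩, hdmin⟩ : ∃ d, (d ∈ I ∧ d ≠ 0) ∧
          ∀ d', d' ∈ I ∧ d' ≠ 0 → (toPoly δ d).natDegree ≤ (toPoly δ d').natDegree := by
        obtain ⟨d, hd, hmin⟩ := (measure fun d => (toPoly δ d).natDegree).wf.has_min
          {d | d ∈ I ∧ d ≠ 0} ⟨f, hfI, hf0⟩
        exact ⟨d, hd, fun d' hd' => not_lt.1 (hmin d' hd')⟩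
      have hdvd : ∀ y ∈ I, ∃ q, y = q * d := by
        intro y hy
        obtain ⟨q, r, hqr, hr⟩ := exists_eq_mul_add hd0 y
        by_cases hr0 : r = 0
        · exact ⟨q, by rw [hqr, hr0, add_zero]⟩
        · have hrI : r ∈ I := by
            have : r = y - q * d := by rw [hqr, add_sub_cancel_left]
            rw [this]
            exact I.sub_mem hy (I.mul_mem_left q hdI)
          exact absurd (natDegree_lt_natDegree hr0 hr) (not_lt.2 (hdmin r ⟨hrI, hr0⟩))
      obtain ⟨c, hc⟩ := hdvd f hfI
      obtain ⟨s, hs⟩ := hdvd x hxI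
      rcases hirr.isUnit_or_isUnit hc with hu | hu
      · obtain ⟨u, rfl⟩ := hu
        exfalso
        apply hx
        rw [hker]
        refine ⟨s * ↑u⁻¹, ?_⟩
        rw [hc, mul_assoc, Units.inv_mul_cancel_left, hs]
      · obtain ⟨u, rfl⟩ := hu
        obtain ⟨a, b, hab⟩ := Ideal.mem_span_pair.1 hdI
        refine ⟨mk δ d₀ (↑u⁻¹ * a), ?_⟩
        have h1 : ↑u⁻¹ * a * x = 1 - ↑u⁻¹ * b * f := by
          rw [eq_sub_iff_add_eq, mul_assoc, mul_assoc, ← mul_add, hab, u.inv_mul]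
        rw [← map_mul, h1, map_sub, map_one, map_mul, mk_extDiffPoly, mul_zero, sub_zero]
    refine ⟨hnt, fun x hx => ?_⟩
    obtain ⟨y, hy⟩ := hleft x hx
    obtain ⟨z, hz⟩ := hleft y fun h => by rw [h, zero_mul] at hy; exact zero_ne_one hy
    have hzx : z = x := by
      calc z = z * (y * x) := by rw [hy, mul_one]
        _ = x := by rw [← mul_assoc, hz, one_mul]
    exact ⟨⟨x, y, by rw [← hzx, hz], hy⟩, rfl⟩
  · rintro ⟨hnt, hdiv⟩
    refine ⟨hnu, fun a b hab => ?_⟩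
    have ha0 : a ≠ 0 := by rintro rfl; rw [zero_mul] at hab; exact hf0 hab
    have hb0 : b ≠ 0 := by rintro rfl; rw [mul_zero] at hab; exact hf0 hab
    have hdeg : (toPoly δ f).natDegree = (toPoly δ a).natDegree + (toPoly δ b).natDegree := by
      rw [hf, hab, DiffPoly.natDegree_mul ha0 hb0]
    -- If f = ab, one of a, b vanishes in the division algebra, so its degree is at least deg f and
    -- the other factor has degree 0.
    have hdvd : ∀ y, y ≠ 0 → mk δ d₀ y = 0 → (toPoly δ f).natDegree ≤ (toPoly δ y).natDegree := by
      intro y hy0 hy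
      obtain ⟨q, rfl⟩ := (hker y).1 hy
      have hq0 : q ≠ 0 := by rintro rfl; exact hy0 (zero_mul _)
      rw [DiffPoly.natDegree_mul hq0 hf0]
      omega
    have hmul : mk δ d₀ a * mk δ d₀ b = 0 := by rw [← map_mul, ← hab, mk_extDiffPoly]
    by_cases ha : mk δ d₀ a = 0
    · right
      rw [DiffPoly.isUnit_iff]
      have := hdvd a ha0 ha
      exact ⟨hb0, by omega⟩
    · left
      rw [DiffPoly.isUnit_iff]
      have := hdvd b hb0 ((hdiv _ ha).mul_right_eq_zero.1 hmul)
      exact ⟨ha0, by omega⟩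

/-- `F[t]/(f)` embeds in an algebra `B ≅ (K,δ,d₀)` as a field iff `f` is irreducible. -/
theorem isField_adjoinRoot_iff {B : Type w} [Ring B] [Nontrivial B] [Algebra F B]
    (h : (derivMinpoly δ).natDegree ≠ 0) (φ : DiffExt δ d₀ →ₐ[F] B) :
    (IsField (AdjoinRoot (extPoly δ d₀)) ∧
      Module.finrank F (AdjoinRoot (extPoly δ d₀)) = (derivMinpoly δ).natDegree ∧
      ∃ ι : AdjoinRoot (extPoly δ d₀) →ₐ[F] B, Function.Injective ι ∧
        ι (AdjoinRoot.root (extPoly δ d₀)) = φ (root δ d₀)) ↔ Irreducible (extPoly δ d₀) := by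
  have hf0 : extPoly δ d₀ ≠ 0 := fun h0 => h (by
    rw [← natDegree_extPoly (δ := δ) d₀, h0, natDegree_zero])
  constructor
  · rintro ⟨hfield, -⟩
    have h1 : (Ideal.span {extPoly δ d₀}).IsMaximal := Ideal.Quotient.maximal_of_isField _ hfield
    exact ((Ideal.span_singleton_prime hf0).1 h1.isPrime).irreducible
  · intro hirr
    have := Fact.mk hirr
    have h0 : aeval (φ (root δ d₀)) (extPoly δ d₀) = 0 := by
      rw [aeval_algHom_apply, extPoly, map_sub, aeval_root, aeval_C, sub_self, map_zero]
    let ι : AdjoinRoot (extPoly δ d₀) →ₐ[F] B :=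
      Ideal.Quotient.liftₐ (Ideal.span {extPoly δ d₀}) (aeval (φ (root δ d₀))) fun a ha => by
        obtain ⟨b, rfl⟩ := Ideal.mem_span_singleton.1 ha
        rw [map_mul, h0, zero_mul]
    refine ⟨Field.toIsField _, ?_, ι, RingHom.injective ι.toRingHom, ?_⟩
    · rw [(AdjoinRoot.powerBasis hf0).finrank, AdjoinRoot.powerBasis_dim, natDegree_extPoly (δ := δ) d₀]
    · exact aeval_X _

theorem add_lmul_mul_lmul (δ : Derivation F K K) (b a : K) :
    (((δ : K →ₗ[F] K) : Module.End F K) + Algebra.lmul F K b) * Algebra.lmul F K a =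
      Algebra.lmul F K a * (((δ : K →ₗ[F] K) : Module.End F K) + Algebra.lmul F K b) +
        Algebra.lmul F K (δ a) := by
  rw [add_mul, mul_add, end_mul_lmul, ← map_mul, ← map_mul, mul_comm a b]
  abel

/-- A simple differential extension of dimension `m²` is split iff `d₀` is a value of `V_g`. -/
theorem nonempty_algEquiv_matrix_iff (p : ℕ) [Fact p.Prime] [CharP F p] (hδ : HasConstants δ)
    {e : ℕ} (he : (derivMinpoly δ).natDegree = p ^ e) (hK : Module.finrank F K = p ^ e) (d₀ : F)
    (hs : IsSimpleRing (DiffExt δ d₀)) (hfin : Module.finrank F (DiffExt δ d₀) = (p ^ e) ^ 2) :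
    Nonempty (DiffExt δ d₀ ≃ₐ[F] Matrix (Fin (p ^ e)) (Fin (p ^ e)) F) ↔
      ∃ b : K, algebraMap F K d₀ = polyV p e δ (derivMinpoly δ) b := by
  have hp : p.Prime := Fact.out
  have hpe : 0 < p ^ e := pow_pos hp.pos e
  have hKf : FiniteDimensional F K := FiniteDimensional.of_finrank_pos (by rw [hK]; exact hpe)
  have hBf : FiniteDimensional F (DiffExt δ d₀) :=
    FiniteDimensional.of_finrank_pos (by rw [hfin]; positivity)
  constructor
  · rintro ⟨θ⟩
    let V := Fin (p ^ e) → F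
    let Θ : DiffExt δ d₀ →ₐ[F] Module.End F V := (Matrix.toLinAlgEquiv'.toAlgHom).comp θ.toAlgHom
    let ι : K →ₐ[F] Module.End F V := Θ.comp ((mk δ d₀).comp (constHom δ))
    -- Through K the space F^{p^e} has K-dimension 1, so the class of t acts on a generator v as
    -- some scalar b of K.
    let : Module K V := Module.compHom V (ι : K →+* Module.End F V)
    have hsm : ∀ (a : K) (v : V), a • v = ι a v := fun _ _ => rfl
    have : IsScalarTower F K V := ⟨fun r a v => by
      rw [hsm, hsm, map_smul, LinearMap.smul_apply]⟩
    have hV : Module.finrank F V = p ^ e := by simp [V]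
    have : FiniteDimensional K V := FiniteDimensional.right F K V
    have h1 : Module.finrank K V = 1 := by
      have := Module.finrank_mul_finrank F K V
      rw [hK, hV] at this
      exact Nat.eq_of_mul_eq_mul_left hpe (by rw [this, mul_one])
    obtain ⟨v, hv0, hv⟩ := finrank_eq_one_iff'.1 h1
    obtain ⟨b, hb⟩ := hv (Θ (root δ d₀) v)
    rw [hsm] at hb
    refine ⟨b, ?_⟩
    set τ : Module.End F V := Θ (root δ d₀) - ι b with hτ
    have hpair0 : ∀ a, Θ (root δ d₀) * ι a = ι a * Θ (root δ d₀) + ι (δ a) := by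
      intro a
      have := congrArg Θ (root_mul (d₀ := d₀) (δ := δ) a)
      rwa [map_mul, map_add, map_mul] at this
    have hpair : ∀ a, τ * ι a = ι a * τ + ι (δ a) := by
      intro a
      rw [hτ, sub_mul, mul_sub, hpair0, ← map_mul, ← map_mul, mul_comm b a]
      abel
    have hτv : τ v = 0 := by rw [hτ, LinearMap.sub_apply, hb, sub_self]
    have h2 := aeval_derivMinpoly_add p hδ he hpair b
    rw [hτ, sub_add_cancel, ← hτ, aeval_algHom_apply, aeval_root, AlgHom.commutes] at h2
    have h3 := LinearMap.congr_fun h2 v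
    -- τ = t - b kills v and g has no constant term. Hence g(t) = g(τ) + V_g(b), applied to v, reads
    -- d₀ v = V_g(b) v.
    have h4 : aeval τ (derivMinpoly δ) v = 0 := by
      rw [aeval_eq_sum_range, LinearMap.sum_apply]
      refine Finset.sum_eq_zero fun i _ => ?_
      rcases i with _ | i
      · rw [derivMinpoly_coeff_zero, zero_smul, LinearMap.zero_apply]
      · rw [LinearMap.smul_apply, pow_succ, Module.End.mul_apply, hτv, map_zero, smul_zero]
    rw [LinearMap.add_apply, h4, zero_add, ← ι.commutes, ← hsm, ← hsm] at h3
    exact smul_left_injective K hv0 h3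
  · rintro ⟨b, hb⟩
    -- Letting t act on K as δ + b, one gets g(δ + b) = g(δ) + V_g(b) = d₀, so the action factors
    -- through (K,δ,d₀). It is injective by simplicity and bijective by dimension.
    let ψ : DiffPoly δ →ₐ[F] Module.End F K := DiffPoly.lift (Algebra.lmul F K) _ (add_lmul_mul_lmul δ b)
    have hψ : ψ (extDiffPoly δ d₀) = 0 := by
      rw [extDiffPoly_eq, map_sub, AlgHom.commutes, ← aeval_algHom_apply, lift_t,
        aeval_derivMinpoly_add p hδ he (end_mul_lmul δ), ← hb, AlgHom.commutes, derivMinpoly,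
        minpoly.aeval, zero_add, sub_self]
    let Ψ : DiffExt δ d₀ →ₐ[F] Module.End F K := lift ψ hψ
    have hinj : Function.Injective Ψ := RingHom.injective Ψ.toRingHom
    have hbij : Function.Bijective Ψ := by
      refine ⟨hinj, ?_⟩
      have := (LinearMap.injective_iff_surjective_of_finrank_eq_finrank (f := Ψ.toLinearMap) ?_).1 hinj
      · exact this
      · rw [hfin, Module.finrank_linearMap, hK, sq]
    let bK : Module.Basis (Fin (p ^ e)) F K := Module.finBasisOfFinrankEq F K hK
    exact ⟨(AlgEquiv.ofBijective Ψ hbij).trans (LinearMap.toMatrixAlgEquiv bK)⟩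

end DiffExt

end DiffExt

/-! ### Power sums over the prime field -/

section PowerSums

theorem sum_range_shift {M : Type*} [AddCommGroup M] (g : ℕ → M) (n : ℕ) :
    ∑ i ∈ Finset.range n, g (i + 1) = ∑ i ∈ Finset.range n, g i + (g n - g 0) := by
  rw [← sub_eq_iff_eq_add', ← Finset.sum_sub_distrib, Finset.sum_range_sub]

theorem sum_range_mul_eq {M : Type*} [AddCommMonoid M] (g : ℕ → M) (q n : ℕ) :
    ∑ i ∈ Finset.range (q * n), g i =
      ∑ j ∈ Finset.range n, ∑ i ∈ Finset.range q, g (q * j + i) := by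
  induction n with
  | zero => simp
  | succ n ih => rw [Nat.mul_succ, Finset.sum_range_add, ih, Finset.sum_range_succ]

theorem sum_range_natCast_pow (p : ℕ) [Fact p.Prime] (R : Type*) [Ring R] [CharP R p] {n : ℕ}
    (hn : n ≤ p - 1) :
    ∑ j ∈ Finset.range p, (j : R) ^ n = if n = p - 1 then -1 else 0 := by
  have hp : p.Prime := Fact.out
  have h1 : ∑ j ∈ Finset.range p, (j : ZMod p) ^ n = ∑ x : ZMod p, x ^ n := by
    refine Finset.sum_bij (fun j _ => (j : ZMod p)) (fun _ _ => Finset.mem_univ _) ?_ ?_ ?_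
    · intro a ha b hb hab
      rw [Finset.mem_range] at ha hb
      exact CharP.natCast_injOn_Iio (ZMod p) p ha hb hab
    · intro x _
      exact ⟨x.val, Finset.mem_range.2 (ZMod.val_lt x), ZMod.natCast_zmod_val x⟩
    · intro _ _; rfl
  have h2 : ∑ j ∈ Finset.range p, (j : ZMod p) ^ n = if n = p - 1 then -1 else 0 := by
    rw [h1]
    split_ifs with h
    · have h3 : ∀ x : ZMod p, x ^ n = if x = 0 then 0 else 1 := by
        intro x
        split_ifs with hx
        · rw [hx, zero_pow]
          have := hp.two_le
          omega
        · rw [h, ZMod.pow_card_sub_one_eq_one hx]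
      simp only [h3]
      rw [Finset.sum_ite, Finset.sum_const_zero, zero_add, Finset.sum_const, nsmul_eq_mul, mul_one,
        Finset.filter_ne', Finset.card_erase_of_mem (Finset.mem_univ _), Finset.card_univ,
        ZMod.card, Nat.cast_sub hp.one_le]
      simp
    · exact FiniteField.sum_pow_lt_card_sub_one _ _ (by rw [ZMod.card]; omega)
  have h3 := congrArg (ZMod.castHom (dvd_refl p) R) h2
  rw [map_sum] at h3
  simp only [map_pow, map_natCast] at h3
  rw [h3]
  split_ifs <;> simp

/-- Expanding, only the power sum of exponent p - 1 over the prime field is nonzero. This supplies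
the element of trace 1 at each Artin–Schreier step. -/
theorem sum_range_add_natCast_pow (p : ℕ) [Fact p.Prime] {R : Type*} [Ring R] [CharP R p] (x : R) :
    ∑ j ∈ Finset.range p, (x + (j : R)) ^ (p - 1) = -1 := by
  have hp : p.Prime := Fact.out
  have h1 : ∀ j : ℕ, (x + (j : R)) ^ (p - 1) =
      ∑ k ∈ Finset.range p, x ^ k * (j : R) ^ (p - 1 - k) * ((p - 1).choose k : R) := by
    intro j
    rw [(Nat.cast_commute j x).symm.add_pow, Nat.sub_add_cancel hp.one_le]
  simp only [h1]
  rw [Finset.sum_comm]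
  simp only [← Finset.sum_mul, ← Finset.mul_sum]
  rw [Finset.sum_eq_single 0]
  · rw [sum_range_natCast_pow p R (Nat.sub_le _ _)]
    simp
  · intro k hk hk0
    rw [Finset.mem_range] at hk
    rw [sum_range_natCast_pow p R (Nat.sub_le _ _), if_neg (by omega), mul_zero, zero_mul]
  · intro h
    exact absurd (Finset.mem_range.2 hp.pos) h

theorem sum_pow_char_of_commute (p : ℕ) [Fact p.Prime] {R : Type*} [Ring R] [CharP R p]
    (f : ℕ → R) (n : ℕ) (hf : ∀ i j, Commute (f i) (f j)) :
    (∑ i ∈ Finset.range n, f i) ^ p = ∑ i ∈ Finset.range n, f i ^ p := by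
  induction n with
  | zero => simp [(Fact.out : p.Prime).ne_zero]
  | succ n ih =>
    rw [Finset.sum_range_succ, Finset.sum_range_succ, add_pow_char_of_commute, ih]
    exact Commute.sum_left _ _ _ fun i _ => hf i n

end PowerSums

/-! ### An Artin–Schreier tower inside a noncommutative algebra -/

section Tower

variable {F : Type u} {B : Type w} [Field F] [Ring B] [Algebra F B]

theorem commute_of_mem_adjoin {s : Set B} {c : B} (hc : ∀ y ∈ s, c * y = y * c) {y : B}
    (hy : y ∈ Algebra.adjoin F s) : c * y = y * c := by
  have h : Algebra.adjoin F s ≤ Subalgebra.centralizer F {c} :=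
    Algebra.adjoin_le fun z hz => by
      rw [SetLike.mem_coe, Subalgebra.mem_centralizer_iff]
      rintro _ rfl
      exact hc z hz
  exact (Subalgebra.mem_centralizer_iff F).1 (h hy) c rfl

/-- A commutative subalgebra, stable under `σ`, which behaves like a cyclic Galois algebra of
degree `p^k` with generator `σ`; the last field is a projection on its centralizer. -/
structure IsCyclicTower (p k : ℕ) (σ : B ≃ₐ[F] B) (L : Subalgebra F B) : Prop where
  comm : ∀ x ∈ L, ∀ y ∈ L, x * y = y * x
  map_mem : ∀ x ∈ L, σ x ∈ L
  pow_apply : ∀ x ∈ L, (σ ^ p ^ k) x = x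
  -- Separability in disguise: F-derivations kill p-th powers, so an algebra generated by them is
  -- unramified.
  le_adjoin : L ≤ Algebra.adjoin F ((fun x => x ^ p) '' L)
  trace : ∃ θ ∈ L, ∑ i ∈ Finset.range (p ^ k), (σ ^ i) θ = 1
  -- π isolates the part of B commuting with L: an element inducing σ^i on L survives exactly when
  -- p^k divides i. It is linear over the centralizer of L and compatible with the powers of
  -- σ^{p^k}.
  proj : ∃ π : B →ₗ[F] B, (∀ b, ∀ y ∈ L, π b * y = y * π b) ∧
    (∀ c, (∀ y ∈ L, c * y = y * c) → ∀ b, π (c * b) = c * π b ∧ π (b * c) = π b * c) ∧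
    (∀ n, p ^ k ∣ n → ∀ b, π ((σ ^ n) b) = (σ ^ n) (π b)) ∧
    ∀ b i, (∀ y ∈ L, b * y = (σ ^ i) y * b) → π b = if p ^ k ∣ i then b else 0

theorem isCyclicTower_bot (p : ℕ) (σ : B ≃ₐ[F] B) : IsCyclicTower p 0 σ (⊥ : Subalgebra F B) where
  comm x hx y _ := by
    obtain ⟨r, rfl⟩ := Algebra.mem_bot.1 hx
    exact Algebra.commutes r y
  map_mem x hx := by
    obtain ⟨r, rfl⟩ := Algebra.mem_bot.1 hx
    rw [AlgEquiv.commutes]; exact hx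
  pow_apply x hx := by
    obtain ⟨r, rfl⟩ := Algebra.mem_bot.1 hx
    rw [AlgEquiv.commutes]
  le_adjoin := bot_le
  trace := ⟨1, one_mem _, by simp⟩
  proj := ⟨LinearMap.id, fun b y hy => by
      obtain ⟨r, rfl⟩ := Algebra.mem_bot.1 hy
      exact (Algebra.commutes r _).symm,
    fun _ _ _ => ⟨rfl, rfl⟩, fun _ _ _ => rfl, fun b i _ => by simp⟩

theorem alg_pow_succ_apply (σ : B ≃ₐ[F] B) (n : ℕ) (x : B) : σ ((σ ^ n) x) = (σ ^ (n + 1)) x := by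
  rw [pow_succ', AlgEquiv.mul_apply]

theorem alg_pow_add_apply (σ : B ≃ₐ[F] B) (n k : ℕ) (x : B) :
    (σ ^ (n + k)) x = (σ ^ n) ((σ ^ k) x) := by
  rw [pow_add, AlgEquiv.mul_apply]

variable {p k e : ℕ} {σ : B ≃ₐ[F] B} {L : Subalgebra F B}

/-- Additive Hilbert 90. -/
theorem exists_sub_eq_of_trace_eq_zero {q : ℕ} {θ y : B}
    (hL : ∀ x ∈ L, σ x ∈ L) (hθL : θ ∈ L) (hyL : y ∈ L)
    (hθ : ∑ i ∈ Finset.range q, (σ ^ i) θ = 1) (hy : ∑ i ∈ Finset.range q, (σ ^ i) y = 0) :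
    ∃ s ∈ L, σ s = s + y := by
  have hpow : ∀ n, ∀ x ∈ L, (σ ^ n) x ∈ L := by
    intro n x hx
    induction n with
    | zero => simpa using hx
    | succ n ih => rw [← alg_pow_succ_apply]; exact hL _ ih
  let S : ℕ → B := fun i => ∑ j ∈ Finset.range i, (σ ^ j) y
  have hS : ∀ i, σ (S i) = S (i + 1) - y := by
    intro i
    simp only [S, map_sum, alg_pow_succ_apply]
    rw [Finset.sum_range_succ', pow_zero, AlgEquiv.one_apply, add_sub_cancel_right]
  -- The usual Hilbert 90 witness: partial sums S_i of the orbit of y, weighted by the conjugates of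
  -- the trace-one element θ.
  refine ⟨-∑ i ∈ Finset.range q, S i * (σ ^ i) θ, L.neg_mem (L.sum_mem fun i _ =>
    L.mul_mem (L.sum_mem fun j _ => hpow j _ hyL) (hpow i _ hθL)), ?_⟩
  have h1 : ∑ i ∈ Finset.range q, (σ ^ (i + 1)) θ = 1 := by
    simp only [← alg_pow_succ_apply]
    rw [← map_sum, hθ, map_one]
  rw [map_neg, map_sum]
  simp only [map_mul, hS, alg_pow_succ_apply, sub_mul, Finset.sum_sub_distrib]
  rw [← Finset.mul_sum, h1, sum_range_shift (fun i => S i * (σ ^ i) θ)]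
  have hSq : S q = 0 := hy
  have hS0 : S 0 = 0 := Finset.sum_range_zero _
  simp only [hSq, hS0, zero_mul, sub_zero, add_zero, mul_one]
  abel

theorem IsCyclicTower.pow_mem (h : IsCyclicTower p k σ L) (n : ℕ) {x : B} (hx : x ∈ L) :
    (σ ^ n) x ∈ L := by
  induction n with
  | zero => simpa using hx
  | succ n ih => rw [← alg_pow_succ_apply]; exact h.map_mem _ ih

theorem IsCyclicTower.pow_mul_apply (h : IsCyclicTower p k σ L) (n : ℕ) {x : B} (hx : x ∈ L) :
    (σ ^ (p ^ k * n)) x = x := by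
  induction n with
  | zero => simp
  | succ n ih => rw [Nat.mul_succ, alg_pow_add_apply, h.pow_apply x hx, ih]

theorem IsCyclicTower.exists_pow_eq [Fact p.Prime] (h : IsCyclicTower p k σ L) (j : ℕ) {y : B}
    (hy : y ∈ L) : ∃ y' ∈ L, (σ ^ j) y' = y := by
  refine ⟨(σ ^ (p ^ k * j - j)) y, h.pow_mem _ hy, ?_⟩
  have : j ≤ p ^ k * j := Nat.le_mul_of_pos_left _ (pow_pos (Fact.out : p.Prime).pos k)
  rw [← alg_pow_add_apply, Nat.add_sub_cancel' this, h.pow_mul_apply _ hy]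

/-- The next Artin–Schreier generator of the tower. -/
theorem IsCyclicTower.exists_generator [Fact p.Prime] [CharP B p] (h : IsCyclicTower p k σ L)
    (hk : ∃ b, (σ ^ p ^ k) b = b + 1)
    (hσ : ∀ u, σ u = u → u ^ p ^ e ∈ (algebraMap F B).range) :
    ∃ θ ∈ L, ∑ i ∈ Finset.range (p ^ k), (σ ^ i) θ = 1 ∧
      ∃ x, σ x = x + θ ∧ (∀ y ∈ L, x * y = y * x) ∧ x ^ p - x ∈ L := by
  have hp : p.Prime := Fact.out
  obtain ⟨θ, hθL, hθ⟩ := h.trace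
  obtain ⟨π, hπ1, hπ2, hπ3, hπ4⟩ := h.proj
  obtain ⟨b, hb⟩ := hk
  refine ⟨θ, hθL, hθ, ?_⟩
  set q := p ^ k with hq
  have hπone : π 1 = 1 := by
    rw [hπ4 1 0 (fun y _ => by simp), if_pos (dvd_zero _)]
  have hx0 : (σ ^ q) (π b) = π b + 1 := by
    rw [← hπ3 q dvd_rfl, hb, map_add, hπone]
  -- Telescoping: σ(x₁) - x₁ = σ^q(θ π(b)) - θ π(b), which is θ because σ^q fixes θ and adds 1 to
  -- π(b). Projecting b first is what makes `x₁` commute with L.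
  set x₁ : B := ∑ j ∈ Finset.range q, (σ ^ j) (θ * π b) with hx₁
  have hσx₁ : σ x₁ = x₁ + θ := by
    rw [hx₁, map_sum]
    simp only [alg_pow_succ_apply]
    rw [sum_range_shift (fun j => (σ ^ j) (θ * π b)), map_mul, h.pow_apply θ hθL, hx0]
    simp [mul_add]
  have hx₁L : ∀ y ∈ L, x₁ * y = y * x₁ := by
    intro y hy
    rw [hx₁, Finset.sum_mul, Finset.mul_sum]
    refine Finset.sum_congr rfl fun j _ => ?_
    obtain ⟨y', hy', rfl⟩ := h.exists_pow_eq j hy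
    rw [← map_mul, ← map_mul, mul_assoc, hπ1 b y' hy', ← mul_assoc, h.comm θ hθL y' hy', mul_assoc]
  -- θ^p - θ has trace 1^p - 1 = 0, so it equals σ(s) - s with s in L. Hence u = x₁^p - x₁ - s is
  -- fixed by σ, though possibly outside L.
  obtain ⟨s, hsL, hs⟩ := exists_sub_eq_of_trace_eq_zero (y := θ ^ p - θ) h.map_mem hθL
    (L.sub_mem (L.pow_mem hθL p) hθL) hθ (by
      simp only [map_sub, Finset.sum_sub_distrib, map_pow]
      rw [← sum_pow_char_of_commute p (fun i => (σ ^ i) θ) _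
        fun i j => h.comm _ (h.pow_mem i hθL) _ (h.pow_mem j hθL), hθ, one_pow, sub_self])
  set u : B := x₁ ^ p - x₁ - s with hu
  have hσu : σ u = u := by
    have hc : Commute x₁ θ := hx₁L θ hθL
    rw [hu, map_sub, map_sub, map_pow, hσx₁, add_pow_char_of_commute _ hc, hs]
    abel
  obtain ⟨c, hc⟩ := hσ u hσu
  have hux₁ : Commute x₁ u :=
    (((Commute.refl x₁).pow_right p).sub_right (Commute.refl x₁)).sub_right (hx₁L s hsL)
  have huL : ∀ y ∈ L, Commute u y := fun y hy =>
    (((show Commute x₁ y from hx₁L y hy).pow_left p).sub_left (hx₁L y hy)).sub_left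
      (h.comm s hsL y hy)
  -- v^p - v telescopes to u^{p^e} - u, and u^{p^e} lies in F. Adding v to `x₁` therefore replaces
  -- the error u by a scalar, without changing the action of σ.
  set v : B := ∑ j ∈ Finset.range e, u ^ p ^ j with hv
  have hσv : σ v = v := by
    rw [hv, map_sum]
    exact Finset.sum_congr rfl fun j _ => by rw [map_pow, hσu]
  have hvp : v ^ p = v + (u ^ p ^ e - u) := by
    rw [hv, sum_pow_char_of_commute p _ _ fun i j => (Commute.refl u).pow_pow _ _]
    simp only [← pow_mul, ← pow_succ]
    rw [sum_range_shift (fun j => u ^ p ^ j), pow_zero, pow_one]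
  refine ⟨x₁ + v, ?_, fun y hy => ?_, ?_⟩
  · rw [map_add, hσx₁, hσv]; abel
  · exact (show Commute x₁ y from hx₁L y hy).add_left
      (Commute.sum_left _ _ _ fun j _ => (huL y hy).pow_left _)
  · have hcv : Commute x₁ v := Commute.sum_right _ _ _ fun j _ => hux₁.pow_right _
    have h1 : (x₁ + v) ^ p - (x₁ + v) = s + algebraMap F B c := by
      rw [add_pow_char_of_commute _ hcv, hvp, hc, hu]
      abel
    rw [h1]
    exact L.add_mem hsL (L.algebraMap_mem c)

/-- The commutator with `x`. -/
def adMap (F : Type u) {B : Type w} [Field F] [Ring B] [Algebra F B] (x : B) : Module.End F B :=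
  LinearMap.mulLeft F x - LinearMap.mulRight F x

theorem adMap_apply (x b : B) : adMap F x b = x * b - b * x := rfl

theorem adMap_pow_char (p : ℕ) [Fact p.Prime] [CharP F p] (x : B) :
    adMap F x ^ p = adMap F (x ^ p) := by
  nontriviality B
  have : CharP (Module.End F B) p := charP_of_injective_algebraMap
    (FaithfulSMul.algebraMap_injective F _) p
  rw [adMap, sub_pow_char_of_commute _ (LinearMap.commute_mulLeft_right (R := F) x x),
    LinearMap.pow_mulLeft, LinearMap.pow_mulRight]
  rfl

theorem adMap_pow_mul_left {x c : B} (hc : c * x = x * c) (n : ℕ) (b : B) :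
    (adMap F x ^ n) (c * b) = c * (adMap F x ^ n) b := by
  induction n with
  | zero => rfl
  | succ n ih =>
    rw [pow_succ', Module.End.mul_apply, Module.End.mul_apply, ih, adMap_apply,
      adMap_apply, ← mul_assoc, ← hc, mul_sub, mul_assoc, mul_assoc]

theorem adMap_pow_mul_right {x c : B} (hc : c * x = x * c) (n : ℕ) (b : B) :
    (adMap F x ^ n) (b * c) = (adMap F x ^ n) b * c := by
  induction n with
  | zero => rfl
  | succ n ih =>
    rw [pow_succ', Module.End.mul_apply, Module.End.mul_apply, ih, adMap_apply,
      adMap_apply, mul_assoc _ c x, hc, sub_mul, mul_assoc, mul_assoc]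

theorem map_adMap_pow (τ : B ≃ₐ[F] B) {x : B} (hx : τ x = x) (n : ℕ) (b : B) :
    τ ((adMap F x ^ n) b) = (adMap F x ^ n) (τ b) := by
  induction n with
  | zero => rfl
  | succ n ih =>
    rw [pow_succ', Module.End.mul_apply, Module.End.mul_apply, ← ih, adMap_apply,
      adMap_apply, map_sub, map_mul, map_mul, hx]

theorem adMap_pow_of_eq {x c b : B} (hcx : c * x = x * c) (h : adMap F x b = c * b) (n : ℕ) :
    (adMap F x ^ n) b = c ^ n * b := by
  induction n with
  | zero => simp
  | succ n ih =>
    rw [pow_succ, Module.End.mul_apply, h, adMap_pow_mul_left hcx, ih, ← mul_assoc, ← pow_succ']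

theorem neg_natCast_pow_sub_one (p : ℕ) [Fact p.Prime] (R : Type*) [Ring R] [CharP R p] (j : ℕ) :
    (-(j : R)) ^ (p - 1) = if p ∣ j then 0 else 1 := by
  have hp : p.Prime := Fact.out
  split_ifs with hj
  · rw [(CharP.cast_eq_zero_iff R p j).2 hj, neg_zero, zero_pow]
    have := hp.two_le
    omega
  · have h1 : (-(j : ZMod p)) ^ (p - 1) = 1 :=
      ZMod.pow_card_sub_one_eq_one (neg_ne_zero.2 fun h => hj ((CharP.cast_eq_zero_iff _ p j).1 h))
    simpa using congrArg (ZMod.castHom (dvd_refl p) R) h1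

/-- L is enlarged by a generator x with σ^q(x) = x + 1, q = p^k, and x^p - x in L. Elements inducing
a power of σ^q are eigenvectors of ad(x) with eigenvalue in the prime field, so 1 - ad(x)^{p-1}
projects them to the centralizer of x. -/
theorem IsCyclicTower.succ [Fact p.Prime] [CharP F p] [Nontrivial B] (h : IsCyclicTower p k σ L)
    (hk : ∃ b, (σ ^ p ^ k) b = b + 1)
    (hσ : ∀ u, σ u = u → u ^ p ^ e ∈ (algebraMap F B).range) :
    ∃ L' : Subalgebra F B, IsCyclicTower p (k + 1) σ L' := by
  have hp : p.Prime := Fact.out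
  have : CharP B p := charP_of_injective_algebraMap (FaithfulSMul.algebraMap_injective F B) p
  obtain ⟨θ, hθL, hθ, x, hσx, hxL, hxp⟩ := h.exists_generator hk hσ
  obtain ⟨π, hπ1, hπ2, hπ3, hπ4⟩ := h.proj
  set q := p ^ k with hq
  set L' : Subalgebra F B := Algebra.adjoin F ((L : Set B) ∪ {x}) with hL'
  have hLL' : ∀ y ∈ L, y ∈ L' := fun y hy => Algebra.subset_adjoin (Or.inl hy)
  have hxL' : x ∈ L' := Algebra.subset_adjoin (Or.inr rfl)
  have hpow : ∀ n, (σ ^ n) x = x + ∑ i ∈ Finset.range n, (σ ^ i) θ := by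
    intro n
    induction n with
    | zero => simp
    | succ n ih => rw [pow_succ, AlgEquiv.mul_apply, hσx, map_add, ih, Finset.sum_range_succ,
        add_assoc]
  have hqx : ∀ j : ℕ, (σ ^ (q * j)) x = x + j := by
    intro j
    induction j with
    | zero => simp
    | succ j ih =>
      rw [Nat.mul_succ, alg_pow_add_apply, hpow q, hθ, map_add, map_one, ih, Nat.cast_succ,
        add_assoc]
  have hqpx : (σ ^ p ^ (k + 1)) x = x := by
    rw [pow_succ, ← hq, hqx, CharP.cast_eq_zero, add_zero]
  refine ⟨L', ⟨?_, ?_, ?_, ?_, ?_, ?_⟩⟩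
  · have h1 : ∀ z ∈ L', ∀ y ∈ (L : Set B) ∪ {x}, z * y = y * z := by
      rintro z hz y (hy | rfl)
      · refine (commute_of_mem_adjoin (c := y) ?_ hz).symm
        rintro w (hw | rfl)
        · exact h.comm _ hy _ hw
        · exact (hxL y hy).symm
      · refine (commute_of_mem_adjoin (c := y) ?_ hz).symm
        rintro w (hw | rfl)
        · exact hxL w hw
        · rfl
    exact fun z hz y hy => commute_of_mem_adjoin (h1 z hz) hy
  · have h1 : L' ≤ L'.comap (σ : B →ₐ[F] B) := by
      refine Algebra.adjoin_le ?_
      rintro y (hy | rfl)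
      · exact hLL' _ (h.map_mem y hy)
      · change σ y ∈ L'
        rw [hσx]
        exact L'.add_mem hxL' (hLL' _ hθL)
    exact fun y hy => h1 hy
  · have h1 : L' ≤ AlgHom.equalizer ((σ ^ p ^ (k + 1) : B ≃ₐ[F] B) : B →ₐ[F] B) (AlgHom.id F B) := by
      refine Algebra.adjoin_le ?_
      rintro y (hy | rfl)
      · change (σ ^ p ^ (k + 1)) y = y
        rw [pow_succ, h.pow_mul_apply _ hy]
      · exact hqpx
    exact fun y hy => h1 hy
  · have h1 : Algebra.adjoin F ((fun x => x ^ p) '' (L : Set B)) ≤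
        Algebra.adjoin F ((fun x => x ^ p) '' (L' : Set B)) :=
      Algebra.adjoin_mono (Set.image_mono hLL')
    refine Algebra.adjoin_le ?_
    rintro y (hy | rfl)
    · exact h1 (h.le_adjoin hy)
    -- x = x^p - (x^p - x), where x^p - x is in L and so is already generated by p-th powers.
    · rw [← sub_sub_cancel (y ^ p) y]
      exact Subalgebra.sub_mem _ (Algebra.subset_adjoin ⟨y, hxL', rfl⟩) (h1 (h.le_adjoin hxp))
  -- Summing over the powers of σ^q, which translate x by 0, ..., p - 1, gives θ; the remaining sum
  -- of conjugates of θ is 1.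
  · refine ⟨-(θ * x ^ (p - 1)), L'.neg_mem (L'.mul_mem (hLL' _ hθL) (L'.pow_mem hxL' _)), ?_⟩
    rw [pow_succ, ← hq, sum_range_mul_eq, Finset.sum_comm]
    refine Eq.trans (Finset.sum_congr rfl fun i _ => ?_) hθ
    have h1 : ∀ j, (σ ^ (q * j + i)) (-(θ * x ^ (p - 1))) =
        (σ ^ i) (-(θ * (x + (j : B)) ^ (p - 1))) := by
      intro j
      rw [add_comm, alg_pow_add_apply, map_neg (σ ^ (q * j)), map_mul (σ ^ (q * j)),
        h.pow_mul_apply _ hθL, map_pow (σ ^ (q * j)), hqx]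
    simp only [h1]
    rw [← map_sum, Finset.sum_neg_distrib, ← Finset.mul_sum, sum_range_add_natCast_pow]
    congr 1
    rw [mul_neg, mul_one, neg_neg]
  · refine ⟨π - (adMap F x ^ (p - 1)) ∘ₗ π, fun b => ?_, fun c hc b => ?_, fun n hn b => ?_,
      fun b i hb => ?_⟩
    · have h1 : ∀ y ∈ L, (π - (adMap F x ^ (p - 1)) ∘ₗ π) b * y =
          y * (π - (adMap F x ^ (p - 1)) ∘ₗ π) b := by
        intro y hy
        change (π b - (adMap F x ^ (p - 1)) (π b)) * y = y * (π b - (adMap F x ^ (p - 1)) (π b))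
        rw [sub_mul, mul_sub, ← adMap_pow_mul_left (hxL y hy).symm,
          ← adMap_pow_mul_right (hxL y hy).symm, hπ1 b y hy]
      refine fun y hy => commute_of_mem_adjoin ?_ hy
      rintro y (hy | rfl)
      · exact h1 y hy
      · refine (sub_eq_zero.1 ?_).symm
        change adMap F y (π b - (adMap F y ^ (p - 1)) (π b)) = 0
        -- ad(x)(1 - ad(x)^{p-1}) = ad(x - x^p), which vanishes on π(b) because x^p - x lies in L.
        rw [map_sub, ← Module.End.mul_apply (adMap F y) (adMap F y ^ (p - 1)), ← pow_succ',
          Nat.sub_add_cancel hp.one_le, adMap_pow_char]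
        have h2 := hπ1 b _ hxp
        rw [sub_mul, mul_sub] at h2
        rw [adMap_apply, adMap_apply]
        rw [sub_eq_sub_iff_sub_eq_sub] at h2
        rw [sub_eq_zero, ← neg_inj, neg_sub, neg_sub, eq_comm, ← sub_eq_zero]
        rw [← sub_eq_zero] at h2
        rw [← h2]
    · obtain ⟨h1, h2⟩ := hπ2 c (fun y hy => hc y (hLL' y hy)) b
      have hcx := hc x hxL'
      constructor
      · change π (c * b) - (adMap F x ^ (p - 1)) (π (c * b)) =
          c * (π b - (adMap F x ^ (p - 1)) (π b))
        rw [h1, adMap_pow_mul_left hcx, mul_sub]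
      · change π (b * c) - (adMap F x ^ (p - 1)) (π (b * c)) =
          (π b - (adMap F x ^ (p - 1)) (π b)) * c
        rw [h2, adMap_pow_mul_right hcx, sub_mul]
    · change π ((σ ^ n) b) - (adMap F x ^ (p - 1)) (π ((σ ^ n) b)) =
        (σ ^ n) (π b - (adMap F x ^ (p - 1)) (π b))
      have hnx : (σ ^ n) x = x := by
        obtain ⟨r, rfl⟩ := hn
        rw [pow_succ, ← hq, mul_assoc, hqx, Nat.cast_mul, CharP.cast_eq_zero, zero_mul, add_zero]
      rw [hπ3 n ((pow_dvd_pow p (Nat.le_succ k)).trans hn), map_sub, map_adMap_pow _ hnx]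
    · change π b - (adMap F x ^ (p - 1)) (π b) = _
      rw [hπ4 b i fun y hy => hb y (hLL' y hy)]
      by_cases hi : q ∣ i
      · obtain ⟨j, rfl⟩ := hi
        rw [if_pos (dvd_mul_right _ _)]
        have h1 := hb x hxL'
        rw [hqx] at h1
        have h2 : adMap F x b = -(j : B) * b := by
          rw [adMap_apply, h1]
          noncomm_ring
        have hcx : -(j : B) * x = x * -(j : B) := by
          rw [neg_mul, mul_neg, Nat.cast_comm]
        rw [adMap_pow_of_eq hcx h2, neg_natCast_pow_sub_one p B j]
        have h3 : p ^ (k + 1) ∣ q * j ↔ p ∣ j := by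
          rw [pow_succ, ← hq, Nat.mul_dvd_mul_iff_left (pow_pos hp.pos k)]
        simp only [h3]
        split_ifs <;> simp
      · rw [if_neg hi, map_zero, sub_zero, if_neg fun h => hi ((pow_dvd_pow p (Nat.le_succ k)).trans h)]

theorem exists_isCyclicTower [Fact p.Prime] [CharP F p] [Nontrivial B] {n : ℕ}
    (hk : ∀ k < n, ∃ b, (σ ^ p ^ k) b = b + 1)
    (hσ : ∀ u, σ u = u → u ^ p ^ e ∈ (algebraMap F B).range) :
    ∃ L : Subalgebra F B, IsCyclicTower p n σ L := by
  induction n with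
  | zero => exact ⟨⊥, isCyclicTower_bot p σ⟩
  | succ n ih =>
    obtain ⟨L, hL⟩ := ih fun k hk' => hk k (hk'.trans (Nat.lt_succ_self n))
    exact hL.succ (hk n (Nat.lt_succ_self n)) hσ

end Tower

/-! ### Dimension of L, the decomposition of B, and the fixed elements -/

section CyclicTowerTop

variable {F : Type u} {B : Type w} [Field F] [Ring B] [Algebra F B]
  {p e : ℕ} {σ : B ≃ₐ[F] B} {L : Subalgebra F B} {z : B}

theorem mul_pow_eq_of_mul_eq (hσ : ∀ b, z * b = σ b * z) (n : ℕ) (b : B) :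
    z ^ n * b = (σ ^ n) b * z ^ n := by
  induction n with
  | zero => simp
  | succ n ih => rw [pow_succ', mul_assoc, ih, ← mul_assoc, hσ, mul_assoc, alg_pow_succ_apply]

/-- Right multiplication by z^{p^e - j} moves the j-th term to exponent p^e. The i-th term then
induces σ^{i + p^e - j} on L, so π keeps only i = j. -/
theorem IsCyclicTower.eq_zero_of_sum_eq_zero [Fact p.Prime] (h : IsCyclicTower p e σ L)
    (hσ : ∀ b, z * b = σ b * z) (hz : IsUnit z) {y : ℕ → B} (hy : ∀ i < p ^ e, y i ∈ L)
    (h0 : ∑ i ∈ Finset.range (p ^ e), y i * z ^ i = 0) : ∀ j < p ^ e, y j = 0 := by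
  intro j hj
  obtain ⟨π, -, -, -, hπ⟩ := h.proj
  have h1 : ∀ i ∈ Finset.range (p ^ e), π (y i * z ^ i * z ^ (p ^ e - j)) =
      if i = j then y j * z ^ p ^ e else 0 := by
    intro i hi
    rw [Finset.mem_range] at hi
    have h2 : ∀ x ∈ L, y i * z ^ (i + (p ^ e - j)) * x =
        (σ ^ (i + (p ^ e - j))) x * (y i * z ^ (i + (p ^ e - j))) := by
      intro x hx
      rw [mul_assoc, mul_pow_eq_of_mul_eq hσ, ← mul_assoc, h.comm _ (hy i hi) _ (h.pow_mem _ hx),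
        mul_assoc]
    rw [mul_assoc, ← pow_add, hπ _ _ h2]
    have h3 : p ^ e ∣ i + (p ^ e - j) ↔ i = j := by
      constructor
      · rintro ⟨r, hr⟩
        have h4 : r ≠ 0 := by rintro rfl; omega
        have h5 : r < 2 := by
          by_contra! h5
          have := Nat.mul_le_mul_left (p ^ e) h5
          omega
        obtain rfl : r = 1 := by omega
        omega
      · rintro rfl
        rw [Nat.add_sub_cancel' hi.le]
    simp only [h3]
    split_ifs with h6
    · subst h6
      rw [Nat.add_sub_cancel' hi.le]
    · rfl
  have h2 : ∑ i ∈ Finset.range (p ^ e), π (y i * z ^ i * z ^ (p ^ e - j)) = 0 := by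
    rw [← map_sum, ← Finset.sum_mul, h0, zero_mul, map_zero]
  rw [Finset.sum_congr rfl h1, Finset.sum_ite_eq' (Finset.range (p ^ e)) j,
    if_pos (Finset.mem_range.2 hj)] at h2
  exact (hz.pow _).mul_left_eq_zero.1 h2

/-- The map `(yᵢ) ↦ ∑ yᵢ zⁱ`. -/
def sumMulPow (L : Subalgebra F B) (z : B) (m : ℕ) : (Fin m → L) →ₗ[F] B :=
  ∑ i : Fin m, LinearMap.mulRight F (z ^ (i : ℕ)) ∘ₗ L.val.toLinearMap ∘ₗ LinearMap.proj i

theorem sumMulPow_apply (m : ℕ) (y : Fin m → L) :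
    sumMulPow L z m y = ∑ i : Fin m, (y i : B) * z ^ (i : ℕ) := by
  simp [sumMulPow]

theorem IsCyclicTower.sumMulPow_injective [Fact p.Prime] (h : IsCyclicTower p e σ L)
    (hσ : ∀ b, z * b = σ b * z) (hz : IsUnit z) : Function.Injective (sumMulPow L z (p ^ e)) := by
  refine (injective_iff_map_eq_zero _).2 fun y hy => ?_
  rw [sumMulPow_apply] at hy
  have h1 := h.eq_zero_of_sum_eq_zero hσ hz
    (y := fun i => if hi : i < p ^ e then (y ⟨i, hi⟩ : B) else 0)
    (fun i hi => by simp [hi]) (by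
      rw [← Fin.sum_univ_eq_sum_range (fun i => (if hi : i < p ^ e then (y ⟨i, hi⟩ : B) else 0) *
        z ^ i), ← hy]
      exact Finset.sum_congr rfl fun i _ => by simp)
  funext i
  have h2 := h1 i i.2
  simpa using h2

/-- The restriction of `σ` to `L`, as an `F`-linear map. -/
def IsCyclicTower.restrict (h : IsCyclicTower p e σ L) : Module.End F L :=
  (σ : B →ₐ[F] B).toLinearMap.restrict (p := Subalgebra.toSubmodule L)
    (q := Subalgebra.toSubmodule L) h.map_mem

theorem IsCyclicTower.coe_restrict_pow (h : IsCyclicTower p e σ L) (n : ℕ) (y : L) :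
    ((h.restrict ^ n) y : B) = (σ ^ n) (y : B) := by
  induction n with
  | zero => rfl
  | succ n ih =>
    rw [pow_succ', Module.End.mul_apply, ← alg_pow_succ_apply, ← ih]
    rfl

/-- The restriction of σ to L is annihilated by (X - 1)^{p^e}. It is not annihilated by (X - 1)^{p^e
- 1}, which equals 1 + X + ... + X^{p^e - 1}, as the trace takes the value 1. So its minimum
polynomial has degree p^e. -/
theorem IsCyclicTower.le_finrank [Fact p.Prime] [CharP F p] [Nontrivial B] [FiniteDimensional F L]
    (h : IsCyclicTower p e σ L) : p ^ e ≤ Module.finrank F L := by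
  have hp : p.Prime := Fact.out
  have hpos : 0 < p ^ e := pow_pos hp.pos e
  have : CharP (Module.End F L) p := charP_of_injective_algebraMap
    (FaithfulSMul.algebraMap_injective F _) p
  set T := h.restrict with hT
  have h1 : T ^ p ^ e = 1 := by
    ext y
    rw [h.coe_restrict_pow, h.pow_apply _ y.2]; rfl
  have hXp : (X - 1 : F[X]) ^ p ^ e = X ^ p ^ e - 1 := by
    rw [sub_pow_char_pow, one_pow]
  have h2 : minpoly F T ∣ (X - C 1) ^ p ^ e := by
    refine minpoly.dvd F T ?_
    rw [C_1, hXp, map_sub, map_pow, aeval_X, h1, map_one, sub_self]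
  obtain ⟨i, hi, hi2⟩ := (dvd_prime_pow (prime_X_sub_C (1 : F)) _).1 h2
  have h3 : minpoly F T = (X - C 1) ^ i :=
    eq_of_monic_of_associated (minpoly.monic (Algebra.IsIntegral.isIntegral _))
      ((monic_X_sub_C 1).pow i) hi2
  have h4 : (minpoly F T).natDegree = i := by
    rw [h3, natDegree_pow, natDegree_X_sub_C, mul_one]
  have h5 : i = p ^ e := by
    by_contra h5
    obtain ⟨θ, hθL, hθ⟩ := h.trace
    have h6 : minpoly F T ∣ (X - 1) ^ (p ^ e - 1) := by
      rw [h3, C_1]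
      exact pow_dvd_pow _ (by omega)
    have h7 : (X - 1 : F[X]) ^ (p ^ e - 1) = ∑ j ∈ Finset.range (p ^ e), X ^ j := by
      have h8 : (X - 1 : F[X]) ≠ 0 := by rw [← C_1]; exact X_sub_C_ne_zero 1
      refine mul_right_cancel₀ h8 ?_
      rw [← pow_succ, Nat.sub_add_cancel hpos, hXp, geom_sum_mul]
    have h9 : aeval T ((X - 1 : F[X]) ^ (p ^ e - 1)) = 0 :=
      (minpoly.dvd_iff).1 h6
    rw [h7, map_sum] at h9
    have h10 := congrArg (fun f : Module.End F L => ((f ⟨θ, hθL⟩ : L) : B)) h9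
    simp only [LinearMap.sum_apply, map_pow, aeval_X, AddSubmonoidClass.coe_finsetSum]
      at h10
    have h11 : ∑ j ∈ Finset.range (p ^ e), ((T ^ j) ⟨θ, hθL⟩ : B) = 1 := by
      rw [← hθ]
      exact Finset.sum_congr rfl fun j _ => h.coe_restrict_pow j _
    rw [h11] at h10
    exact one_ne_zero h10
  rw [← h5, ← h4, ← LinearMap.charpoly_natDegree (R := F) (M := L) T]
  exact natDegree_le_of_dvd (LinearMap.minpoly_dvd_charpoly T) (LinearMap.charpoly_monic T).ne_zero

/-- The upper bound comes from the independence of the powers of z over L, which gives p^e · dim L ≤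
dim B. -/
theorem IsCyclicTower.finrank_eq [Fact p.Prime] [CharP F p] [Nontrivial B] [FiniteDimensional F B]
    (h : IsCyclicTower p e σ L) (hσ : ∀ b, z * b = σ b * z) (hz : IsUnit z)
    (hB : Module.finrank F B = (p ^ e) ^ 2) : Module.finrank F L = p ^ e := by
  refine le_antisymm ?_ h.le_finrank
  have h1 := LinearMap.finrank_le_finrank_of_injective (h.sumMulPow_injective hσ hz)
  rw [Module.finrank_pi_fintype, Finset.sum_const, Finset.card_univ, Fintype.card_fin,
    smul_eq_mul, hB, sq] at h1
  exact Nat.le_of_mul_le_mul_left h1 (pow_pos (Fact.out : p.Prime).pos e)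

theorem IsCyclicTower.sumMulPow_bijective [Fact p.Prime] [CharP F p] [Nontrivial B]
    [FiniteDimensional F B]
    (h : IsCyclicTower p e σ L) (hσ : ∀ b, z * b = σ b * z) (hz : IsUnit z)
    (hB : Module.finrank F B = (p ^ e) ^ 2) : Function.Bijective (sumMulPow L z (p ^ e)) := by
  have h1 := h.sumMulPow_injective hσ hz
  refine ⟨h1, (LinearMap.injective_iff_surjective_of_finrank_eq_finrank ?_).1 h1⟩
  rw [Module.finrank_pi_fintype, Finset.sum_const, Finset.card_univ, Fintype.card_fin,
    smul_eq_mul, hB, sq, h.finrank_eq hσ hz hB]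

/-- Such an element commutes with L and with z, which together span B, so it is central. -/
theorem IsCyclicTower.mem_range_of_apply_eq [Fact p.Prime] [CharP F p] [Nontrivial B]
    [FiniteDimensional F B] [Algebra.IsCentral F B]
    (h : IsCyclicTower p e σ L) (hσ : ∀ b, z * b = σ b * z) (hz : IsUnit z)
    (hB : Module.finrank F B = (p ^ e) ^ 2) {y : B} (hy : y ∈ L) (hσy : σ y = y) :
    y ∈ (algebraMap F B).range := by
  have h1 : y ∈ Subalgebra.center F B := by
    refine Subalgebra.mem_center_iff.2 fun b => ?_
    obtain ⟨x, rfl⟩ := (h.sumMulPow_bijective hσ hz hB).2 b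
    have hyz : Commute z y := by
      change z * y = y * z
      rw [hσ, hσy]
    rw [sumMulPow_apply, Finset.sum_mul, Finset.mul_sum]
    refine Finset.sum_congr rfl fun i _ => ?_
    rw [mul_assoc, (hyz.pow_left _).eq, ← mul_assoc, h.comm _ (x i).2 _ hy, mul_assoc]
  rw [Algebra.IsCentral.center_eq_bot] at h1
  exact Algebra.mem_bot.1 h1

end CyclicTowerTop

/-! ### The top of the tower is a cyclic Galois algebra -/

section Etale

/-- The universal derivation kills p-th powers, hence everything they generate, so the Kähler
differentials vanish. -/
theorem formallyUnramified_of_adjoin_pow_eq_top (F : Type u) (L : Type w) [Field F] [CommRing L]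
    [Algebra F L] (p : ℕ) [CharP F p]
    (h : Algebra.adjoin F (Set.range fun x : L => x ^ p) = ⊤) : Algebra.FormallyUnramified F L := by
  refine ⟨?_⟩
  have h1 : KaehlerDifferential.D F L = 0 := by
    refine Derivation.ext fun x => ?_
    have hx : x ∈ Algebra.adjoin F (Set.range fun x : L => x ^ p) := h ▸ Algebra.mem_top
    refine Derivation.eqOn_adjoin (D1 := KaehlerDifferential.D F L) (D2 := 0) ?_ hx
    rintro _ ⟨y, rfl⟩
    simp only [Derivation.leibniz_pow, Derivation.zero_apply]
    have h2 : (p : L) = 0 := by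
      rw [← map_natCast (algebraMap F L), CharP.cast_eq_zero, map_zero]
    rw [← Nat.cast_smul_eq_nsmul L, h2, zero_smul, smul_zero, smul_zero]
  have h2 : (⊤ : Submodule L (Ω[L⁄F])) = ⊥ := by
    rw [← KaehlerDifferential.span_range_derivation, h1, Submodule.span_eq_bot]
    rintro _ ⟨x, rfl⟩
    rfl
  exact (Submodule.subsingleton_iff L).1 (subsingleton_of_bot_eq_top h2.symm)

theorem IsCyclicTower.exists_isCyclicAlg {F : Type u} {B : Type w} [Field F] [Ring B] [Algebra F B]
    {p e : ℕ} {σ : B ≃ₐ[F] B} {L : Subalgebra F B} {z : B} [Fact p.Prime] [CharP F p] [Nontrivial B]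
    [FiniteDimensional F B] [Algebra.IsCentral F B] (h : IsCyclicTower p e σ L)
    (hσ : ∀ b, z * b = σ b * z) (hz : IsUnit z) (hB : Module.finrank F B = (p ^ e) ^ 2)
    {c : Fˣ} (hc : z ^ p ^ e = algebraMap F B c) :
    ∃ (L : Type w) (_ : CommRing L) (_ : Algebra F L) (σ : L ≃ₐ[F] L),
      IsCyclicGaloisAlg F L σ (p ^ e) ∧ IsCyclicAlg F L B σ c (p ^ e) := by
  let _ : CommRing L := { (inferInstance : Ring L) with
    mul_comm := fun x y => Subtype.ext (h.comm _ x.2 _ y.2) }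
  let f : L →ₐ[F] L := ((σ : B →ₐ[F] B).comp L.val).codRestrict L fun x => h.map_mem _ x.2
  have hf : ∀ n (x : L), ((f ^ n) x : B) = (σ ^ n) (x : B) := by
    intro n x
    induction n with
    | zero => rfl
    | succ n ih =>
      rw [pow_succ', AlgHom.mul_apply, ← alg_pow_succ_apply, ← ih]
      rfl
  have hf1 : f ^ p ^ e = 1 := by
    refine AlgHom.ext fun x => Subtype.ext ?_
    rw [hf, h.pow_apply _ x.2]
    rfl
  have hpos : 0 < p ^ e := pow_pos (Fact.out : p.Prime).pos e
  -- σ is given on B, and only σ(L) ⊆ L is known; the inverse on L is the power p^e - 1.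
  let τ : L ≃ₐ[F] L := AlgEquiv.ofAlgHom f (f ^ (p ^ e - 1))
    (by
      change f * f ^ (p ^ e - 1) = 1
      rw [← pow_succ', Nat.sub_add_cancel hpos, hf1])
    (by
      change f ^ (p ^ e - 1) * f = 1
      rw [← pow_succ, Nat.sub_add_cancel hpos, hf1])
  have hτ : ∀ n (x : L), ((τ ^ n) x : B) = (σ ^ n) (x : B) := by
    intro n x
    induction n with
    | zero => rfl
    | succ n ih =>
      rw [pow_succ', AlgEquiv.mul_apply, ← alg_pow_succ_apply, ← ih]
      rfl
  have hur : Algebra.FormallyUnramified F L := by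
    refine formallyUnramified_of_adjoin_pow_eq_top F L p ?_
    rw [eq_top_iff]
    rintro x -
    have h1 : (Algebra.adjoin F (Set.range fun x : L => x ^ p)).map L.val =
        Algebra.adjoin F ((fun x => x ^ p) '' (L : Set B)) := by
      rw [AlgHom.map_adjoin]
      congr 1
      ext y
      constructor
      · rintro ⟨_, ⟨x, rfl⟩, rfl⟩
        exact ⟨x, x.2, rfl⟩
      · rintro ⟨x, hx, rfl⟩
        exact ⟨_, ⟨⟨x, hx⟩, rfl⟩, rfl⟩
    have h2 := h.le_adjoin x.2
    rw [← h1] at h2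
    obtain ⟨x', hx', hxx⟩ := h2
    rwa [← Subtype.ext (a1 := x') (a2 := x) hxx]
  have hfin : Module.Finite F L := inferInstanceAs (Module.Finite F (Subalgebra.toSubmodule L))
  refine ⟨L, inferInstance, inferInstance, τ, ⟨?_, h.finrank_eq hσ hz hB, ?_, ?_⟩, L.val, z, ?_, hc, ?_⟩
  · exact ⟨Algebra.FormallyEtale.of_formallyUnramified_of_field F L,
      (Algebra.FinitePresentation.of_finiteType).1 inferInstance⟩
  · refine AlgEquiv.ext fun x => Subtype.ext ?_
    rw [hτ, h.pow_apply _ x.2]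
    rfl
  · intro x hx
    obtain ⟨r, hr⟩ := h.mem_range_of_apply_eq hσ hz hB x.2 (congrArg Subtype.val hx)
    exact ⟨r, Subtype.ext hr⟩
  · intro x
    exact hσ x
  · have h1 := h.sumMulPow_bijective hσ hz hB
    convert h1 using 1
    funext x
    rw [sumMulPow_apply]
    rfl

end Etale

/-! ### Modules over finite-dimensional simple algebras -/

section Representations

variable {F : Type u} {A : Type v} [Field F] [Ring A] [Algebra F A] [IsSimpleRing A]
  [FiniteDimensional F A] {V W : Type w} [AddCommGroup V] [Module F V] [AddCommGroup W] [Module F W]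

/-- Representations of equal dimension of a finite-dimensional simple algebra are isomorphic. -/
theorem exists_intertwining_equiv [FiniteDimensional F V] [FiniteDimensional F W]
    (hVW : Module.finrank F V = Module.finrank F W)
    (ρ : A →ₐ[F] Module.End F V) (ρ' : A →ₐ[F] Module.End F W) :
    ∃ θ : V ≃ₗ[F] W, ∀ a v, θ (ρ a v) = ρ' a (θ v) := by
  have : IsArtinianRing A := IsArtinianRing.of_finite F A
  rcases subsingleton_or_nontrivial V with hV | hV
  · have hW : Subsingleton W := by
      rw [← Module.finrank_zero_iff (R := F), ← hVW, Module.finrank_zero_iff]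
      exact hV
    exact ⟨0, fun _ _ => Subsingleton.elim _ _⟩
  let _ : Module A V := Module.compHom V ρ.toRingHom
  let _ : Module A W := Module.compHom W ρ'.toRingHom
  have hsV : ∀ (a : A) (v : V), a • v = ρ a v := fun _ _ => rfl
  have hsW : ∀ (a : A) (v : W), a • v = ρ' a v := fun _ _ => rfl
  have : IsScalarTower F A V := ⟨fun r a v => by rw [hsV, hsV, map_smul]; rfl⟩
  have : IsScalarTower F A W := ⟨fun r a v => by rw [hsW, hsW, map_smul]; rfl⟩
  have : Module.Finite A V := Module.Finite.of_restrictScalars_finite F A V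
  have : Module.Finite A W := Module.Finite.of_restrictScalars_finite F A W
  -- Inside V × W both modules are powers of one simple module; equal dimension gives equal
  -- exponents.
  have hiso : IsIsotypic A (V × W) := IsSimpleRing.isIsotypic A (V × W)
  obtain ⟨S, hS⟩ := IsSemisimpleModule.exists_simple_submodule A (V × W)
  have hS' := hiso S
  obtain ⟨n, ⟨f⟩⟩ := (hS'.of_injective (LinearMap.inl A V W) LinearMap.inl_injective).linearEquiv_fun
  obtain ⟨k, ⟨g⟩⟩ := (hS'.of_injective (LinearMap.inr A V W) LinearMap.inr_injective).linearEquiv_fun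
  have : Nontrivial S := IsSimpleModule.nontrivial A S
  have : FiniteDimensional F S :=
    Module.Finite.of_injective (S.subtype.restrictScalars F) S.injective_subtype
  have h1 := (f.restrictScalars F).finrank_eq
  have h2 := (g.restrictScalars F).finrank_eq
  rw [Module.finrank_pi_fintype, Finset.sum_const, Finset.card_univ, Fintype.card_fin,
    smul_eq_mul] at h1 h2
  have h3 : 0 < Module.finrank F S := Module.finrank_pos
  obtain rfl : n = k := by
    rw [h1, h2] at hVW
    exact Nat.eq_of_mul_eq_mul_right h3 hVW
  exact ⟨(f.trans g.symm).restrictScalars F, fun a v => (f.trans g.symm).map_smul a v⟩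

/-- Equivariant surjections of representations of a finite-dimensional simple algebra split. -/
theorem exists_intertwining_section (ρ : A →ₐ[F] Module.End F V) (ρ' : A →ₐ[F] Module.End F W)
    (q : V →ₗ[F] W) (hq : Function.Surjective q) (hqρ : ∀ a v, q (ρ a v) = ρ' a (q v)) :
    ∃ s : W →ₗ[F] V, (∀ a v, s (ρ' a v) = ρ a (s v)) ∧ ∀ v, q (s v) = v := by
  have : IsArtinianRing A := IsArtinianRing.of_finite F A
  let _ : Module A V := Module.compHom V ρ.toRingHom
  let _ : Module A W := Module.compHom W ρ'.toRingHom
  have hsV : ∀ (a : A) (v : V), a • v = ρ a v := fun _ _ => rfl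
  have hsW : ∀ (a : A) (v : W), a • v = ρ' a v := fun _ _ => rfl
  have : IsScalarTower F A V := ⟨fun r a v => by rw [hsV, hsV, map_smul]; rfl⟩
  have : IsScalarTower F A W := ⟨fun r a v => by rw [hsW, hsW, map_smul]; rfl⟩
  have : Module.Projective A W := Module.projective_of_isSemisimpleRing A W
  obtain ⟨s, hs⟩ := Module.projective_lifting_property
    ({ q with map_smul' := hqρ } : V →ₗ[A] W) LinearMap.id hq
  exact ⟨s.restrictScalars F, fun a v => s.map_smul a v, fun v => LinearMap.congr_fun hs v⟩

end Representations

/-! ### Splitting fields: embeddings, Skolem–Noether, inner derivations -/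

section SplittingField

variable {F : Type u} {E : Type v} {B : Type w} [Field F] [Field E] [Algebra F E] [Ring B]
  [Algebra F B]

theorem SplitBy.isSimpleRing (h : SplitBy F E B) : IsSimpleRing (E ⊗[F] B) := by
  obtain ⟨n, hn, ⟨f⟩⟩ := h
  have : NeZero n := ⟨hn⟩
  have : IsSimpleRing (Matrix (Fin n) (Fin n) E) := inferInstance
  exact IsSimpleRing.of_ringEquiv f.symm.toRingEquiv this

theorem SplitBy.exists_algEquiv [FiniteDimensional F B] (h : SplitBy F E B) {m : ℕ}
    (hB : Module.finrank F B = m ^ 2) :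
    Nonempty (E ⊗[F] B ≃ₐ[E] Matrix (Fin m) (Fin m) E) := by
  obtain ⟨n, -, ⟨f⟩⟩ := h
  have h1 := f.toLinearEquiv.finrank_eq
  rw [Module.finrank_baseChange, hB, Module.finrank_matrix, Module.finrank_self, mul_one,
    Fintype.card_fin, ← sq] at h1
  obtain rfl : m = n := Nat.pow_left_injective two_ne_zero h1
  exact ⟨f⟩

/-- The split form makes B act E-linearly on E^m, which has the dimension of B over F and is
therefore the regular representation. The scalars from E become left B-linear maps of B, that is,
right multiplications; commutativity of E makes this an embedding of E in B. -/
theorem SplitBy.exists_algHom [IsSimpleRing B] [FiniteDimensional F B] [FiniteDimensional F E]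
    (h : SplitBy F E B) (hB : Module.finrank F B = Module.finrank F E ^ 2) :
    Nonempty (E →ₐ[F] B) := by
  obtain ⟨f⟩ := h.exists_algEquiv hB
  set m := Module.finrank F E with hm
  let ρ₀ : B →ₐ[F] Module.End E (Fin m → E) :=
    ((Matrix.toLinAlgEquiv' : Matrix (Fin m) (Fin m) E ≃ₐ[E] _).toAlgHom.restrictScalars F).comp
      ((f.toAlgHom.restrictScalars F).comp Algebra.TensorProduct.includeRight)
  let ρ : B →ₐ[F] Module.End F (Fin m → E) := (Algebra.lsmul F F (Fin m → E)).comp ρ₀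
  have hρ : ∀ b (x : E) v, ρ b (x • v) = x • ρ b v := fun b x v => (ρ₀ b).map_smul x v
  -- both representations are moved to a common universe
  obtain ⟨θ, hθ⟩ := exists_intertwining_equiv (F := F) (A := B)
    (V := ULift.{w} (Fin m → E)) (W := ULift.{v} B) (by
      rw [ULift.moduleEquiv.finrank_eq, ULift.moduleEquiv.finrank_eq, Module.finrank_pi_fintype, Finset.sum_const,
        Finset.card_univ, Fintype.card_fin, smul_eq_mul, hB, ← hm, sq])
    ((ULift.moduleEquiv.symm.conjAlgEquiv F).toAlgHom.comp ρ)
    ((ULift.moduleEquiv.symm.conjAlgEquiv F).toAlgHom.comp (Algebra.lmul F B))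
  let η : (Fin m → E) ≃ₗ[F] B := ULift.moduleEquiv.symm.trans (θ.trans ULift.moduleEquiv)
  have hη : ∀ b v, η (ρ b v) = b * η v := fun b v =>
    congrArg ULift.down (hθ b (ULift.up v))
  have hη' : ∀ b w, η.symm (b * w) = ρ b (η.symm w) := fun b w => by
    rw [LinearEquiv.symm_apply_eq, hη, LinearEquiv.apply_symm_apply]
  have key : ∀ (x : E) (b : B), η (x • η.symm b) = b * η (x • η.symm 1) := by
    intro x b
    rw [← hη, hρ, ← hη', mul_one]
  refine ⟨AlgHom.ofLinearMap
    { toFun := fun x => η (x • η.symm 1)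
      map_add' := fun x y => by rw [add_smul, map_add]
      map_smul' := fun r x => by rw [smul_assoc, map_smul, RingHom.id_apply] } ?_ ?_⟩
  · change η ((1 : E) • η.symm 1) = 1
    rw [one_smul, LinearEquiv.apply_symm_apply]
  · intro x y
    change η ((x * y) • η.symm 1) = η (x • η.symm 1) * η (y • η.symm 1)
    rw [← key, LinearEquiv.symm_apply_apply, smul_smul, mul_comm]

/-- The right multiplications by elements of a commutative subalgebra. -/
def rightMul {R : Type*} [CommRing R] [Algebra F R] (ι : R →ₐ[F] B) : R →ₐ[F] Module.End F B :=
  AlgHom.ofLinearMap ((LinearMap.mul F B).flip ∘ₗ ι.toLinearMap)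
    (by ext; simp) (fun x y => by ext b; simp [mul_comm x y, mul_assoc])

/-- The theorem of Skolem and Noether for a splitting subfield. -/
theorem SplitBy.exists_conj [FiniteDimensional F B] [FiniteDimensional F E]
    (h : SplitBy F E B) (ι ι' : E →ₐ[F] B) : ∃ z : B, IsUnit z ∧ ∀ x, ι x * z = z * ι' x := by
  have := h.isSimpleRing
  have hc : ∀ (ι : E →ₐ[F] B) (x : E) (b : B), Commute (rightMul ι x) (Algebra.lmul F B b) := by
    intro ι x b
    ext c
    exact mul_assoc b c (ι x)
  -- Right multiplication through ι or ι' makes B a module over the simple algebra E ⊗ B in two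
  -- ways, which are isomorphic. The isomorphism is left B-linear, hence right multiplication by the
  -- unit θ(1), which conjugates ι to ι'.
  obtain ⟨θ, hθ⟩ := exists_intertwining_equiv (F := F) (A := E ⊗[F] B) (V := B) (W := B) rfl
    (Algebra.TensorProduct.lift (rightMul ι) (Algebra.lmul F B) (hc ι))
    (Algebra.TensorProduct.lift (rightMul ι') (Algebra.lmul F B) (hc ι'))
  have h1 : ∀ b c, θ (b * c) = b * θ c := by
    intro b c
    have := hθ (1 ⊗ₜ b) c
    rw [Algebra.TensorProduct.lift_tmul, Algebra.TensorProduct.lift_tmul, map_one, map_one] at this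
    exact this
  have h2 : ∀ x c, θ (c * ι x) = θ c * ι' x := by
    intro x c
    have := hθ (x ⊗ₜ 1) c
    rw [Algebra.TensorProduct.lift_tmul, Algebra.TensorProduct.lift_tmul, map_one, mul_one,
      mul_one] at this
    exact this
  have h3 : ∀ b, θ b = b * θ 1 := fun b => by rw [← h1, mul_one]
  obtain ⟨v, hv⟩ := θ.surjective 1
  have h4 : v * θ 1 = 1 := by rw [← h3, hv]
  have h5 : θ 1 * v = 1 := θ.injective (by rw [h1, hv, mul_one])
  refine ⟨θ 1, ⟨⟨θ 1, v, h5, h4⟩, rfl⟩, fun x => ?_⟩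
  rw [← h3, ← h2, one_mul]

/-- A derivation of a splitting subfield extends to an inner derivation. -/
theorem SplitBy.exists_ad [FiniteDimensional F B] [FiniteDimensional F E]
    (h : SplitBy F E B) (ι : E →ₐ[F] B) (δ : Derivation F E E) :
    ∃ τ : B, ∀ a, τ * ι a = ι a * τ + ι (δ a) := by
  have := h.isSimpleRing
  -- δ defines an extension of the E ⊗ B-module B by itself: on B × B, x acts by right
  -- multiplication with a unipotent twist by δ(x). The algebra is simple, so the extension splits;
  -- a section has the form b ↦ (bs, b), and -s induces δ.
  let R (x : E) : Module.End F (B × B) :=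
    LinearMap.prod (rightMul ι x ∘ₗ LinearMap.fst F B B + rightMul ι (δ x) ∘ₗ LinearMap.snd F B B)
      (rightMul ι x ∘ₗ LinearMap.snd F B B)
  have hR : ∀ x w, R x w = (w.1 * ι x + w.2 * ι (δ x), w.2 * ι x) := fun _ _ => rfl
  let f : E →ₐ[F] Module.End F (B × B) := AlgHom.ofLinearMap
    { toFun := R
      map_add' := fun x y => LinearMap.ext fun w => by
        rw [LinearMap.add_apply, hR, hR, hR, Prod.mk_add_mk]
        simp only [map_add, mul_add]
        congr 1
        abel
      map_smul' := fun r x => LinearMap.ext fun w => by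
        rw [RingHom.id_apply, LinearMap.smul_apply, hR, hR]
        simp [Prod.smul_mk, map_smul] }
    (LinearMap.ext fun w => by
      change R 1 w = w
      rw [hR]
      simp)
    (fun x y => LinearMap.ext fun w => by
      change R (x * y) w = R x (R y w)
      rw [hR, hR, hR]
      simp only [Derivation.leibniz, smul_eq_mul, map_add, map_mul, Prod.mk.injEq]
      have hxy : ∀ a b : E, ι a * ι b = ι b * ι a := fun a b => by
        rw [← map_mul, mul_comm, map_mul]
      constructor
      · rw [add_mul, mul_add, mul_assoc, mul_assoc, mul_assoc, hxy x y, hxy x (δ y)]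
        abel
      · rw [mul_assoc, hxy x y])
  let g : B →ₐ[F] Module.End F (B × B) := AlgHom.ofLinearMap
    { toFun := fun b => LinearMap.prodMap (LinearMap.mulLeft F b) (LinearMap.mulLeft F b)
      map_add' := fun x y => LinearMap.ext fun w => by simp [add_mul]
      map_smul' := fun r x => LinearMap.ext fun w => by simp }
    (LinearMap.ext fun w => by simp) (fun x y => LinearMap.ext fun w => by simp)
  have hg : ∀ b w, g b w = (b * w.1, b * w.2) := fun _ _ => rfl
  have hf : ∀ x w, f x w = (w.1 * ι x + w.2 * ι (δ x), w.2 * ι x) := fun _ _ => rfl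
  have hc : ∀ x b, Commute (f x) (g b) := by
    intro x b
    refine LinearMap.ext fun w => ?_
    change f x (g b w) = g b (f x w)
    rw [hf, hg, hf, hg]
    simp only [mul_add, mul_assoc]
  have hc' : ∀ (x : E) (b : B), Commute (rightMul ι x) (Algebra.lmul F B b) := by
    intro x b
    ext c
    exact mul_assoc b c (ι x)
  have hl : ∀ x b w, Algebra.TensorProduct.lift f g hc (x ⊗ₜ b) w = f x (g b w) := by
    intro x b w
    rw [Algebra.TensorProduct.lift_tmul]; rfl
  have hl' : ∀ x b c, Algebra.TensorProduct.lift (rightMul ι) (Algebra.lmul F B) hc' (x ⊗ₜ b) c =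
      b * c * ι x := by
    intro x b w
    rw [Algebra.TensorProduct.lift_tmul]; rfl
  obtain ⟨s, hs, hs2⟩ := exists_intertwining_section (F := F) (A := E ⊗[F] B)
    (Algebra.TensorProduct.lift f g hc)
    (Algebra.TensorProduct.lift (rightMul ι) (Algebra.lmul F B) hc') (LinearMap.snd F B B)
    LinearMap.snd_surjective (by
      intro a w
      induction a using TensorProduct.induction_on with
      | zero => simp
      | tmul x b => rw [hl, hl', hf, hg]; rfl
      | add a a' ha ha' =>
        rw [map_add, map_add, LinearMap.add_apply, LinearMap.add_apply, map_add, ha, ha'])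
  have h1 : ∀ b, s b = (b * (s 1).1, b) := by
    intro b
    have h2 := hs (1 ⊗ₜ b) 1
    rw [hl, hl', map_one, map_one, mul_one, mul_one, Module.End.one_apply, hg] at h2
    rw [h2]
    have h3 : (s 1).2 = 1 := hs2 1
    rw [h3, mul_one]
  refine ⟨-(s 1).1, fun x => ?_⟩
  have h2 := hs (x ⊗ₜ 1) 1
  rw [hl, hl', map_one, Module.End.one_apply, hf, one_mul, one_mul, h1] at h2
  have h3 := congrArg Prod.fst h2
  have h4 : (s 1).2 = 1 := hs2 1
  simp only [h4, one_mul] at h3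
  rw [mul_neg, h3, neg_mul]
  abel

/-- A nonzero subspace of `Bⁿ` stable under the two-sided action of a simple algebra `B` contains
a nonzero vector with central entries. -/
theorem exists_central_vector_mem [IsSimpleRing B] {ι : Type*} [Fintype ι]
    (N : AddSubgroup (ι → B)) (hl : ∀ b, ∀ v ∈ N, (fun i => b * v i) ∈ N)
    (hr : ∀ b, ∀ v ∈ N, (fun i => v i * b) ∈ N) (hN : ∃ v ∈ N, v ≠ 0) :
    ∃ v ∈ N, v ≠ 0 ∧ ∀ i b, b * v i = v i * b := by
  classical
  obtain ⟨v, hv, hmin⟩ := exists_minimalFor_of_wellFoundedLT (fun v : ι → B => v ∈ N ∧ v ≠ 0)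
    (fun v => (Finset.univ.filter fun i => v i ≠ 0).card) hN
  obtain ⟨hvN, hv0⟩ := hv
  obtain ⟨i, hi⟩ := Function.ne_iff.1 hv0
  -- every element of the two-sided ideal of `v i` is the `i`-th entry of a vector with no new entry
  let I : TwoSidedIdeal B := TwoSidedIdeal.mk'
    {b | ∃ w ∈ N, (∀ j, v j = 0 → w j = 0) ∧ w i = b}
    ⟨0, N.zero_mem, fun _ _ => rfl, rfl⟩
    (by
      rintro _ _ ⟨w, hw, hw0, rfl⟩ ⟨w', hw', hw0', rfl⟩
      exact ⟨w + w', N.add_mem hw hw', fun j hj => by simp [hw0 j hj, hw0' j hj], rfl⟩)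
    (by
      rintro _ ⟨w, hw, hw0, rfl⟩
      exact ⟨-w, N.neg_mem hw, fun j hj => by simp [hw0 j hj], rfl⟩)
    (by
      rintro b _ ⟨w, hw, hw0, rfl⟩
      exact ⟨_, hl b w hw, fun j hj => by simp [hw0 j hj], rfl⟩)
    (by
      rintro _ b ⟨w, hw, hw0, rfl⟩
      exact ⟨_, hr b w hw, fun j hj => by simp [hw0 j hj], rfl⟩)
  have hI : ∀ b, b ∈ I ↔ ∃ w ∈ N, (∀ j, v j = 0 → w j = 0) ∧ w i = b := fun b =>
    TwoSidedIdeal.mem_mk' _ _ _ _ _ _ _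
  have hItop : I = ⊤ := by
    refine (eq_bot_or_eq_top I).resolve_left fun h => hi ?_
    have : v i ∈ I := (hI _).2 ⟨v, hvN, fun _ h => h, rfl⟩
    rwa [h, TwoSidedIdeal.mem_bot] at this
  obtain ⟨w, hwN, hw0, hwi⟩ := (hI 1).1 (hItop ▸ TwoSidedIdeal.mem_top B)
  have hw : w ≠ 0 := fun h => by
    rw [h] at hwi
    exact zero_ne_one hwi
  refine ⟨w, hwN, hw, fun j b => ?_⟩
  -- The i-th entry of w is 1, so this commutator has entry 0 there and smaller support than v; by
  -- minimality it vanishes.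
  have hd : (fun k => b * w k) - (fun k => w k * b) ∈ N := N.sub_mem (hl b w hwN) (hr b w hwN)
  by_contra hj
  have hd0 : (fun k => b * w k) - (fun k => w k * b) ≠ 0 := fun h => hj (by
    have := congrFun h j
    exact sub_eq_zero.1 this)
  have h1 := hmin (j := (fun k => b * w k) - (fun k => w k * b)) ⟨hd, hd0⟩
  refine absurd (h1 (Finset.card_le_card ?_)) (not_le.2 (Finset.card_lt_card ?_))
  · intro k hk
    simp only [Finset.mem_filter, Finset.mem_univ, true_and, Pi.sub_apply] at hk ⊢
    intro hk0
    exact hk (by rw [hw0 k hk0]; simp)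
  · refine Finset.ssubset_iff_subset_ne.2 ⟨?_, fun h => ?_⟩
    · intro k hk
      simp only [Finset.mem_filter, Finset.mem_univ, true_and, Pi.sub_apply] at hk ⊢
      intro hk0
      exact hk (by rw [hw0 k hk0]; simp)
    · have : i ∈ Finset.univ.filter fun k => v k ≠ 0 := by simpa using hi
      rw [← h] at this
      simp [hwi] at this

/-- A representation of dimension `m` over `E` of a central simple algebra of dimension `m²` shows
that `E` splits it. -/
theorem splitBy_of_algHom [IsSimpleRing B] [Algebra.IsCentral F B] [FiniteDimensional F B]
    [FiniteDimensional F E] {m : ℕ} (hm : m ≠ 0) (hB : Module.finrank F B = m ^ 2)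
    (ρ : B →ₐ[F] Matrix (Fin m) (Fin m) E) : SplitBy F E B := by
  have hc : ∀ (x : E) (b : B), Commute (algebraMap E (Matrix (Fin m) (Fin m) E) x) (ρ b) :=
    fun x b => Algebra.commutes x _
  let f : E ⊗[F] B →ₐ[E] Matrix (Fin m) (Fin m) E :=
    Algebra.TensorProduct.lift (Algebra.ofId E _) ρ hc
  have hf : ∀ x b, f (x ⊗ₜ b) = algebraMap E _ x * ρ b := fun x b =>
    Algebra.TensorProduct.lift_tmul _ _ _ _ _
  have : NeZero m := ⟨hm⟩
  have hinj : Function.Injective f := by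
    refine (injective_iff_map_eq_zero f).2 fun t ht => ?_
    let β := Module.finBasis F E
    obtain ⟨y, rfl⟩ : ∃ y : Fin (Module.finrank F E) → B, t = ∑ i, β i ⊗ₜ[F] y i := by
      refine TensorProduct.induction_on t ⟨0, by simp⟩ (fun x b => ?_) ?_
      · refine ⟨fun i => β.repr x i • b, ?_⟩
        simp only [TensorProduct.tmul_smul, TensorProduct.smul_tmul']
        rw [← TensorProduct.sum_tmul, β.sum_repr]
      · rintro _ _ ⟨y, rfl⟩ ⟨y', rfl⟩
        exact ⟨y + y', by simp [TensorProduct.tmul_add, Finset.sum_add_distrib]⟩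
    rw [map_sum] at ht
    simp only [hf] at ht
    by_contra ht0
    -- In coordinates over a basis of E, the kernel is a sub-bimodule of a power of B. If it is
    -- nonzero it has a nonzero vector over F, which is a linear relation among the basis elements
    -- of E.
    let N : AddSubgroup (Fin (Module.finrank F E) → B) :=
      { carrier := {v | ∑ i, algebraMap E (Matrix (Fin m) (Fin m) E) (β i) * ρ (v i) = 0}
        zero_mem' := by simp
        add_mem' := fun {v w} hv hw => by
          simp only [Set.mem_ofPred_eq] at hv hw ⊢
          simp [mul_add, Finset.sum_add_distrib, hv, hw]
        neg_mem' := fun {v} hv => by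
          simp only [Set.mem_ofPred_eq] at hv ⊢
          simp [hv] }
    have hN : ∀ v, v ∈ N ↔ ∑ i, algebraMap E (Matrix (Fin m) (Fin m) E) (β i) * ρ (v i) = 0 :=
      fun _ => Iff.rfl
    obtain ⟨v, hv, hv0, hvc⟩ := exists_central_vector_mem (B := B) N
      (fun b v hv => by
        rw [hN] at hv ⊢
        have := congrArg (ρ b * ·) hv
        simp only [mul_zero, Finset.mul_sum, ← mul_assoc, ← (hc _ b).eq] at this
        simpa only [map_mul, ← mul_assoc] using this)
      (fun b v hv => by
        rw [hN] at hv ⊢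
        have := congrArg (· * ρ b) hv
        simp only [zero_mul, Finset.sum_mul] at this
        simpa only [map_mul, ← mul_assoc] using this)
      ⟨y, ht, fun h => ht0 (by simp [h])⟩
    have h1 : ∀ i, ∃ r : F, algebraMap F B r = v i := fun i => by
      have : v i ∈ Subalgebra.center F B := Subalgebra.mem_center_iff.2 fun b => hvc i b
      rw [Algebra.IsCentral.center_eq_bot] at this
      exact Algebra.mem_bot.1 this
    choose r hr using h1
    rw [hN] at hv
    simp only [← hr, AlgHom.commutes, IsScalarTower.algebraMap_apply F E (Matrix (Fin m) (Fin m) E),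
      ← map_mul] at hv
    rw [← map_sum, map_eq_zero_iff _ (FaithfulSMul.algebraMap_injective E _)] at hv
    have h2 := Fintype.linearIndependent_iff.1 β.linearIndependent r (by
      simpa only [Algebra.smul_def, mul_comm] using hv)
    exact hv0 (funext fun i => by rw [← hr, h2 i, map_zero]; rfl)
  refine ⟨m, hm, ⟨AlgEquiv.ofBijective f ⟨hinj, ?_⟩⟩⟩
  refine (LinearMap.injective_iff_surjective_of_finrank_eq_finrank (f := f.toLinearMap) ?_).1 hinj
  rw [Module.finrank_baseChange, hB, Module.finrank_matrix, Module.finrank_self, mul_one,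
    Fintype.card_fin, ← sq]

end SplittingField

/-! ### A nilpotent derivation with constants F on a field of exponent at most one -/

section NilpotentDerivation

variable {F : Type u} {E : Type v} {M : Type w} [Field F] [Field E] [Field M] [Algebra F E]

/-- The derivation of `E[X]` which extends `δ` and sends `X` to `u`. -/
def Derivation.polyExtend (δ : Derivation F E E) (u : E) : Derivation F E[X] E[X] :=
  Derivation.mk' (DiffPoly.mapCoeff δ +
      (LinearMap.mulLeft F (C u)) ∘ₗ (derivative : E[X] →ₗ[E] E[X]).restrictScalars F) <| by
    intro P Q
    induction P using Polynomial.induction_on' with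
    | add P P' hP hP' =>
      rw [add_mul, map_add, hP, hP', map_add]
      simp only [smul_eq_mul]
      ring
    | monomial i a =>
      induction Q using Polynomial.induction_on' with
      | add Q Q' hQ hQ' =>
        rw [mul_add, map_add, hQ, hQ', map_add]
        simp only [smul_eq_mul]
        ring
      | monomial j b =>
        simp only [LinearMap.add_apply, LinearMap.comp_apply, LinearMap.mulLeft_apply,
          LinearMap.restrictScalars_apply, smul_eq_mul, mul_add]
        rw [add_add_add_comm]
        congr 1
        · simp only [monomial_mul_monomial, DiffPoly.mapCoeff_monomial, Derivation.leibniz,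
            smul_eq_mul, map_add]
          rw [add_comm j i]
        · rw [derivative_mul]
          ring

theorem Derivation.polyExtend_coeff (δ : Derivation F E E) (u : E) (P : E[X]) (i : ℕ) :
    (δ.polyExtend u P).coeff i = δ (P.coeff i) + u * (P.coeff (i + 1) * (i + 1)) := by
  have h1 : (DiffPoly.mapCoeff δ P).coeff i = δ (P.coeff i) := by
    induction P using Polynomial.induction_on' with
    | add P Q hP hQ => simp [hP, hQ]
    | monomial j a =>
      rw [DiffPoly.mapCoeff_monomial, coeff_monomial, coeff_monomial]
      split_ifs <;> simp
  change (DiffPoly.mapCoeff δ P + C u * derivative P).coeff i = _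
  rw [coeff_add, h1, coeff_C_mul, coeff_derivative]

theorem Derivation.polyExtend_C (δ : Derivation F E E) (u a : E) :
    δ.polyExtend u (C a) = C (δ a) := by
  ext i
  rw [polyExtend_coeff, coeff_C, coeff_C, coeff_C]
  split_ifs <;> simp_all

theorem Derivation.polyExtend_X (δ : Derivation F E E) (u : E) :
    δ.polyExtend u X = C u := by
  change DiffPoly.mapCoeff δ X + C u * derivative X = _
  rw [← monomial_one_one_eq_X, DiffPoly.mapCoeff_monomial]
  simp

variable [Algebra F M] [Algebra E M] [IsScalarTower F E M]

/-- A derivation with constants `F` and vanishing `p^n`-th power extends to an extension of degree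
`p` generated by a `p`-th root of an element of `F`. -/
theorem exists_nilpotent_derivation_step (p : ℕ) [Fact p.Prime] [CharP F p] {n : ℕ}
    [FiniteDimensional F E] (hn : Module.finrank F E = p ^ n) {δ : Derivation F E E}
    (hδ : HasConstants δ) (hδn : ∀ x, δ^[p ^ n] x = 0) {a : M} {α : F}
    (hmin : minpoly E a = X ^ p - C (algebraMap F E α))
    (hgen : ∀ y : M, ∃ P : E[X], P.natDegree < p ∧ y = aeval a P) :
    ∃ D : Derivation F M M, HasConstants D ∧ ∀ x, D^[p ^ (n + 1)] x = 0 := by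
  have hp : p.Prime := Fact.out
  have hpn : 0 < p ^ n := pow_pos hp.pos n
  have : CharP E p := charP_of_injective_algebraMap (algebraMap F E).injective p
  have : CharP M p := charP_of_injective_algebraMap (algebraMap F M).injective p
  -- u is to lie outside the image of δ. It suffices that δ^{p^n-1}(u) ≠ 0, as δ^{p^n} = 0; such u
  -- exists because the minimum polynomial of δ has degree p^n.
  obtain ⟨u, hu⟩ : ∃ u, δ^[p ^ n - 1] u ≠ 0 := by
    by_contra! h
    have h1 : derivMinpoly δ ∣ X ^ (p ^ n - 1) := by
      refine minpoly.dvd F _ ?_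
      rw [map_pow, aeval_X]
      ext x
      rw [coe_pow_apply, h x]
      rfl
    have h2 := natDegree_le_of_dvd h1 (pow_ne_zero _ X_ne_zero)
    rw [natDegree_derivMinpoly hδ, hn, natDegree_X_pow] at h2
    omega
  have hu' : ∀ v, δ v ≠ u := by
    rintro v rfl
    apply hu
    rw [← Function.iterate_succ_apply, Nat.succ_eq_add_one, Nat.sub_add_cancel hpn, hδn]
  let f : E[X] →ₐ[F] M := (aeval a).restrictScalars F
  have hfC : ∀ c, f (C c) = algebraMap E M c := fun c => aeval_C a c
  have hfX : f X = a := aeval_X a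
  have hf : Function.Surjective f := fun y => by
    obtain ⟨P, -, hP⟩ := hgen y
    exact ⟨P, hP.symm⟩
  have hf0 : ∀ P, f P = 0 → X ^ p - C (algebraMap F E α) ∣ P := fun P hP => by
    rw [← hmin]
    exact minpoly.dvd E a hP
  have hroot : f (X ^ p - C (algebraMap F E α)) = 0 := by
    rw [← hmin]
    exact minpoly.aeval E a
  -- Sending a to u is consistent with a^p = α: the derivative of X^p - α is zero.
  let D : Derivation F M M := Derivation.liftOfSurjective (f := f) hf (d := δ.polyExtend u) (by
    intro P hP
    obtain ⟨Q, rfl⟩ := hf0 P hP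
    have h1 : δ.polyExtend u (X ^ p - C (algebraMap F E α)) = 0 := by
      rw [map_sub, Derivation.leibniz_pow, Derivation.polyExtend_C, Derivation.map_algebraMap,
        nsmul_eq_mul, CharP.cast_eq_zero, zero_mul, C_0, sub_zero]
    rw [Derivation.leibniz, h1, smul_zero, add_zero, smul_eq_mul, map_mul, hroot, zero_mul])
  have hD : ∀ P, D (f P) = f (δ.polyExtend u P) := fun P =>
    Derivation.liftOfSurjective_apply hf _ P
  refine ⟨D, ?_, ?_⟩
  · intro y hy
    obtain ⟨P, hP, rfl⟩ := hgen y
    have h1 : δ.polyExtend u P = 0 := by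
      by_contra h0
      have h2 := natDegree_le_of_dvd (hf0 _ ((hD P).symm.trans hy)) h0
      rw [natDegree_X_pow_sub_C] at h2
      refine absurd h2 (not_le.2 (lt_of_le_of_lt (natDegree_le_iff_coeff_eq_zero.2 fun i hi => ?_) hP))
      rw [Derivation.polyExtend_coeff, coeff_eq_zero_of_natDegree_lt hi,
        coeff_eq_zero_of_natDegree_lt (hi.trans (Nat.lt_succ_self i))]
      simp
    have h2 : ∀ i, δ (P.coeff i) + u * (P.coeff (i + 1) * (i + 1)) = 0 := fun i => by
      rw [← Derivation.polyExtend_coeff, h1, coeff_zero]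
    obtain ⟨r, hr⟩ := hδ (P.coeff P.natDegree) (by
      have := h2 P.natDegree
      rwa [coeff_eq_zero_of_natDegree_lt (Nat.lt_succ_self _), zero_mul, mul_zero, add_zero] at this)
    rcases Nat.eq_zero_or_pos P.natDegree with h0 | hpos
    · rw [h0] at hr
      rw [eq_C_of_natDegree_eq_zero h0, aeval_C, ← hr, ← IsScalarTower.algebraMap_apply]
      exact ⟨r, rfl⟩
    -- The leading coefficient r of P lies in F. The next coefficient gives δ(P_i) = -(i+1)ru, where
    -- i + 1 = deg P < p is invertible, so u would be in the image of δ.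
    · exfalso
      obtain ⟨i, hi⟩ := Nat.exists_eq_succ_of_ne_zero hpos.ne'
      have h3 := h2 i
      have h4 : ((i : E) + 1) = algebraMap F E ((i + 1 : ℕ) : F) := by
        rw [map_natCast, Nat.cast_succ]
      rw [← Nat.succ_eq_add_one, ← hi, ← hr, h4, ← map_mul] at h3
      have h5 : r * ((i + 1 : ℕ) : F) ≠ 0 := by
        refine mul_ne_zero ?_ ?_
        · rintro rfl
          rw [map_zero, eq_comm, coeff_natDegree, leadingCoeff_eq_zero] at hr
          rw [hr, natDegree_zero] at hpos
          exact hpos.false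
        · rw [Ne, CharP.cast_eq_zero_iff F p]
          intro h
          have := Nat.le_of_dvd (Nat.succ_pos i) h
          omega
      refine hu' (-((r * ((i + 1 : ℕ) : F))⁻¹ • P.coeff i)) ?_
      rw [map_neg, Derivation.map_smul, eq_neg_of_add_eq_zero_left h3, smul_neg, neg_neg,
        mul_comm u, ← Algebra.smul_def, smul_smul, inv_mul_cancel₀ h5, one_smul]
  · have hDE : ∀ k (c : E), D^[k] (algebraMap E M c) = algebraMap E M (δ^[k] c) := by
      intro k c
      induction k generalizing c with
      | zero => rfl
      | succ k ih =>
        rw [Function.iterate_succ_apply, Function.iterate_succ_apply, ← ih, ← hfC, hD,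
          Derivation.polyExtend_C, hfC]
    have hDa : D a = algebraMap E M u := by
      rw [← hfX, hD, Derivation.polyExtend_X, hfC]
    have hle : p ^ n + p ^ n ≤ p ^ (n + 1) := by
      rw [pow_succ, ← mul_two]
      exact Nat.mul_le_mul_left _ hp.two_le
    have h1 : ∀ c : E, D^[p ^ (n + 1)] (algebraMap E M c) = 0 := by
      intro c
      obtain ⟨k, hk⟩ := Nat.exists_eq_add_of_le hle
      rw [hDE, hk, show p ^ n + p ^ n + k = p ^ n + (p ^ n + k) from add_assoc _ _ _,
        Function.iterate_add_apply, hδn, map_zero]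
    have h2 : D^[p ^ (n + 1)] a = 0 := by
      obtain ⟨k, hk⟩ := Nat.exists_eq_add_of_le hle
      have h3 : p ^ (n + 1) = (p ^ n + (p ^ n - 1 + k)) + 1 := by omega
      rw [h3, Function.iterate_succ_apply, hDa, hDE, Function.iterate_add_apply, hδn, map_zero]
    intro x
    obtain ⟨P, rfl⟩ := hf x
    -- D^{p^{n+1}} is itself a derivation, so its vanishing on E and on a is enough.
    rw [← Derivation.charPow_apply p D (n + 1)] at h2 ⊢
    induction P using Polynomial.induction_on' with
    | add P Q hP hQ => rw [map_add, map_add, hP, hQ, add_zero]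
    | monomial i c =>
      rw [← C_mul_X_pow_eq_monomial, map_mul, map_pow, hfC, hfX, Derivation.leibniz,
        Derivation.leibniz_pow, h2, smul_zero, smul_zero, smul_zero, zero_add,
        Derivation.charPow_apply, h1, smul_zero]

open IntermediateField in
/-- A finite purely inseparable extension of exponent at most one has a nilpotent derivation with
the smallest possible field of constants. -/
theorem exists_nilpotent_derivation (F : Type u) (K : Type v) [Field F] [Field K] [Algebra F K]
    (p : ℕ) [Fact p.Prime] [CharP F p] [FiniteDimensional F K]
    (hK : ∀ x : K, x ^ p ∈ (algebraMap F K).range) :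
    ∃ n, Module.finrank F K = p ^ n ∧
      ∃ δ : Derivation F K K, HasConstants δ ∧ ∀ x, δ^[p ^ n] x = 0 := by
  have hp : p.Prime := Fact.out
  -- Climb from F to K through intermediate fields; k is the difference of the degrees of K and E
  -- over F.
  suffices h : ∀ (k : ℕ) (E : IntermediateField F K), Module.finrank F K - Module.finrank F E = k →
      ∀ n, Module.finrank F E = p ^ n →
      (∃ δ : Derivation F E E, HasConstants δ ∧ ∀ x, δ^[p ^ n] x = 0) →
      ∃ n, Module.finrank F K = p ^ n ∧
        ∃ δ : Derivation F K K, HasConstants δ ∧ ∀ x, δ^[p ^ n] x = 0 by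
    refine h _ ⊥ rfl 0 (by rw [IntermediateField.finrank_bot, pow_zero]) ⟨0, fun a _ => ?_, fun x => ?_⟩
    · obtain ⟨r, hr⟩ := IntermediateField.mem_bot.1 a.2
      exact ⟨r, Subtype.ext hr⟩
    · rw [pow_zero, Function.iterate_one]; rfl
  intro k
  induction k using Nat.strong_induction_on with
  | _ k ih =>
    rintro E hk n hn ⟨δ, hδ, hδn⟩
    by_cases hE : E = ⊤
    · subst hE
      let ψ : (⊤ : IntermediateField F K) ≃ₐ[F] K := IntermediateField.topEquiv
      refine ⟨n, by rw [← hn, ψ.toLinearEquiv.finrank_eq], ?_⟩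
      let D : Derivation F K K := Derivation.mk'
        (ψ.toLinearMap ∘ₗ (δ : _ →ₗ[F] _) ∘ₗ ψ.symm.toLinearMap) (fun a b => by simp)
      have hD : ∀ x, D x = ψ (δ (ψ.symm x)) := fun _ => rfl
      have hDk : ∀ j x, D^[j] x = ψ (δ^[j] (ψ.symm x)) := by
        intro j x
        induction j with
        | zero => simp
        | succ j ih => rw [Function.iterate_succ_apply', ih, hD, Function.iterate_succ_apply',
            AlgEquiv.symm_apply_apply]
      refine ⟨D, fun a ha => ?_, fun x => by rw [hDk, hδn, map_zero]⟩
      rw [hD, map_eq_zero_iff _ ψ.injective] at ha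
      obtain ⟨r, hr⟩ := hδ _ ha
      exact ⟨r, by rw [← ψ.apply_symm_apply a, ← hr]; exact (ψ.commutes r).symm⟩
    · obtain ⟨a, haE⟩ : ∃ a, a ∉ E := by
        by_contra! h
        exact hE (eq_top_iff.2 fun x _ => h x)
      obtain ⟨α, hα⟩ := hK a
      have : CharP K p := charP_of_injective_algebraMap (algebraMap F K).injective p
      have hint : IsIntegral E a := Algebra.IsIntegral.isIntegral a
      have hirr : Irreducible (X ^ p - C (algebraMap F E α)) := by
        refine X_pow_sub_C_irreducible_of_prime hp fun b hb => haE ?_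
        have h1 : ((b : K) - a) ^ p = 0 := by
          rw [sub_pow_char, ← hα, sub_eq_zero]
          exact congrArg Subtype.val hb
        rw [← sub_eq_zero.1 (eq_zero_of_pow_eq_zero h1)]
        exact b.2
      have hmin : minpoly E a = X ^ p - C (algebraMap F E α) := by
        refine (minpoly.eq_of_irreducible_of_monic hirr ?_ (monic_X_pow_sub_C _ hp.ne_zero)).symm
        rw [map_sub, map_pow, aeval_X, aeval_C, ← hα, sub_eq_zero]
        rfl
      have hdeg : (minpoly E a).natDegree = p := by rw [hmin, natDegree_X_pow_sub_C]
      obtain ⟨D, hD, hDn⟩ := exists_nilpotent_derivation_step (M := E⟮a⟯) p hn hδ hδn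
        (a := AdjoinSimple.gen E a) (by rw [minpoly_gen, hmin]) (fun y => by
          obtain ⟨P, hP, hy⟩ := (adjoin.powerBasis hint).exists_eq_aeval y
          rw [adjoin.powerBasis_dim, hdeg] at hP
          exact ⟨P, hP, hy⟩)
      have hfin : Module.finrank F E⟮a⟯ = p ^ (n + 1) := by
        rw [← Module.finrank_mul_finrank F E E⟮a⟯, hn, adjoin.finrank hint, hdeg, pow_succ]
      refine ih _ ?_ (E⟮a⟯.restrictScalars F) rfl (n + 1) hfin ⟨D, hD, hDn⟩
      have h1 : Module.finrank F (E⟮a⟯.restrictScalars F) ≤ Module.finrank F K :=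
        Submodule.finrank_le (Subalgebra.toSubmodule (E⟮a⟯.restrictScalars F).toSubalgebra)
      have h2 : Module.finrank F (E⟮a⟯.restrictScalars F) = p ^ (n + 1) := hfin
      have h3 : p ^ n < p ^ (n + 1) := Nat.pow_lt_pow_right hp.one_lt (Nat.lt_succ_self n)
      omega

end NilpotentDerivation

/-! ### Presenting B by K and τ; cyclicity for nilpotent δ -/

section Presentation

variable {F : Type u} {K : Type v} {B : Type w} [Field F] [Field K] [Algebra F K] [Ring B]
  [Algebra F B] {δ : Derivation F K K} {ι : K →ₐ[F] B} {τ : B}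

/-- The powers of τ below m = [K:F] are left independent over K, so they span a space of dimension
m², which is all of B. -/
theorem exists_leftEval_eq [Nontrivial B] [FiniteDimensional F K] [FiniteDimensional F B]
    (hδ : HasConstants δ) (h : ∀ a, τ * ι a = ι a * τ + ι (δ a))
    (hB : Module.finrank F B = Module.finrank F K ^ 2) (b : B) :
    ∃ P : K[X], P.degree < Module.finrank F K ∧ leftEval ι τ P = b := by
  set m := Module.finrank F K with hm
  let g : (Fin m → K) →ₗ[F] B := leftEval ι τ ∘ₗ
    ((degreeLT K m).subtype ∘ₗ (degreeLTEquiv K m).symm.toLinearMap).restrictScalars F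
  have hg : ∀ x, g x = leftEval ι τ ((degreeLTEquiv K m).symm x : K[X]) := fun _ => rfl
  have hinj : Function.Injective g := by
    refine (injective_iff_map_eq_zero g).2 fun x hx => ?_
    have h1 := leftEval_injective_of_degree_lt hδ h (P := ((degreeLTEquiv K m).symm x : K[X])) (by
      rw [natDegree_derivMinpoly hδ]
      exact mem_degreeLT.1 ((degreeLTEquiv K m).symm x).2) hx
    have h2 : (degreeLTEquiv K m).symm x = 0 := Subtype.ext h1
    rwa [LinearEquiv.map_eq_zero_iff] at h2
  have hsurj := (LinearMap.injective_iff_surjective_of_finrank_eq_finrank (f := g) (by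
    rw [Module.finrank_pi_fintype, Finset.sum_const, Finset.card_univ, Fintype.card_fin,
      smul_eq_mul, hB, sq])).1 hinj
  obtain ⟨x, hx⟩ := hsurj b
  exact ⟨_, mem_degreeLT.1 ((degreeLTEquiv K m).symm x).2, hx⟩

theorem leftEval_commute {x : B} (hx : ∀ a, x * ι a = ι a * x) (hxτ : x * τ = τ * x) (P : K[X]) :
    x * leftEval ι τ P = leftEval ι τ P * x := by
  induction P using Polynomial.induction_on' with
  | add P Q hP hQ => rw [map_add, mul_add, add_mul, hP, hQ]
  | monomial i a =>
    rw [leftEval_monomial, ← mul_assoc, hx, mul_assoc, mul_assoc,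
      ((show Commute x τ from hxτ).pow_right i).eq]

theorem mem_range_of_commute [Nontrivial B] [FiniteDimensional F K] [FiniteDimensional F B]
    [Algebra.IsCentral F B]
    (hδ : HasConstants δ) (h : ∀ a, τ * ι a = ι a * τ + ι (δ a))
    (hB : Module.finrank F B = Module.finrank F K ^ 2) {x : B}
    (hx : ∀ a, x * ι a = ι a * x) (hxτ : x * τ = τ * x) : x ∈ (algebraMap F B).range := by
  have h1 : x ∈ Subalgebra.center F B := by
    refine Subalgebra.mem_center_iff.2 fun b => ?_
    obtain ⟨P, -, rfl⟩ := exists_leftEval_eq hδ h hB b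
    exact (leftEval_commute hx hxτ P).symm
  rw [Algebra.IsCentral.center_eq_bot] at h1
  exact Algebra.mem_bot.1 h1

/-- Division by f reduces injectivity to remainders of degree below that of g, where the powers of τ
are independent. -/
theorem nonempty_diffExt_algEquiv [Nontrivial B] [FiniteDimensional F K] [FiniteDimensional F B]
    (hδ : HasConstants δ) (h : ∀ a, τ * ι a = ι a * τ + ι (δ a))
    (hB : Module.finrank F B = Module.finrank F K ^ 2) {d₀ : F}
    (hd : aeval τ (derivMinpoly δ) = algebraMap F B d₀) : Nonempty (DiffExt δ d₀ ≃ₐ[F] B) := by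
  let ψ := DiffPoly.lift ι τ h
  have hψ : ψ (extDiffPoly δ d₀) = 0 := by
    rw [DiffPoly.extDiffPoly_eq, map_sub, ← aeval_algHom_apply, DiffPoly.lift_t, hd,
      AlgHom.commutes, sub_self]
  refine ⟨AlgEquiv.ofBijective (DiffExt.lift ψ hψ) ⟨?_, fun b => ?_⟩⟩
  · refine (injective_iff_map_eq_zero _).2 fun x hx => ?_
    obtain ⟨y, rfl⟩ := DiffExt.mk_surjective x
    have hm : (derivMinpoly δ).natDegree ≠ 0 := by
      rw [natDegree_derivMinpoly hδ]
      exact Module.finrank_pos.ne'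
    have hne := DiffExt.extDiffPoly_ne_zero hm d₀
    obtain ⟨q, r, rfl, hr⟩ := DiffPoly.exists_eq_mul_add hne y
    have h1 : ψ r = 0 := by
      have h2 : ψ (q * extDiffPoly δ d₀ + r) = 0 := hx
      rwa [map_add, map_mul, hψ, mul_zero, zero_add] at h2
    have h2 : r = 0 := by
      refine leftEval_injective_of_degree_lt hδ h (P := DiffPoly.toPoly δ r) ?_ h1
      rwa [← DiffExt.natDegree_extDiffPoly (δ := δ) d₀, ← degree_eq_natDegree (p := DiffPoly.toPoly δ (extDiffPoly δ d₀)) hne]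
    rw [h2, add_zero, map_mul, DiffExt.mk_extDiffPoly, mul_zero]
  · obtain ⟨P, -, rfl⟩ := exists_leftEval_eq hδ h hB b
    exact ⟨DiffExt.mk δ d₀ (DiffPoly.ofPoly δ P), rfl⟩

theorem derivMinpoly_eq_X_pow [FiniteDimensional F K] {m : ℕ} (hδ : HasConstants δ)
    (hm : Module.finrank F K = m) (hδm : ∀ x, δ^[m] x = 0) : derivMinpoly δ = X ^ m := by
  have h1 : derivMinpoly δ ∣ X ^ m := by
    refine minpoly.dvd F _ ?_
    rw [map_pow, aeval_X]
    ext x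
    rw [coe_pow_apply, hδm x]
    rfl
  refine (eq_of_monic_of_dvd_of_natDegree_le (minpoly.monic (Algebra.IsIntegral.isIntegral _))
    (monic_X_pow m) h1 ?_).symm
  rw [natDegree_X_pow, ← hm, ← natDegree_derivMinpoly hδ, derivMinpoly]

/-- An element which commutes with `τ` is a polynomial in `τ`. -/
theorem exists_aeval_eq_of_commute [Nontrivial B] [FiniteDimensional F K] [FiniteDimensional F B]
    (hδ : HasConstants δ) (h : ∀ a, τ * ι a = ι a * τ + ι (δ a))
    (hB : Module.finrank F B = Module.finrank F K ^ 2) {x : B} (hx : τ * x = x * τ) :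
    ∃ Q : F[X], x = aeval τ Q := by
  obtain ⟨P, hP, rfl⟩ := exists_leftEval_eq hδ h hB x
  rw [mul_leftEval h, add_eq_left] at hx
  have h1 : DiffPoly.mapCoeff δ P = 0 := by
    refine leftEval_injective_of_degree_lt hδ h ?_ hx
    rw [natDegree_derivMinpoly hδ]
    refine lt_of_le_of_lt (degree_mono fun i hi => ?_) hP
    rw [mem_support_iff, DiffPoly.coeff_mapCoeff] at hi
    rw [mem_support_iff]
    intro h0
    rw [h0, map_zero] at hi
    exact hi rfl
  have h2 : P ∈ lifts (algebraMap F K) := by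
    rw [lifts_iff_coeff_lifts]
    intro i
    obtain ⟨r, hr⟩ := hδ (P.coeff i) (by rw [← DiffPoly.coeff_mapCoeff, h1, coeff_zero])
    exact ⟨r, hr⟩
  obtain ⟨Q, rfl⟩ := (mem_lifts P).1 h2
  exact ⟨Q, leftEval_map _ _ _⟩

theorem aeval_pow_mem_range {z : B} {q : ℕ} (p : ℕ) [Fact p.Prime] [CharP F p] [Nontrivial B]
    (hq : z ^ p ^ q ∈ (algebraMap F B).range) (Q : F[X]) :
    aeval z Q ^ p ^ q ∈ (algebraMap F B).range := by
  have : CharP B p := charP_of_injective_algebraMap (FaithfulSMul.algebraMap_injective F B) p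
  induction Q using Polynomial.induction_on' with
  | add P Q hP hQ =>
    rw [map_add, add_pow_char_pow_of_commute _ _ ((Commute.all P Q).map (aeval z))]
    exact add_mem hP hQ
  | monomial i a =>
    rw [aeval_monomial, Commute.mul_pow (Algebra.commutes a (z ^ i)), ← map_pow, ← pow_mul,
      mul_comm i, pow_mul]
    exact mul_mem ⟨_, rfl⟩ (pow_mem hq i)

/-- The inner automorphism of a unit. -/
def conjAlgEquiv (F : Type u) {B : Type w} [Field F] [Ring B] [Algebra F B] (z : Bˣ) : B ≃ₐ[F] B :=
  AlgEquiv.ofAlgHom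
    (AlgHom.ofLinearMap (LinearMap.mulLeft F (z : B) ∘ₗ LinearMap.mulRight F ((z⁻¹ : Bˣ) : B))
      (by simp) (fun a b => by simp [mul_assoc]))
    (AlgHom.ofLinearMap (LinearMap.mulLeft F ((z⁻¹ : Bˣ) : B) ∘ₗ LinearMap.mulRight F (z : B))
      (by simp) (fun a b => by simp [mul_assoc]))
    (by ext a; simp [mul_assoc]) (by ext a; simp [mul_assoc])

theorem mul_eq_conjAlgEquiv_mul (z : Bˣ) (b : B) : (z : B) * b = conjAlgEquiv F z b * z := by
  change (z : B) * b = ((z : B) * (b * ((z⁻¹ : Bˣ) : B))) * z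
  simp [mul_assoc]

/-- A differential extension for a nilpotent derivation is a cyclic algebra. -/
theorem exists_isCyclicAlg_of_nilpotent (p : ℕ) [Fact p.Prime] [CharP F p] [Nontrivial B]
    [FiniteDimensional F K] [FiniteDimensional F B] [Algebra.IsCentral F B] {e : ℕ}
    (hδ : HasConstants δ) (hK : Module.finrank F K = p ^ e) (hδe : ∀ x, δ^[p ^ e] x = 0)
    (h : ∀ a, τ * ι a = ι a * τ + ι (δ a)) (hB : Module.finrank F B = (p ^ e) ^ 2)
    {d₀ : F} (hd : τ ^ p ^ e = algebraMap F B d₀) :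
    ∃ (L : Type w) (_ : CommRing L) (_ : Algebra F L) (σ : L ≃ₐ[F] L) (c : Fˣ),
      IsCyclicGaloisAlg F L σ (p ^ e) ∧ IsCyclicAlg F L B σ c (p ^ e) := by
  have hp : p.Prime := Fact.out
  have hpe : 0 < p ^ e := pow_pos hp.pos e
  have : CharP B p := charP_of_injective_algebraMap (FaithfulSMul.algebraMap_injective F B) p
  have hB' : Module.finrank F B = Module.finrank F K ^ 2 := by rw [hB, hK]
  -- d₀ may be zero; translating τ by ε makes the p^e-th power a nonzero scalar, so τ + ε is a unit.
  -- It still induces δ.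
  obtain ⟨ε, hε⟩ : ∃ ε : F, d₀ + ε ^ p ^ e ≠ 0 := by
    by_cases h0 : d₀ = 0
    · exact ⟨1, by rw [h0, zero_add, one_pow]; exact one_ne_zero⟩
    · exact ⟨0, by rw [zero_pow hpe.ne', add_zero]; exact h0⟩
  have hpow : ∀ j, (τ + algebraMap F B ε) ^ p ^ j = τ ^ p ^ j + algebraMap F B (ε ^ p ^ j) := by
    intro j
    rw [add_pow_char_pow_of_commute _ _ (Algebra.commutes ε τ : Commute _ _).symm, map_pow]
  have hc : (τ + algebraMap F B ε) ^ p ^ e = algebraMap F B (d₀ + ε ^ p ^ e) := by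
    rw [hpow, hd, map_add]
  have hu : IsUnit (τ + algebraMap F B ε) := by
    have h1 : IsUnit ((τ + algebraMap F B ε) ^ p ^ e) := by
      rw [hc]
      exact (IsUnit.mk0 _ hε).map (algebraMap F B)
    exact (isUnit_pow_iff hpe.ne').1 h1
  obtain ⟨z, hz⟩ := hu
  have hσ : ∀ b, (z : B) * b = conjAlgEquiv F z b * z := mul_eq_conjAlgEquiv_mul z
  have hcomm : ∀ x, (z : B) * x = x * z → τ * x = x * τ := by
    intro x hx
    rw [hz, add_mul, mul_add, Algebra.commutes ε x] at hx
    exact add_right_cancel hx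
  obtain ⟨y, hy⟩ : ∃ y, δ^[p ^ e - 1] y = 1 := by
    obtain ⟨y, hy⟩ : ∃ y, δ^[p ^ e - 1] y ≠ 0 := by
      by_contra! h0
      have h1 : derivMinpoly δ ∣ X ^ (p ^ e - 1) := by
        refine minpoly.dvd F _ ?_
        rw [map_pow, aeval_X]
        ext x
        rw [coe_pow_apply, h0 x]
        rfl
      have h2 := natDegree_le_of_dvd h1 (pow_ne_zero _ X_ne_zero)
      rw [natDegree_derivMinpoly hδ, hK, natDegree_X_pow] at h2
      omega
    obtain ⟨r, hr⟩ := hδ (δ^[p ^ e - 1] y) (by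
      rw [← Function.iterate_succ_apply' (⇑δ), Nat.succ_eq_add_one, Nat.sub_add_cancel hpe, hδe])
    refine ⟨r⁻¹ • y, ?_⟩
    rw [← hr] at hy
    rw [← coe_pow_apply, map_smul, coe_pow_apply, ← hr, Algebra.smul_def, ← map_mul,
      inv_mul_cancel₀ (fun h0 => hy (by rw [h0, map_zero])), map_one]
  obtain ⟨L, hL⟩ := exists_isCyclicTower (p := p) (e := e) (σ := conjAlgEquiv F z) (n := e)
    (by
      intro k hk
      have hle : p ^ k ≤ p ^ e - 1 := Nat.le_sub_one_of_lt (Nat.pow_lt_pow_right hp.one_lt hk)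
      have h1 : δ^[p ^ k] (δ^[p ^ e - 1 - p ^ k] y) = 1 := by
        rw [← Function.iterate_add_apply, Nat.add_sub_cancel' hle, hy]
      set a := δ^[p ^ e - 1 - p ^ k] y
      -- Since δ^{p^k}(a) = 1, z^{p^k} a = a z^{p^k} + 1. Hence conjugation by z^{p^k} adds 1 to a
      -- z^{p^k}.
      refine ⟨ι a * (z : B) ^ p ^ k, ?_⟩
      have h2 := mul_pow_eq_of_mul_eq hσ (p ^ k) (ι a * (z : B) ^ p ^ k)
      refine (z.isUnit.pow (p ^ k)).mul_right_cancel (h2.symm.trans ?_)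
      have h3 : (z : B) ^ p ^ k * ι a = ι a * (z : B) ^ p ^ k + 1 := by
        rw [hz, hpow, add_mul, mul_add, charPow_mul p h, h1, map_one, Algebra.commutes]
        abel
      rw [← mul_assoc, h3])
    (by
      intro x hx
      have h1 := hσ x
      rw [hx] at h1
      -- A σ-fixed element commutes with τ, so it is a polynomial in τ over F; its p^e-th power is a
      -- scalar because that of τ is.
      obtain ⟨Q, rfl⟩ := exists_aeval_eq_of_commute hδ h hB' (hcomm x h1)
      exact aeval_pow_mem_range p ⟨d₀, hd.symm⟩ Q)
  obtain ⟨L, i1, i2, σ, h1, h2⟩ := hL.exists_isCyclicAlg hσ z.isUnit hB (c := Units.mk0 _ hε) (by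
    rw [hz, hc]; rfl)
  exact ⟨L, i1, i2, σ, _, h1, h2⟩

end Presentation

/-- With δ nilpotent, g = t^{p^e}; as δ^{p^e} = 0, the element τ^{p^e} commutes with K and with τ,
hence is a scalar, and this is d₀. -/
theorem exists_diffExt_and_isCyclicAlg (p : ℕ) [Fact p.Prime] {F : Type u} {K : Type v} {B : Type w}
    [Field F] [CharP F p] [Field K] [Algebra F K] [FiniteDimensional F K]
    (hK : ∀ x : K, x ^ p ∈ (algebraMap F K).range)
    [Ring B] [Algebra F B] [Algebra.IsCentral F B] [IsSimpleRing B] [FiniteDimensional F B]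
    (hB : Module.finrank F B = Module.finrank F K ^ 2) (hsplit : SplitBy F K B) :
    ∃ e, Module.finrank F K = p ^ e ∧
      (∃ (δ : Derivation F K K) (d₀ : F), HasConstants δ ∧ (derivMinpoly δ).natDegree = p ^ e ∧
        Nonempty (DiffExt δ d₀ ≃ₐ[F] B)) ∧
      ∃ (L : Type w) (_ : CommRing L) (_ : Algebra F L) (σ : L ≃ₐ[F] L) (c : Fˣ),
        IsCyclicGaloisAlg F L σ (p ^ e) ∧ IsCyclicAlg F L B σ c (p ^ e) := by
  obtain ⟨e, he, δ, hδ, hδe⟩ := exists_nilpotent_derivation F K p hK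
  obtain ⟨ι⟩ := hsplit.exists_algHom hB
  obtain ⟨τ, h⟩ := hsplit.exists_ad ι δ
  have hτ : τ ^ p ^ e ∈ (algebraMap F B).range :=
    mem_range_of_commute hδ h hB (fun a => by rw [charPow_mul p h, hδe, map_zero, add_zero])
      (Commute.pow_left (Commute.refl τ) _)
  obtain ⟨d₀, hd⟩ := hτ
  refine ⟨e, he, ⟨δ, d₀, hδ, by rw [natDegree_derivMinpoly hδ, he], ?_⟩, ?_⟩
  · refine nonempty_diffExt_algEquiv hδ h hB ?_
    rw [derivMinpoly_eq_X_pow hδ he hδe, map_pow, aeval_X, hd]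
  · exact exists_isCyclicAlg_of_nilpotent p hδ he hδe h (by rw [hB, he]) hd.symm

/-! ### Embedding cyclic p-extensions in larger ones -/

section CyclicField

variable {F : Type u} {E : Type v} [Field F] [Field E] [Algebra F E] [FiniteDimensional F E]

theorem zpowers_eq_top_of_fixed {τ : E ≃ₐ[F] E} (hτ : ∀ x, τ x = x → x ∈ (algebraMap F E).range) :
    IsGalois F E ∧ Subgroup.zpowers τ = ⊤ := by
  have h1 : IntermediateField.fixedField (Subgroup.zpowers τ) = ⊥ := by
    rw [eq_bot_iff]
    intro x hx
    exact IntermediateField.mem_bot.2 (hτ x (hx ⟨τ, Subgroup.mem_zpowers τ⟩))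
  have h2 : Subgroup.zpowers τ = ⊤ := by
    rw [← IntermediateField.fixingSubgroup_fixedField (Subgroup.zpowers τ), h1,
      IntermediateField.fixingSubgroup_bot]
  exact ⟨IsGalois.of_fixedField_eq_bot F E (by rw [← h2, h1]), h2⟩

theorem orderOf_eq_finrank_of_fixed {τ : E ≃ₐ[F] E}
    (hτ : ∀ x, τ x = x → x ∈ (algebraMap F E).range) : orderOf τ = Module.finrank F E := by
  obtain ⟨h1, h2⟩ := zpowers_eq_top_of_fixed hτ
  rw [← IsGalois.card_aut_eq_finrank, ← Nat.card_zpowers, h2, Subgroup.card_top]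

theorem fixed_of_zpowers_eq_top [IsGalois F E] {τ : E ≃ₐ[F] E} (hτ : Subgroup.zpowers τ = ⊤)
    (x : E) (hx : τ x = x) : x ∈ (algebraMap F E).range := by
  refine (IsGalois.mem_range_algebraMap_iff_fixed x).2 fun g => ?_
  have h2 : Subgroup.zpowers τ ≤ MulAction.stabilizer (E ≃ₐ[F] E) x :=
    Subgroup.zpowers_le.2 hx
  exact h2 (hτ ▸ Subgroup.mem_top g)

/-- Dedekind independence of the distinct powers of τ gives an element of nonzero trace; the trace
lies in F, so rescaling works. -/
theorem exists_trace_eq_one {τ : E ≃ₐ[F] E} (hτ : ∀ x, τ x = x → x ∈ (algebraMap F E).range) :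
    ∃ θ, ∑ i ∈ Finset.range (Module.finrank F E), (τ ^ i) θ = 1 := by
  have ho := orderOf_eq_finrank_of_fixed hτ
  set q := Module.finrank F E
  obtain ⟨θ, hθ⟩ : ∃ θ, ∑ i ∈ Finset.range q, (τ ^ i) θ ≠ 0 := by
    by_contra! h0
    have h1 := (linearIndependent_monoidHom E E).comp
      (fun i : Fin q => (((τ ^ (i : ℕ) : E ≃ₐ[F] E) : E →ₐ[F] E) : E →* E)) (by
        intro i j hij
        refine Fin.ext (pow_injOn_Iio_orderOf (x := τ) (by rw [ho]; exact i.2)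
          (by rw [ho]; exact j.2) (AlgEquiv.ext fun x => ?_))
        exact DFunLike.congr_fun hij x)
    have h2 := Fintype.linearIndependent_iff.1 h1 (fun _ => 1) (by
      funext x
      rw [Finset.sum_apply, Pi.zero_apply, ← h0 x, ← Fin.sum_univ_eq_sum_range (fun i => (τ ^ i) x)]
      exact Finset.sum_congr rfl fun i _ => one_mul _)
    exact one_ne_zero (h2 ⟨0, Module.finrank_pos⟩)
  have hfix : τ (∑ i ∈ Finset.range q, (τ ^ i) θ) = ∑ i ∈ Finset.range q, (τ ^ i) θ := by
    rw [map_sum]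
    simp only [alg_pow_succ_apply]
    rw [sum_range_shift (fun i => (τ ^ i) θ), ← ho, pow_orderOf_eq_one, pow_zero, sub_self, add_zero]
  obtain ⟨r, hr⟩ := hτ _ hfix
  refine ⟨r⁻¹ • θ, ?_⟩
  simp only [map_smul]
  rw [← Finset.smul_sum, ← hr, Algebra.smul_def, ← map_mul, inv_mul_cancel₀, map_one]
  rintro rfl
  exact hθ (by rw [← hr, map_zero])

open IntermediateField in
/-- A cyclic extension of degree `p^s`, `s ≥ 1`, of a field of characteristic `p` embeds in a cyclic
extension of degree `p^(s+1)`. -/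
theorem exists_cyclic_extension_succ (p : ℕ) [Fact p.Prime] [CharP F p] {τ : E ≃ₐ[F] E}
    (hτ : ∀ x, τ x = x → x ∈ (algebraMap F E).range) {s : ℕ} (hs : 1 ≤ s)
    (hE : Module.finrank F E = p ^ s) :
    ∃ (E' : Type v) (_ : Field E') (_ : Algebra F E') (_ : E →ₐ[F] E') (τ' : E' ≃ₐ[F] E'),
      FiniteDimensional F E' ∧ (∀ x, τ' x = x → x ∈ (algebraMap F E').range) ∧
      Module.finrank F E' = p ^ (s + 1) := by
  have hp : p.Prime := Fact.out
  have ho := orderOf_eq_finrank_of_fixed hτ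
  obtain ⟨θ, hθ⟩ := exists_trace_eq_one hτ
  rw [hE] at hθ ho
  have : CharP E p := charP_of_injective_algebraMap (algebraMap F E).injective p
  -- Hilbert 90 gives a with τ(a) = a + θ^p - θ. The larger field is generated by a root x of X^p -
  -- X - a.
  obtain ⟨a, -, ha⟩ := exists_sub_eq_of_trace_eq_zero (L := (⊤ : Subalgebra F E)) (σ := τ)
    (y := θ ^ p - θ) (fun _ _ => Algebra.mem_top) (Algebra.mem_top (x := θ)) Algebra.mem_top hθ (by
      simp only [map_sub, Finset.sum_sub_distrib, map_pow]
      rw [← sum_pow_char_of_commute p (fun i => (τ ^ i) θ) _ fun i j => Commute.all _ _, hθ,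
        one_pow, sub_self])
  let Ω := AlgebraicClosure E
  have : CharP Ω p := charP_of_injective_algebraMap (algebraMap E Ω).injective p
  have : Algebra.IsAlgebraic F Ω := Algebra.IsAlgebraic.trans F E Ω
  have : IsAlgClosure F Ω := ⟨inferInstance, inferInstance⟩
  have : Normal F Ω := IsAlgClosure.normal F Ω
  let σ : Ω ≃ₐ[F] Ω := τ.liftNormal Ω
  have hσE : ∀ l : E, σ (algebraMap E Ω l) = algebraMap E Ω (τ l) := τ.liftNormal_commutes Ω
  have hdegree : (X ^ p - X - C a : E[X]).natDegree = p := by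
    rw [natDegree_sub_C]
    exact FiniteField.X_pow_card_sub_X_natDegree_eq E hp.one_lt
  have hne : (X ^ p - X - C a : E[X]) ≠ 0 := by
    intro h0
    rw [h0, natDegree_zero] at hdegree
    exact hp.ne_zero hdegree.symm
  obtain ⟨x, hx⟩ := IsAlgClosed.exists_aeval_eq_zero Ω (X ^ p - X - C a : E[X]) (by
    rw [degree_eq_natDegree hne, hdegree]
    exact_mod_cast hp.ne_zero)
  have hxa : x ^ p - x = algebraMap E Ω a := by
    rw [map_sub, map_sub, map_pow, aeval_X, aeval_C, sub_eq_zero] at hx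
    exact hx
  -- σ(x) - θ is again a root of X^p - X - a, so it differs from x by an element of the prime field.
  obtain ⟨j, hj⟩ : ∃ j : ZMod p, σ x = x + algebraMap E Ω θ + ZMod.castHom (dvd_refl p) Ω j := by
    have h1 : (σ x - x - algebraMap E Ω θ) ^ p = σ x - x - algebraMap E Ω θ := by
      have h2 := congrArg σ hxa
      rw [map_sub, map_pow, hσE, ha, map_add, map_sub, map_pow, ← hxa] at h2
      rw [sub_pow_char, sub_pow_char, ← sub_eq_zero]
      rw [← sub_eq_zero] at h2
      rw [← h2]
      ring
    have h2 := (Subfield.mem_bot_iff_pow_eq_self (F := Ω) (p := p)).2 h1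
    rw [← ZMod.fieldRange_castHom_eq_bot p] at h2
    obtain ⟨j, hj⟩ := h2
    exact ⟨j, by rw [hj]; ring⟩
  let M : IntermediateField E Ω := E⟮x⟯
  have hxM : x ∈ M := mem_adjoin_simple_self E x
  have hEM : ∀ l : E, algebraMap E Ω l ∈ M := fun l => M.algebraMap_mem l
  have hjF : ∀ j : ZMod p, ZMod.castHom (dvd_refl p) Ω j =
      algebraMap F Ω (ZMod.castHom (dvd_refl p) F j) := fun j =>
    (RingHom.congr_fun (RingHom.ext_zmod (ZMod.castHom (dvd_refl p) Ω)
      ((algebraMap F Ω).comp (ZMod.castHom (dvd_refl p) F))) j)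
  have hjM : ZMod.castHom (dvd_refl p) Ω j ∈ M := by
    rw [hjF, IsScalarTower.algebraMap_apply F E Ω]
    exact hEM _
  have hσM : ∀ y ∈ M, σ y ∈ M := by
    intro y hy
    induction hy using IntermediateField.adjoin_induction with
    | mem y hy =>
      rw [Set.mem_singleton_iff.1 hy, hj]
      exact M.add_mem (M.add_mem hxM (hEM θ)) hjM
    | algebraMap l => rw [hσE]; exact hEM _
    | add y z _ _ hy hz => rw [map_add]; exact M.add_mem hy hz
    | inv y _ hy => rw [map_inv₀]; exact M.inv_mem hy
    | mul y z _ _ hy hz => rw [map_mul]; exact M.mul_mem hy hz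
  have hint : IsIntegral E x := Algebra.IsIntegral.isIntegral x
  have hfinM : FiniteDimensional E M := adjoin.finiteDimensional hint
  have hfin : FiniteDimensional F M := FiniteDimensional.trans F E M
  let f : M →ₐ[F] M :=
    ((σ : Ω →ₐ[F] Ω).comp (M.val.restrictScalars F)).codRestrict
      ((M.restrictScalars F).toSubalgebra) fun y => hσM y y.2
  have hf : ∀ y : M, (f y : Ω) = σ y := fun _ => rfl
  let τ' : M ≃ₐ[F] M := AlgEquiv.ofBijective f (Algebra.IsAlgebraic.algHom_bijective f)
  have hτ' : ∀ n (y : M), ((τ' ^ n) y : Ω) = (σ ^ n) (y : Ω) := by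
    intro n y
    induction n with
    | zero => rfl
    | succ n ih => rw [← alg_pow_succ_apply, ← alg_pow_succ_apply, ← ih]; rfl
  have hσn : ∀ n (l : E), (σ ^ n) (algebraMap E Ω l) = algebraMap E Ω ((τ ^ n) l) := by
    intro n l
    induction n with
    | zero => rfl
    | succ n ih => rw [← alg_pow_succ_apply, ih, hσE, alg_pow_succ_apply]
  have hσx : ∀ n, (σ ^ n) x = x + algebraMap E Ω (∑ i ∈ Finset.range n, (τ ^ i) θ) +
      n * ZMod.castHom (dvd_refl p) Ω j := by
    intro n
    induction n with
    | zero => simp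
    | succ n ih =>
      rw [pow_succ, AlgEquiv.mul_apply, hj, map_add, map_add, ih, hσn, Finset.sum_range_succ,
        map_add, hjF, AlgEquiv.commutes]
      push_cast
      ring
  -- The contribution p^s·j of the ambiguity vanishes because s ≥ 1, so σ^{p^s} adds the trace of θ,
  -- namely 1, to x.
  have hσq : ∀ n : ℕ, (σ ^ (p ^ s * n)) x = x + n := by
    intro n
    induction n with
    | zero => simp
    | succ n ih =>
      have h1 : ((p ^ s : ℕ) : Ω) = 0 := by
        rw [Nat.cast_pow, CharP.cast_eq_zero, zero_pow (by omega)]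
      rw [Nat.mul_succ, alg_pow_add_apply, hσx (p ^ s), hθ, map_one, h1, zero_mul, add_zero, map_add,
        map_one, ih]
      push_cast
      ring
  have hle : Module.finrank F M ≤ p ^ s * p := by
    rw [← Module.finrank_mul_finrank F E M, hE, adjoin.finrank hint]
    refine Nat.mul_le_mul_left _ ?_
    conv_rhs => rw [← hdegree]
    exact natDegree_le_of_dvd (minpoly.dvd E x hx) hne
  have hge : p ^ s * p ≤ orderOf τ' := by
    have h1 : τ' ^ orderOf τ' = 1 := pow_orderOf_eq_one τ'
    have h2 : ∀ y ∈ M, (σ ^ orderOf τ') y = y := fun y hy => by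
      have := hτ' (orderOf τ') ⟨y, hy⟩
      rw [h1] at this
      exact this.symm
    have h3 : τ ^ orderOf τ' = 1 := by
      refine AlgEquiv.ext fun l => (algebraMap E Ω).injective ?_
      rw [← hσn, h2 _ (hEM l)]
      rfl
    obtain ⟨n, hn⟩ : p ^ s ∣ orderOf τ' := by
      rw [← ho]
      exact orderOf_dvd_of_pow_eq_one h3
    have h4 := h2 x hxM
    rw [hn, hσq, add_eq_left, CharP.cast_eq_zero_iff Ω p] at h4
    refine Nat.le_of_dvd (orderOf_pos τ') ?_
    rw [hn]
    exact Nat.mul_dvd_mul_left _ h4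
  have hcard : Module.finrank (fixedField (Subgroup.zpowers τ')) M = orderOf τ' := by
    rw [finrank_fixedField_eq_card, Nat.card_zpowers]
  have hmul := Module.finrank_mul_finrank F (fixedField (Subgroup.zpowers τ')) M
  have hpos : 0 < Module.finrank F (fixedField (Subgroup.zpowers τ')) := Module.finrank_pos
  -- [M:F] ≤ p^{s+1} ≤ orderOf τ' = [M : fixed field], which forces the fixed field to be F.
  have hone : Module.finrank F (fixedField (Subgroup.zpowers τ')) = 1 := by
    by_contra h1
    have h2 : 2 ≤ Module.finrank F (fixedField (Subgroup.zpowers τ')) := by omega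
    have h3 := Nat.mul_le_mul_right (orderOf τ') h2
    rw [hcard] at hmul
    have h4 : 0 < p ^ s * p := Nat.mul_pos (pow_pos hp.pos s) hp.pos
    omega
  refine ⟨M, inferInstance, inferInstance, IsScalarTower.toAlgHom F E M, τ', hfin, ?_, ?_⟩
  · intro y hy
    have h1 : fixedField (Subgroup.zpowers τ') = ⊥ := finrank_eq_one_iff.1 hone
    refine IntermediateField.mem_bot.1 ?_
    rw [← h1]
    rintro ⟨g, hg⟩
    have h2 : Subgroup.zpowers τ' ≤ MulAction.stabilizer (M ≃ₐ[F] M) y :=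
      Subgroup.zpowers_le.2 hy
    exact h2 hg
  · rw [hone, one_mul, hcard] at hmul
    rw [pow_succ]
    omega

theorem exists_cyclic_extension (p : ℕ) [Fact p.Prime] [CharP F p] {τ : E ≃ₐ[F] E}
    (hτ : ∀ x, τ x = x → x ∈ (algebraMap F E).range) {s : ℕ} (hs : 1 ≤ s)
    (hE : Module.finrank F E = p ^ s) (n : ℕ) :
    ∃ (E' : Type v) (_ : Field E') (_ : Algebra F E') (_ : E →ₐ[F] E') (τ' : E' ≃ₐ[F] E'),
      FiniteDimensional F E' ∧ (∀ x, τ' x = x → x ∈ (algebraMap F E').range) ∧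
      Module.finrank F E' = p ^ (s + n) := by
  induction n with
  | zero => exact ⟨E, inferInstance, inferInstance, AlgHom.id F E, τ, inferInstance, hτ, hE⟩
  | succ n ih =>
    obtain ⟨E₁, _, _, f₁, τ₁, _, hτ₁, hE₁⟩ := ih
    obtain ⟨E₂, i₁, i₂, f₂, τ₂, h1, h2, h3⟩ :=
      exists_cyclic_extension_succ p hτ₁ (hs.trans (Nat.le_add_right s n)) hE₁
    exact ⟨E₂, i₁, i₂, f₂.comp f₁, τ₂, h1, h2, h3⟩

end CyclicField

/-! ### Residue fields of cyclic Galois algebras -/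

section CyclicQuotient

variable {F : Type u} {L : Type w} [Field F] [CommRing L] [Algebra F L] {σ : L ≃ₐ[F] L} {p e : ℕ}

/-- σ - 1 is nilpotent in characteristic p. Its last nonzero iterate on an element of I is fixed by
σ, hence a nonzero scalar in I. -/
theorem IsCyclicGaloisAlg.eq_bot_of_stable [Fact p.Prime] [CharP F p]
    (h : IsCyclicGaloisAlg F L σ (p ^ e)) {I : Ideal L} (hI : ∀ x ∈ I, σ x ∈ I) (hne : I ≠ ⊤) :
    I = ⊥ := by
  have : Nontrivial L := by
    rw [← not_subsingleton_iff_nontrivial]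
    exact fun hs => hne (Subsingleton.elim _ _)
  have : CharP (Module.End F L) p := charP_of_injective_algebraMap
    (FaithfulSMul.algebraMap_injective F _) p
  by_contra hbot
  obtain ⟨x, hxI, hx0⟩ := I.ne_bot_iff.1 hbot
  let T : Module.End F L := σ.toLinearMap - 1
  have hT : ∀ x, T x = σ x - x := fun _ => rfl
  have hTI : ∀ n, (T ^ n) x ∈ I := by
    intro n
    induction n with
    | zero => exact hxI
    | succ n ih =>
      rw [pow_succ', Module.End.mul_apply, hT]
      exact I.sub_mem (hI _ ih) ih
  have hpow : ∀ n (y : L), ((σ.toLinearMap : Module.End F L) ^ n) y = (σ ^ n) y := by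
    intro n y
    induction n with
    | zero => rfl
    | succ n ih => rw [pow_succ', Module.End.mul_apply, ih, ← alg_pow_succ_apply]; rfl
  have hTm : T ^ p ^ e = 0 := by
    rw [sub_pow_char_pow_of_commute _ _ (Commute.one_right _), one_pow]
    refine LinearMap.ext fun y => ?_
    rw [LinearMap.sub_apply, hpow, h.pow_eq_one]
    exact sub_self y
  have hex : ∃ n, (T ^ n) x = 0 := ⟨p ^ e, by rw [hTm]; rfl⟩
  classical
  have hn0 : Nat.find hex ≠ 0 := fun h0 => hx0 (by
    have := Nat.find_spec hex
    rwa [h0, pow_zero] at this)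
  obtain ⟨n, hn⟩ := Nat.exists_eq_succ_of_ne_zero hn0
  have h1 : (T ^ n) x ≠ 0 := Nat.find_min hex (by omega)
  have h2 : σ ((T ^ n) x) = (T ^ n) x := by
    have := Nat.find_spec hex
    rw [hn, Nat.succ_eq_add_one, pow_succ', Module.End.mul_apply, hT] at this
    exact sub_eq_zero.1 this
  obtain ⟨r, hr⟩ := h.fixed _ h2
  have hr0 : r ≠ 0 := by
    rintro rfl
    exact h1 (by rw [← hr, map_zero])
  exact hne (I.eq_top_of_isUnit_mem (hr ▸ hTI n) ((IsUnit.mk0 r hr0).map (algebraMap F L)))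

/-- A cyclic Galois algebra of degree `p^e` in characteristic `p` has a quotient which is a cyclic
Galois field extension. -/
theorem IsCyclicGaloisAlg.exists_quotient_field [Fact p.Prime] [CharP F p]
    (h : IsCyclicGaloisAlg F L σ (p ^ e)) :
    ∃ (E : Type w) (_ : Field E) (_ : Algebra F E) (_ : L →ₐ[F] E) (τ : E ≃ₐ[F] E) (s : ℕ),
      FiniteDimensional F E ∧ (∀ x, τ x = x → x ∈ (algebraMap F E).range) ∧
      Module.finrank F E = p ^ s ∧ s ≤ e := by
  classical
  have hp : p.Prime := Fact.out
  have hpe : 0 < p ^ e := pow_pos hp.pos e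
  have hfin : FiniteDimensional F L := by
    refine Module.finite_of_finrank_pos ?_
    rw [h.finrank_eq]; exact hpe
  have : Nontrivial L := by
    rw [← not_subsingleton_iff_nontrivial]
    intro hs
    have := h.finrank_eq
    rw [Module.finrank_zero_of_subsingleton] at this
    omega
  obtain ⟨P, hP⟩ := Ideal.exists_maximal L
  -- d is the least positive exponent for which σ^d stabilizes P, and τ will be induced by σ^d. By
  -- minimality P differs from its other conjugates, so it is comaximal with their intersection J.
  have hex : ∃ d, 0 < d ∧ ∀ x, (σ ^ d) x ∈ P ↔ x ∈ P :=
    ⟨p ^ e, hpe, fun x => by rw [h.pow_eq_one]; rfl⟩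
  set d := Nat.find hex with hd
  obtain ⟨hd0, hdP⟩ : 0 < d ∧ ∀ x, (σ ^ d) x ∈ P ↔ x ∈ P := Nat.find_spec hex
  let Q : ℕ → Ideal L := fun i => P.comap ((σ ^ i : L ≃ₐ[F] L) : L →+* L)
  have hQ : ∀ i x, x ∈ Q i ↔ (σ ^ i) x ∈ P := fun _ _ => Iff.rfl
  let J : Ideal L := (Finset.Ioo 0 d).inf Q
  have hJ : ∀ x, x ∈ J ↔ ∀ i, 0 < i → i < d → (σ ^ i) x ∈ P := by
    intro x
    rw [Submodule.mem_finsetInf]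
    simp only [Finset.mem_Ioo, hQ, and_imp]
  have hJP : ¬ J ≤ P := by
    intro hle
    obtain ⟨i, hi, hiP⟩ := (Ideal.IsPrime.inf_le' hP.isPrime).1 hle
    rw [Finset.mem_Ioo] at hi
    have hmax : (Q i).IsMaximal :=
      Ideal.comap_isMaximal_of_surjective _ (σ ^ i : L ≃ₐ[F] L).surjective
    have heq : Q i = P := hmax.eq_of_le hP.ne_top hiP
    exact Nat.find_min hex hi.2 ⟨hi.1, fun x => by rw [← hQ, heq]⟩
  have hsup : P ⊔ J = ⊤ := hP.1.2 _ (lt_of_le_of_ne le_sup_left fun h0 => hJP (h0 ▸ le_sup_right))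
  have hstab : ∀ n x, (σ ^ (d * n)) x ∈ P ↔ x ∈ P := by
    intro n x
    induction n with
    | zero => rfl
    | succ n ih => rw [Nat.mul_succ, add_comm, alg_pow_add_apply, hdP, ih]
  have hzero : ∀ x, (∀ i < d, (σ ^ i) x ∈ P) → x = 0 := by
    intro x hx
    let I : Ideal L := ⨅ i, Q i
    have hI : ∀ x, x ∈ I ↔ ∀ i, (σ ^ i) x ∈ P := fun x => by
      simp only [I, Submodule.mem_iInf, hQ]
    have hIbot : I = ⊥ := by
      refine h.eq_bot_of_stable (fun x hx => ?_) fun htop => hP.ne_top ?_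
      · rw [hI] at hx ⊢
        intro i
        have := hx (i + 1)
        rwa [alg_pow_add_apply, pow_one] at this
      · rw [Ideal.eq_top_iff_one]
        exact (hI 1).1 (htop ▸ Submodule.mem_top) 0
    have hxI : x ∈ I := by
      rw [hI]
      intro i
      rw [← Nat.div_add_mod i d, alg_pow_add_apply, hstab]
      exact hx _ (Nat.mod_lt _ hd0)
    rwa [hIbot] at hxI
  let _ : Field (L ⧸ P) := Ideal.Quotient.field P
  have hfinE : FiniteDimensional F (L ⧸ P) := Module.Finite.of_surjective
    (Ideal.Quotient.mkₐ F P).toLinearMap (Ideal.Quotient.mkₐ_surjective F P)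
  let f : (L ⧸ P) →ₐ[F] (L ⧸ P) := Ideal.quotientMapₐ P ((σ ^ d : L ≃ₐ[F] L) : L →ₐ[F] L)
    fun x hx => (hdP x).2 hx
  have hf : ∀ x : L, f (Ideal.Quotient.mk P x) = Ideal.Quotient.mk P ((σ ^ d) x) := fun _ => rfl
  let τ : (L ⧸ P) ≃ₐ[F] (L ⧸ P) :=
    AlgEquiv.ofBijective f (Algebra.IsAlgebraic.algHom_bijective f)
  have hτ : ∀ n (x : L), (τ ^ n) (Ideal.Quotient.mk P x) = Ideal.Quotient.mk P ((σ ^ (d * n)) x) := by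
    intro n x
    induction n with
    | zero => rfl
    | succ n ih =>
      rw [← alg_pow_succ_apply, ih, Nat.mul_succ, add_comm, alg_pow_add_apply]
      exact hf _
  have hfix : ∀ x, τ x = x → x ∈ (algebraMap F (L ⧸ P)).range := by
    intro x hx
    obtain ⟨x, rfl⟩ := Ideal.Quotient.mk_surjective x
    -- Lift the fixed residue class to y in J. Then σ^d(y) = y, as the difference lies in every
    -- conjugate of P. The sum of σ^i(y) for i < d is fixed by σ, hence a scalar, and is congruent
    -- to y modulo P.
    obtain ⟨a, ha, y, hy, hxy⟩ := Submodule.mem_sup.1 (hsup ▸ Submodule.mem_top : x ∈ P ⊔ J)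
    have hmk : Ideal.Quotient.mk P x = Ideal.Quotient.mk P y := by
      rw [Ideal.Quotient.mk_eq_mk_iff_sub_mem, ← hxy, add_sub_cancel_right]
      exact ha
    rw [hmk] at hx ⊢
    have hyJ := (hJ y).1 hy
    have h1 : (σ ^ d) y = y := by
      refine sub_eq_zero.1 (hzero _ fun i hi => ?_)
      rw [map_sub]
      rcases Nat.eq_zero_or_pos i with rfl | hi0
      · exact (Ideal.Quotient.mk_eq_mk_iff_sub_mem _ _).1 hx
      · refine P.sub_mem ?_ (hyJ i hi0 hi)
        rw [← alg_pow_add_apply, add_comm, alg_pow_add_apply, hdP]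
        exact hyJ i hi0 hi
    obtain ⟨r, hr⟩ := h.fixed (∑ i ∈ Finset.range d, (σ ^ i) y) (by
      rw [map_sum]
      simp only [alg_pow_succ_apply]
      rw [sum_range_shift (fun i => (σ ^ i) y), h1, pow_zero, AlgEquiv.one_apply, sub_self, add_zero])
    refine ⟨r, ?_⟩
    have h2 : algebraMap F (L ⧸ P) r = Ideal.Quotient.mk P (algebraMap F L r) := rfl
    obtain ⟨k, hk⟩ := Nat.exists_eq_succ_of_ne_zero hd0.ne'
    rw [h2, hr, Ideal.Quotient.mk_eq_mk_iff_sub_mem, hk, Nat.succ_eq_add_one, Finset.sum_range_succ',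
      pow_zero, AlgEquiv.one_apply, add_sub_cancel_right]
    exact P.sum_mem fun i hi => hyJ (i + 1) (Nat.succ_pos i)
      (by rw [Finset.mem_range] at hi; omega)
  have hord : orderOf τ ∣ p ^ e := by
    refine orderOf_dvd_of_pow_eq_one (AlgEquiv.ext fun x => ?_)
    obtain ⟨x, rfl⟩ := Ideal.Quotient.mk_surjective x
    rw [hτ, mul_comm, pow_mul, h.pow_eq_one, one_pow]
    rfl
  obtain ⟨s, hs, hs2⟩ := (Nat.dvd_prime_pow hp).1 hord
  refine ⟨L ⧸ P, inferInstance, inferInstance, Ideal.Quotient.mkₐ F P, τ, s, hfinE, hfix, ?_, hs⟩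
  rw [← orderOf_eq_finrank_of_fixed hfix, hs2]

end CyclicQuotient

/-! ### Cyclic algebras over fields -/

section CyclicAlgebra

variable {F : Type u} {B : Type w} [Field F] [Ring B] [Algebra F B]

/-- A cyclic algebra has the expected matrix representation over its cyclic subalgebra. -/
theorem IsCyclicAlg.exists_algHom_matrix {L : Type w} [CommRing L] [Algebra F L] {σ : L ≃ₐ[F] L}
    {c : Fˣ} {m : ℕ} (h : IsCyclicAlg F L B σ c m) :
    Nonempty (B →ₐ[F] Matrix (Fin m) (Fin m) L) := by
  obtain ⟨ι, z, hz, -, hbij⟩ := h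
  -- With L acting on the right, B is free of rank m with basis the powers of z, and left
  -- multiplication is L-linear.
  let _ : Module L B := Module.compHom B (rightMul ι).toRingHom
  have hs : ∀ (x : L) (b : B), x • b = b * ι x := fun _ _ => rfl
  have : IsScalarTower F L B := ⟨fun r x b => by
    rw [hs, hs, map_smul, mul_smul_comm]⟩
  have : SMulCommClass B L B := ⟨fun a x b => by
    rw [smul_eq_mul, smul_eq_mul, hs, hs, mul_assoc]⟩
  have : SMulCommClass L B B := SMulCommClass.symm _ _ _
  have hzn : ∀ (n : ℕ) (x : L), z ^ n * ι x = ι ((σ ^ n) x) * z ^ n := by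
    intro n x
    induction n generalizing x with
    | zero => simp
    | succ n ih =>
      rw [pow_succ, mul_assoc, hz, ← mul_assoc, ih, pow_succ, AlgEquiv.mul_apply, mul_assoc]
  let g : (Fin m → L) →ₗ[L] B := Fintype.linearCombination L (fun i : Fin m => z ^ (i : ℕ))
  have hg : ∀ y, g y = ∑ i : Fin m, ι ((σ ^ (i : ℕ)) (y i)) * z ^ (i : ℕ) := by
    intro y
    rw [Fintype.linearCombination_apply]
    exact Finset.sum_congr rfl fun i _ => by rw [hs, hzn]
  have hgbij : Function.Bijective g := by
    have h1 : Function.Bijective fun (y : Fin m → L) (i : Fin m) => (σ ^ (i : ℕ)) (y i) :=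
      (Equiv.piCongrRight fun i : Fin m => (σ ^ (i : ℕ)).toEquiv).bijective
    have h2 := hbij.comp h1
    convert h2 using 1
    funext y
    exact hg y
  let β : Module.Basis (Fin m) L B := Module.Basis.ofEquivFun (LinearEquiv.ofBijective g hgbij).symm
  exact ⟨((LinearMap.toMatrixAlgEquiv β).toAlgHom.restrictScalars F).comp (Algebra.lsmul F L B)⟩

/-- A cyclic extension field of degree `m` inside a central simple algebra of degree `m`, normalized
by a unit, presents it as a cyclic algebra. -/
theorem exists_isCyclicAlg_of_normalizer [FiniteDimensional F B] [Nontrivial B]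
    [Algebra.IsCentral F B] {E : Type w} [Field E] [Algebra F E] [FiniteDimensional F E]
    {τ : E ≃ₐ[F] E} (hτ : ∀ x, τ x = x → x ∈ (algebraMap F E).range) {m : ℕ}
    (hE : Module.finrank F E = m) (hB : Module.finrank F B = m ^ 2) (ι : E →ₐ[F] B) {z : B}
    (hz : IsUnit z) (hzι : ∀ x, z * ι x = ι (τ x) * z) : ∃ c : Fˣ, IsCyclicAlg F E B τ c m := by
  have hord : orderOf τ = m := by rw [orderOf_eq_finrank_of_fixed hτ, hE]
  have hgal : IsGalois F E := (zpowers_eq_top_of_fixed hτ).1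
  have hzn : ∀ (n : ℕ) (x : E), z ^ n * ι x = ι ((τ ^ n) x) * z ^ n := by
    intro n x
    induction n generalizing x with
    | zero => simp
    | succ n ih =>
      rw [pow_succ, mul_assoc, hzι, ← mul_assoc, ih, pow_succ, AlgEquiv.mul_apply, mul_assoc]
  let _ : Module E B := Module.compHom B ι.toRingHom
  have hs : ∀ (x : E) (b : B), x • b = ι x * b := fun _ _ => rfl
  let pb := Field.powerBasisOfFiniteOfSeparable F E
  -- z^i is an eigenvector of right multiplication by a primitive element, with eigenvalue its image
  -- under τ^i. These are distinct, so the powers of z are independent over E.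
  let f : Module.End E B :=
    { toFun := fun b => b * ι pb.gen
      map_add' := fun a b => add_mul a b _
      map_smul' := fun x b => by rw [hs, RingHom.id_apply, hs, mul_assoc] }
  have hli : LinearIndependent E (fun i : Fin m => z ^ (i : ℕ)) := by
    refine Module.End.eigenvectors_linearIndependent' f (fun i : Fin m => (τ ^ (i : ℕ)) pb.gen) ?_ _
      fun i => ⟨Module.End.mem_eigenspace_iff.2 ?_, (hz.pow _).ne_zero⟩
    · intro i j hij
      refine Fin.ext (pow_injOn_Iio_orderOf (x := τ) (by rw [hord]; exact i.2)
        (by rw [hord]; exact j.2) (AlgEquiv.ext fun x => ?_))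
      have h1 : ((τ ^ (i : ℕ) : E ≃ₐ[F] E) : E →ₐ[F] E) = ((τ ^ (j : ℕ) : E ≃ₐ[F] E) : E →ₐ[F] E) :=
        pb.algHom_ext hij
      exact DFunLike.congr_fun h1 x
    · exact hzn i pb.gen
  let g : (Fin m → E) →ₗ[F] B := ∑ i : Fin m, LinearMap.mulRight F (z ^ (i : ℕ)) ∘ₗ
    ι.toLinearMap ∘ₗ LinearMap.proj i
  have hg : ∀ x, g x = ∑ i : Fin m, ι (x i) * z ^ (i : ℕ) := fun x => by simp [g]
  have hinj : Function.Injective g := by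
    refine (injective_iff_map_eq_zero g).2 fun x hx => ?_
    rw [hg] at hx
    exact funext (Fintype.linearIndependent_iff.1 hli x hx)
  have hsurj := (LinearMap.injective_iff_surjective_of_finrank_eq_finrank (f := g) (by
    rw [Module.finrank_pi_fintype, Finset.sum_const, Finset.card_univ, Fintype.card_fin,
      smul_eq_mul, hE, hB, sq])).1 hinj
  have hτm : τ ^ m = 1 := by rw [← hord, pow_orderOf_eq_one]
  have hcen : z ^ m ∈ Subalgebra.center F B := by
    refine Subalgebra.mem_center_iff.2 fun b => ?_
    obtain ⟨x, rfl⟩ := hsurj b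
    rw [hg, Finset.sum_mul, Finset.mul_sum]
    refine Finset.sum_congr rfl fun i _ => ?_
    rw [← mul_assoc, hzn, hτm, AlgEquiv.one_apply, mul_assoc, mul_assoc,
      ← pow_add, ← pow_add, add_comm]
  rw [Algebra.IsCentral.center_eq_bot] at hcen
  obtain ⟨c, hc⟩ := Algebra.mem_bot.1 hcen
  have hc0 : c ≠ 0 := by
    rintro rfl
    exact (hz.pow m).ne_zero (by rw [← hc, map_zero])
  refine ⟨Units.mk0 c hc0, ι, z, hzι, hc.symm, ?_⟩
  have h1 : Function.Bijective g := ⟨hinj, hsurj⟩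
  convert h1 using 1
  funext x
  exact (hg x).symm

/-- A central simple algebra of degree `m` split by a cyclic extension of degree `m` is cyclic. -/
theorem exists_isCyclicAlg_of_splitBy [FiniteDimensional F B] [IsSimpleRing B]
    [Algebra.IsCentral F B] {E : Type v} [Field E] [Algebra F E] [FiniteDimensional F E]
    {τ : E ≃ₐ[F] E} (hτ : ∀ x, τ x = x → x ∈ (algebraMap F E).range) {m : ℕ}
    (hE : Module.finrank F E = m) (hB : Module.finrank F B = m ^ 2) (hsplit : SplitBy F E B) :
    ∃ (L : Type w) (_ : CommRing L) (_ : Algebra F L) (σ : L ≃ₐ[F] L) (c : Fˣ),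
      IsCyclicGaloisAlg F L σ m ∧ IsCyclicAlg F L B σ c m ∧ IsField L := by
  obtain ⟨ι⟩ := hsplit.exists_algHom (by rw [hB, hE])
  obtain ⟨z, hz, hzι⟩ := hsplit.exists_conj (ι.comp (τ : E →ₐ[F] E)) ι
  -- E embeds in B, so it has a copy in the universe of B.
  have : Small.{w} E := small_of_injective ι.toRingHom.injective
  let f : Shrink.{w} E ≃ₐ[F] E := Shrink.algEquiv F E
  let σ : Shrink.{w} E ≃ₐ[F] Shrink.{w} E := (f.trans τ).trans f.symm
  have hσ : ∀ x, f (σ x) = τ (f x) := fun x => f.apply_symm_apply _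
  have hσfix : ∀ x, σ x = x → x ∈ (algebraMap F (Shrink.{w} E)).range := by
    intro x hx
    obtain ⟨r, hr⟩ := hτ (f x) (by rw [← hσ, hx])
    exact ⟨r, f.injective (by rw [f.commutes, hr])⟩
  have hfin : FiniteDimensional F (Shrink.{w} E) := Module.Finite.equiv f.symm.toLinearEquiv
  have hrank : Module.finrank F (Shrink.{w} E) = m := by rw [f.toLinearEquiv.finrank_eq, hE]
  have hgal := (zpowers_eq_top_of_fixed hσfix).1
  obtain ⟨c, hc⟩ := exists_isCyclicAlg_of_normalizer hσfix hrank hB (ι.comp (f : _ →ₐ[F] E)) hz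
    (fun x => by
      change z * ι (f x) = ι (f (σ x)) * z
      rw [hσ]
      exact (hzι (f x)).symm)
  refine ⟨Shrink.{w} E, inferInstance, inferInstance, σ, c, ⟨?_, hrank, ?_, hσfix⟩, hc,
    Field.toIsField _⟩
  · exact ⟨Algebra.FormallyEtale.of_isSeparable F _,
      (Algebra.FinitePresentation.of_finiteType).1 inferInstance⟩
  · rw [← hrank, ← orderOf_eq_finrank_of_fixed hσfix, pow_orderOf_eq_one]

/-- A non-split cyclic algebra of degree `p^e` in characteristic `p` is a cyclic algebra with
respect to a cyclic field extension. -/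
theorem IsCyclicAlg.exists_isField (p : ℕ) [Fact p.Prime] [CharP F p] [FiniteDimensional F B]
    [IsSimpleRing B] [Algebra.IsCentral F B] {L : Type w} [CommRing L] [Algebra F L]
    {σ : L ≃ₐ[F] L} {c : Fˣ} {e : ℕ} (hL : IsCyclicGaloisAlg F L σ (p ^ e))
    (h : IsCyclicAlg F L B σ c (p ^ e)) (hB : Module.finrank F B = (p ^ e) ^ 2)
    (hns : ¬ Nonempty (B ≃ₐ[F] Matrix (Fin (p ^ e)) (Fin (p ^ e)) F)) :
    ∃ (L : Type w) (_ : CommRing L) (_ : Algebra F L) (σ : L ≃ₐ[F] L) (c : Fˣ),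
      IsCyclicGaloisAlg F L σ (p ^ e) ∧ IsCyclicAlg F L B σ c (p ^ e) ∧ IsField L := by
  have hp : p.Prime := Fact.out
  obtain ⟨ρ⟩ := h.exists_algHom_matrix
  obtain ⟨E, _, _, π, τ, s, _, hτ, hE, hse⟩ := hL.exists_quotient_field
  -- If the residue field of L were F, the matrix representation over L would reduce to one over F,
  -- and B would be split.
  have hs : 1 ≤ s := by
    by_contra hs
    obtain rfl : s = 0 := by omega
    rw [pow_zero] at hE
    refine hns ?_
    have hbij : Function.Bijective (algebraMap F E) :=
      ⟨(algebraMap F E).injective, (LinearMap.injective_iff_surjective_of_finrank_eq_finrank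
        (f := Algebra.linearMap F E) (by rw [hE, Module.finrank_self])).1 (algebraMap F E).injective⟩
    let ε : E ≃ₐ[F] F := (AlgEquiv.ofBijective (Algebra.ofId F E) hbij).symm
    let ρ' : B →ₐ[F] Matrix (Fin (p ^ e)) (Fin (p ^ e)) F :=
      (ε.toAlgHom.mapMatrix.comp π.mapMatrix).comp ρ
    have : NeZero (p ^ e) := ⟨(pow_pos hp.pos e).ne'⟩
    have hinj : Function.Injective ρ' := ρ'.toRingHom.injective
    refine ⟨AlgEquiv.ofBijective ρ' ⟨hinj, ?_⟩⟩
    refine (LinearMap.injective_iff_surjective_of_finrank_eq_finrank (f := ρ'.toLinearMap) ?_).1 hinj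
    rw [hB, Module.finrank_matrix, Module.finrank_self, mul_one, Fintype.card_fin, sq]
  obtain ⟨E', _, _, f, τ', _, hτ', hE'⟩ := exists_cyclic_extension p hτ hs hE (e - s)
  rw [Nat.add_sub_cancel' hse] at hE'
  exact exists_isCyclicAlg_of_splitBy hτ' hE' hB
    (splitBy_of_algHom (pow_pos hp.pos e).ne' hB ((f.comp π).mapMatrix.comp ρ))

end CyclicAlgebra

end

/-! ### The theorem -/

theorem mainTheorem3 (p : ℕ) [Fact p.Prime] {F : Type u} {K : Type v} {B : Type w}
    [Field F] [CharP F p] [Field K] [Algebra F K]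
    [IsPurelyInseparable.HasExponent F K] (hK : IsPurelyInseparable.exponent F K = 1)
    [Ring B] [Algebra F B] (hB : IsPAlgebra p F B)
    (m : ℕ) (hBm : Module.finrank F B = m ^ 2) (hKm : Module.finrank F K = m)
    (hsplit : SplitBy F K B) :
    ∃ e : ℕ, 1 ≤ e ∧ m = p ^ e ∧
      -- `B` is a differential extension of `K`
      (∃ (δ : Derivation F K K) (d₀ : F), HasConstants δ ∧ (derivMinpoly δ).natDegree = m ∧
        Nonempty (DiffExt δ d₀ ≃ₐ[F] B)) ∧
      -- `B` is cyclic
      (∃ (L : Type w) (_ : CommRing L) (_ : Algebra F L) (σ : L ≃ₐ[F] L) (c : Fˣ),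
        IsCyclicGaloisAlg F L σ m ∧ IsCyclicAlg F L B σ c m ∧
        ((¬ Nonempty (B ≃ₐ[F] Matrix (Fin m) (Fin m) F) ∨
          ∃ (E : Type u) (_ : Field E) (_ : Algebra F E), IsGalois F E ∧ IsCyclic Gal(E/F) ∧
            Module.finrank F E = m) → IsField L)) ∧
      -- properties of every presentation of `B` as a differential extension of `K`
      ∀ (δ : Derivation F K K) (d₀ : F), HasConstants δ → (derivMinpoly δ).natDegree = m →
        ∀ φ : DiffExt δ d₀ ≃ₐ[F] B,
          -- the minimum polynomial of `δ` is `t^{p^e} + c₁ t^{p^{e-1}} + ⋯ + c_e t`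
          (∃ c : ℕ → F, derivMinpoly δ = Polynomial.X ^ p ^ e +
            ∑ i ∈ Finset.Icc 1 e, Polynomial.C (c i) * Polynomial.X ^ p ^ (e - i)) ∧
          -- `f` is central and the center of `K[t;δ]` is `F[z]` with `z = f = g - d₀`
          extDiffPoly δ d₀ ∈ Subalgebra.center F (DiffPoly δ) ∧
          Subalgebra.center F (DiffPoly δ) = Algebra.adjoin F {extDiffPoly δ d₀} ∧
          -- `F[t]/(f)` is a subfield of `B` of degree `p^e` iff `f` is irreducible in `F[t]`
          ((IsField (AdjoinRoot (extPoly δ d₀)) ∧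
              Module.finrank F (AdjoinRoot (extPoly δ d₀)) = p ^ e ∧
              ∃ ι : AdjoinRoot (extPoly δ d₀) →ₐ[F] B, Function.Injective ι ∧
                ι (AdjoinRoot.root (extPoly δ d₀)) = φ (DiffExt.root δ d₀)) ↔
            Irreducible (extPoly δ d₀)) ∧
          -- `f` is irreducible in `K[t;δ]` iff `B` is a division algebra
          (Irreducible (extDiffPoly δ d₀) ↔ IsDivisionAlg B) ∧
          -- `B` is split iff `d₀` is a value of `V_g`
          (Nonempty (B ≃ₐ[F] Matrix (Fin (p ^ e)) (Fin (p ^ e)) F) ↔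
            ∃ b : K, algebraMap F K d₀ = polyV p e δ (derivMinpoly δ) b) := by
  have hp : p.Prime := Fact.out
  have := hB.central
  have := hB.simple
  have := hB.finite
  have hm0 : m ≠ 0 := by
    rintro rfl
    exact Module.finrank_pos.ne' (hBm.trans (zero_pow two_ne_zero))
  have hfinK : FiniteDimensional F K :=
    Module.finite_of_finrank_pos (by rw [hKm]; exact Nat.pos_of_ne_zero hm0)
  have hKp : ∀ x : K, x ^ p ∈ (algebraMap F K).range := fun x => by
    have h1 := IsPurelyInseparable.exponent_def' F p x
    rwa [hK, pow_one] at h1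
  obtain ⟨e, he, hdiff, L, _, _, σ, c, hL, hLB⟩ :=
    exists_diffExt_and_isCyclicAlg p hKp (B := B) (by rw [hBm, hKm]) hsplit
  have hme : m = p ^ e := hKm.symm.trans he
  have hBe : Module.finrank F B = (p ^ e) ^ 2 := by rw [hBm, hme]
  -- For e = 0 one would have K = F, which has exponent 0 rather than 1.
  have he1 : 1 ≤ e := by
    by_contra h0
    obtain rfl : e = 0 := by omega
    obtain ⟨x, hx⟩ := IsPurelyInseparable.exponent_min' (K := F) (L := K) p (e := 0) (by omega)
    have hbij : Function.Surjective (algebraMap F K) :=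
      (LinearMap.injective_iff_surjective_of_finrank_eq_finrank
        (f := Algebra.linearMap F K) (by rw [he, pow_zero, Module.finrank_self])).1
        (algebraMap F K).injective
    exact hx (hbij _)
  subst hme
  refine ⟨e, he1, rfl, hdiff, ?_, fun δ d₀ hδ hδm φ => ⟨?_, ?_, ?_, ?_, ?_, ?_⟩⟩
  · by_cases hcond : ¬ Nonempty (B ≃ₐ[F] Matrix (Fin (p ^ e)) (Fin (p ^ e)) F) ∨
        ∃ (E : Type u) (_ : Field E) (_ : Algebra F E), IsGalois F E ∧ IsCyclic Gal(E/F) ∧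
          Module.finrank F E = p ^ e
    · suffices h : ∃ (L : Type w) (_ : CommRing L) (_ : Algebra F L) (σ : L ≃ₐ[F] L) (c : Fˣ),
          IsCyclicGaloisAlg F L σ (p ^ e) ∧ IsCyclicAlg F L B σ c (p ^ e) ∧ IsField L by
        obtain ⟨L, i1, i2, σ, c, h1, h2, h3⟩ := h
        exact ⟨L, i1, i2, σ, c, h1, h2, fun _ => h3⟩
      -- If B is split, any cyclic field E of degree m splits it and can serve as L; otherwise such
      -- a field is built from the residue field of the algebra L already found.
      by_cases hns : Nonempty (B ≃ₐ[F] Matrix (Fin (p ^ e)) (Fin (p ^ e)) F)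
      · obtain ⟨E, _, _, hgal, hcyc, hE⟩ := hcond.resolve_left (not_not.2 hns)
        obtain ⟨ε⟩ := hns
        have hfinE : FiniteDimensional F E :=
          Module.finite_of_finrank_pos (by rw [hE]; exact Nat.pos_of_ne_zero hm0)
        obtain ⟨τ, hτ⟩ := hcyc.exists_zpow_surjective
        exact exists_isCyclicAlg_of_splitBy (τ := τ)
          (fixed_of_zpowers_eq_top (eq_top_iff.2 fun g _ => hτ g)) hE hBm
          (splitBy_of_algHom hm0 hBm ((Algebra.ofId F E).mapMatrix.comp ε.toAlgHom))
      · exact hLB.exists_isField p hL hBe hns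
    · exact ⟨L, inferInstance, inferInstance, σ, c, hL, hLB, fun h => absurd h hcond⟩
  · refine ⟨fun i => (derivMinpoly δ).coeff (p ^ (e - i)), ?_⟩
    have hlead : (derivMinpoly δ).coeff (p ^ e) = 1 := by
      rw [← hδm]
      exact minpoly.monic (Algebra.IsIntegral.isIntegral _)
    conv_lhs => rw [derivMinpoly_eq_sum p hδ hδm, ← Finset.sum_range_reflect,
      Finset.sum_range_succ']
    rw [add_comm, ← Finset.Ico_add_one_right_eq_Icc, Finset.sum_Ico_eq_sum_range]
    simp only [Nat.add_sub_cancel, Nat.sub_zero, hlead, C_1, one_mul]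
    congr 1
    exact Finset.sum_congr rfl fun i _ => by rw [add_comm i 1]
  · exact DiffPoly.extDiffPoly_mem_center p hδ hδm d₀
  · exact DiffPoly.center_eq_adjoin p hδ hδm d₀
  · have h1 := DiffExt.isField_adjoinRoot_iff (δ := δ) (d₀ := d₀) (by rw [hδm]; exact hm0)
      (φ : DiffExt δ d₀ →ₐ[F] B)
    rw [hδm] at h1
    exact h1
  · rw [DiffExt.irreducible_iff p hδ hδm d₀]
    constructor
    · rintro ⟨_, h2⟩
      refine ⟨inferInstance, fun x hx => ?_⟩
      have h3 := (h2 (φ.symm x) (by rwa [Ne, map_eq_zero_iff _ φ.symm.injective])).map φ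
      rwa [φ.apply_symm_apply] at h3
    · rintro ⟨_, h2⟩
      refine ⟨φ.toEquiv.nontrivial, fun x hx => ?_⟩
      have h3 := (h2 (φ x) (by rwa [Ne, map_eq_zero_iff _ φ.injective])).map φ.symm
      rwa [φ.symm_apply_apply] at h3
  · have hs : IsSimpleRing (DiffExt δ d₀) := IsSimpleRing.of_ringEquiv φ.symm.toRingEquiv hB.simple
    have hfin : Module.finrank F (DiffExt δ d₀) = (p ^ e) ^ 2 := by
      rw [φ.toLinearEquiv.finrank_eq, hBm]
    rw [← DiffExt.nonempty_algEquiv_matrix_iff p hδ hδm hKm d₀ hs hfin]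
    exact ⟨fun ⟨ψ⟩ => ⟨φ.trans ψ⟩, fun ⟨ψ⟩ => ⟨φ.symm.trans ψ⟩⟩
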